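/- **Balanced braided categories.** A braided monoidal category $(\mathcal B,\otimes,I,c)$ is *balanced* if it is equipped with a natural automorphism $\theta$ of the identity functor such that $\theta_I=1_I$ and $\theta_{X\otimes Y}=c_{Y,X}\circ(\theta_Y\otimes\theta_X)\circ c_{X,Y}$ for all $X,Y$. The opposite $\mathcal B^{op}$ is balanced braided monoidal with the opposite tensor product, braiding and twist. **The category $\mathbf D\otimes\mathbf{RB}$.** Let $RB_n=\mathbb Z^n\rtimes B_n$ be the ribbon braid group on $n$ ribbons, where the braid group $B_n$ permutes the coordinates of $\mathbb Z^n$ (which count the full twists of the individual ribbons) through $B_n\to S_n$. For an order-preserving map $\varphi:\{1,\dots,n\}\to\{1,\dots,m\}$ and $j\in RB_m$, let $j_\star\varphi$ be the order-preserving map whose fibres are those of $\varphi$ permuted by the permutation of $j$, and let $\varphi^\star j\in RB_n$ be obtained from $j$ by replacing the $i$-th ribbon by $|\varphi^{-1}(i)|$ parallel ribbons; thus crossings of ribbons become crossings of blocks of parallel ribbons, and a full twist of a ribbon becomes a full twist of the whole block, regarded as one wide ribbon. The objects of $\mathbf D\otimes\mathbf{RB}$ are the integers $n\ge 0$; the morphisms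 $n\to m$ are the pairs $(\varphi,j)$ with $\varphi:\{1,\dots,n\}\to\{1,\dots,m\}$ order-preserving and $j\in RB_n$; and composition is $$(\psi,k)\circ(\varphi,j)=\bigl(\psi\circ k_\star\varphi,\;\varphi^\star k\cdot j\bigr).$$ This is a strict monoidal category under addition of objects and juxtaposition of morphisms, and it is balanced braided: the braiding $n\otimes m\to m\otimes n$ is the crossing of a block of $n$ parallel ribbons with a block of $m$ parallel ribbons, and the twist on $n$ is the full twist of $n$ parallel ribbons. **The category $\mathbf D\otimes\mathbf{RB}\otimes\mathbf G$.** For a group $G$, the balanced strict monoidal category $\mathbf D\otimes\mathbf{RB}\otimes\mathbf G$ is defined in the same way, with $RB_n$ replaced by the group $G^n\rtimes RB_n$ of ribbon braids whose ribbons are labelled by elements of $G$. In $\varphi^\star j$, each of the ribbons parallel to a given ribbon receives the label of that ribbon; all labels of the braiding and of the twist are $1$. **Algebras.** For balanced braided monoidal categories $\mathcal Q$ and $\mathcal B$, let $\mathrm{Alg}(\mathcal Q,\mathcal B)$ be the category whose objects are the strong monoidal functors $F:\mathcal Q\to\mathcal B$ that preserve the braiding and the twist ($F(\theta_X)=\theta_{F(X)}$),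 and whose morphisms are the monoidal natural transformations. Such a functor is *strict* if its structure maps $I\to F(I)$ and $F(X)\otimes F(Y)\to F(X\otimes Y)$ are identities. If the monoidal categories $\mathcal Q$ and $\mathcal B$ are strict, let $\mathrm{Alg}_{\mathrm{str}}(\mathcal Q,\mathcal B)$ be the full subcategory of $\mathrm{Alg}(\mathcal Q,\mathcal B)$ on the strict functors. Let $\mathrm{Mon}(\mathcal B)$ and $\mathrm{Comon}(\mathcal B)$ be the categories of monoids and comonoids in $\mathcal B$. For a group $G$, regarded as a category with one object, let $G\mathrm{Mon}(\mathcal B)=\mathrm{Fun}(G,\mathrm{Mon}(\mathcal B))$ and $G\mathrm{Comon}(\mathcal B)=\mathrm{Fun}(G,\mathrm{Comon}(\mathcal B))$ be the categories of $G$-monoids and $G$-comonoids. **Proposition.** Let $\mathcal B$ be a balanced braided monoidal category and let $G$ be a group. Then there are equivalences of categories 1. $\mathrm{Alg}(\mathbf D\otimes\mathbf{RB},\mathcal B)\simeq\mathrm{Mon}(\mathcal B)$, 2. $\mathrm{Alg}(\mathbf D\otimes\mathbf{RB}\otimes\mathbf G,\mathcal B)\simeq G\mathrm{Mon}(\mathcal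 B)$, 3. $\mathrm{Alg}((\mathbf D\otimes\mathbf{RB})^{op},\mathcal B)\simeq\mathrm{Comon}(\mathcal B)$, 4. $\mathrm{Alg}((\mathbf D\otimes\mathbf{RB}\otimes\mathbf G)^{op},\mathcal B)\simeq G\mathrm{Comon}(\mathcal B)$. If the monoidal category $\mathcal B$ is strict, then the same four equivalences also hold with $\mathrm{Alg}_{\mathrm{str}}$ in place of $\mathrm{Alg}$. -/

import Mathlib

universe u v w

namespace RibbonPROB

open Equiv (Perm)

variable {n m l n' m' : ℕ}

/-- The disjoint union (ordinal sum) of two order-preserving maps. -/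
def ordTensor (φ : Fin n →o Fin m) (ψ : Fin n' →o Fin m') : Fin (n + n') →o Fin (m + m') where
  toFun x := if h : (x : ℕ) < n then ⟨φ ⟨x, h⟩, by omega⟩
    else ⟨m + ψ ⟨x - n, by omega⟩, by omega⟩
  monotone' x y hxy := by
    have hxy' : (x : ℕ) ≤ y := hxy
    simp only [Fin.le_def]
    split_ifs with h1 h2 h2
    · exact φ.monotone (show (⟨x, h1⟩ : Fin n) ≤ ⟨y, h2⟩ from hxy')
    · have := (φ ⟨x, h1⟩).isLt
      show (φ ⟨x, h1⟩ : ℕ) ≤ m + _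
      omega
    · omega
    · exact Nat.add_le_add_left (ψ.monotone
        (show (⟨x - n, by omega⟩ : Fin n') ≤ ⟨y - n, by omega⟩ from Nat.sub_le_sub_right hxy' n)) m

theorem ordTensor_left (φ : Fin n →o Fin m) (ψ : Fin n' →o Fin m') (x : Fin (n + n'))
    (h : (x : ℕ) < n) : (ordTensor φ ψ x : ℕ) = φ ⟨x, h⟩ :=
  congrArg Fin.val (dif_pos h)
theorem ordTensor_right (φ : Fin n →o Fin m) (ψ : Fin n' →o Fin m') (x : Fin (n + n'))
    (h : n ≤ (x : ℕ)) : (ordTensor φ ψ x : ℕ) = m + ψ ⟨x - n, by omega⟩ :=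
  congrArg Fin.val (dif_neg (not_lt.2 h))

/-- The identity map between two equal ordinals. -/
def ordCast (h : n = m) : Fin n →o Fin m := ⟨Fin.cast h, fun _ _ hxy => hxy⟩

@[simp] theorem ordCast_val (h : n = m) (x : Fin n) : (ordCast h x : ℕ) = x := rfl

/-- For a permutation `π` of the target of an order-preserving map `φ`, the order-preserving map
`π_⋆ φ` obtained by sorting the values of `π ∘ φ`. It is the unique order-preserving map whose fibre
over `π i` has as many elements as the fibre of `φ` over `i`. -/
def permAct (π : Perm (Fin m)) (φ : Fin n →o Fin m) : Fin n →o Fin m :=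
  ⟨(π ∘ φ) ∘ Tuple.sort (π ∘ φ), Tuple.monotone_sort _⟩

theorem permAct_spec (π : Perm (Fin m)) (φ : Fin n →o Fin m) :
    ∃ ρ : Perm (Fin n), ∀ x, permAct π φ (ρ x) = π (φ x) :=
  ⟨(Tuple.sort (π ∘ φ))⁻¹, fun x => by simp [permAct]⟩

/-- Uniqueness of sorting: any order-preserving rearrangement of `π ∘ φ` is `permAct π φ`. -/
theorem permAct_eq {π : Perm (Fin m)} {φ χ : Fin n →o Fin m} (ρ : Perm (Fin n))
    (h : ∀ x, χ (ρ x) = π (φ x)) : permAct π φ = χ := by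
  have h1 : (π ∘ φ) ∘ (ρ⁻¹ : Perm (Fin n)) = χ := by
    funext x
    simp [← h]
  ext1
  show (π ∘ φ) ∘ Tuple.sort (π ∘ φ) = χ
  rw [← h1]
  exact Tuple.unique_monotone (Tuple.monotone_sort _) (h1 ▸ χ.monotone)

theorem permAct_one (φ : Fin n →o Fin m) : permAct 1 φ = φ := permAct_eq 1 fun _ => rfl

theorem permAct_mul (π π' : Perm (Fin m)) (φ : Fin n →o Fin m) :
    permAct (π * π') φ = permAct π (permAct π' φ) := by
  obtain ⟨ρ, hρ⟩ := permAct_spec π' φ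
  obtain ⟨ρ', hρ'⟩ := permAct_spec π (permAct π' φ)
  exact permAct_eq (ρ' * ρ) fun x => by simp [hρ, hρ']

/-- The number of elements that `φ` sends below `i`. The fibre of `φ` over `i` is the interval
`[cut φ i, cut φ (i + 1))`. -/
def cut (φ : Fin n →o Fin m) (i : ℕ) : ℕ := (Finset.univ.filter fun x => (φ x : ℕ) < i).card

theorem lt_cut_iff (φ : Fin n →o Fin m) (i : ℕ) (x : Fin n) : (x : ℕ) < cut φ i ↔ (φ x : ℕ) < i := by
  have h : Monotone (fun x => (φ x : ℕ)) := fun a b hab => φ.monotone hab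
  exact Tuple.lt_card_lt_iff_apply_lt_of_monotone (f := fun x => (φ x : ℕ)) h

theorem cut_le (φ : Fin n →o Fin m) (i : ℕ) : cut φ i ≤ n := by
  simpa [cut] using Finset.card_le_univ (Finset.univ.filter fun x => (φ x : ℕ) < i)

theorem cut_mono (φ : Fin n →o Fin m) {i j : ℕ} (h : i ≤ j) : cut φ i ≤ cut φ j :=
  Finset.card_le_card fun x hx => by
    simp only [Finset.mem_filter, Finset.mem_univ, true_and] at hx ⊢; omega

theorem card_below (c : ℕ) (h : c ≤ n) :
    (Finset.univ.filter fun x : Fin n => (x : ℕ) < c).card = c := by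
  rw [Fin.card_filter_val_lt]; omega

theorem cut_eq (φ : Fin n →o Fin m) (i c : ℕ) (hc : c ≤ n)
    (h : ∀ x : Fin n, (φ x : ℕ) < i ↔ (x : ℕ) < c) : cut φ i = c := by
  rw [cut, ← card_below c hc]
  congr 1; ext x; simp [h]

theorem cut_zero (φ : Fin n →o Fin m) : cut φ 0 = 0 := cut_eq _ _ _ (by omega) (by simp)
theorem cut_top (φ : Fin n →o Fin m) : cut φ m = n :=
  cut_eq _ _ _ le_rfl fun x => by simp
theorem cut_comp (ψ : Fin m →o Fin l) (φ : Fin n →o Fin m) (i : ℕ) :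
    cut (ψ.comp φ) i = cut φ (cut ψ i) :=
  cut_eq _ _ _ (cut_le _ _) fun x => by
    rw [lt_cut_iff, lt_cut_iff]; rfl
theorem cut_id (i : ℕ) (h : i ≤ n) : cut (OrderHom.id : Fin n →o Fin n) i = i :=
  cut_eq _ _ _ h fun _ => Iff.rfl

theorem cut_tensor_left (φ : Fin n →o Fin m) (ψ : Fin n' →o Fin m') (i : ℕ) (h : i ≤ m) :
    cut (ordTensor φ ψ) i = cut φ i := by
  refine cut_eq _ _ _ ((cut_le _ _).trans (by omega)) fun x => ?_
  have := cut_le φ i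
  rcases Nat.lt_or_ge x n with hx | hx
  · rw [ordTensor_left _ _ _ hx, ← lt_cut_iff]
  · rw [ordTensor_right _ _ _ hx]; omega

theorem cut_tensor_right (φ : Fin n →o Fin m) (ψ : Fin n' →o Fin m') (i : ℕ) :
    cut (ordTensor φ ψ) (m + i) = n + cut ψ i := by
  have h1 := cut_le ψ i
  refine cut_eq _ _ _ (by omega) fun x => ?_
  rcases Nat.lt_or_ge x n with hx | hx
  · rw [ordTensor_left _ _ _ hx]
    have := (φ ⟨x, hx⟩).isLt; omega
  · rw [ordTensor_right _ _ _ hx]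
    have := lt_cut_iff ψ i ⟨x - n, by omega⟩
    simp only at this
    omega

theorem cut_permAct (π : Perm (Fin m)) (φ : Fin n →o Fin m) (k : ℕ) :
    cut (permAct π φ) k = (Finset.univ.filter fun x => (π (φ x) : ℕ) < k).card := by
  obtain ⟨ρ, hρ⟩ := permAct_spec π φ
  rw [cut]
  refine (Finset.card_bij (fun x _ => ρ x) ?_ ?_ ?_).symm
  · intro x hx; simpa [hρ] using hx
  · intro x _ y _ h; exact ρ.injective h
  · intro y hy
    refine ⟨ρ⁻¹ y, ?_, by simp⟩
    simpa [← hρ] using hy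

theorem cut_permAct_of (π : Perm (Fin m)) (φ : Fin n →o Fin m) (k u v w : ℕ) (huv : u ≤ v)
    (hvw : v ≤ w)
    (h : ∀ y : Fin m, (π y : ℕ) < k ↔ (y : ℕ) < u ∨ (v ≤ (y : ℕ) ∧ (y : ℕ) < w)) :
    cut (permAct π φ) k = cut φ u + (cut φ w - cut φ v) := by
  rw [cut_permAct]
  have h1 : (Finset.univ.filter fun x => (π (φ x) : ℕ) < k) =
      (Finset.univ.filter fun x => (φ x : ℕ) < u) ∪
      ((Finset.univ.filter fun x => (φ x : ℕ) < w) \ (Finset.univ.filter fun x => (φ x : ℕ) < v)) := by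
    ext x; simp only [Finset.mem_filter, Finset.mem_univ, true_and, Finset.mem_union,
      Finset.mem_sdiff, h]; omega
  rw [h1, Finset.card_union_of_disjoint, Finset.card_sdiff_of_subset]
  · rfl
  · intro x; simp only [Finset.mem_filter, Finset.mem_univ, true_and]; omega
  · rw [Finset.disjoint_left]; intro x
    simp only [Finset.mem_filter, Finset.mem_univ, true_and, Finset.mem_sdiff]; omega

/-- Generators of the ribbon braid group on `n` ribbons (numbered from `0`): the crossing `σ_i` of
the ribbons in positions `i` and `i + 1`, and the full twist `τ_i` of the ribbon in position `i`. -/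
inductive RibbonGen (n : ℕ) : Type
  | cross (i : ℕ) (h : i + 1 < n) : RibbonGen n
  | twist (i : ℕ) (h : i < n) : RibbonGen n

open FreeGroup in
/-- The relations of the ribbon braid group, written `x y⁻¹` for `x = y`: the Artin relations of the
braid group, commutation of the twists, and `σ_i τ_i = τ_{i+1} σ_i`, `σ_i τ_{i+1} = τ_i σ_i`,
`σ_i τ_j = τ_j σ_i` otherwise. This is the standard presentation of `ℤ^n ⋊ B_n`, where `B_n` acts on
`ℤ^n` through the underlying permutations. -/
inductive RibbonRel (n : ℕ) : FreeGroup (RibbonGen n) → Prop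
  | far (i j : ℕ) (hi : i + 1 < j) (hj : j + 1 < n) : RibbonRel n
      (of (.cross i (by omega)) * of (.cross j hj) *
        (of (.cross j hj) * of (.cross i (by omega)))⁻¹)
  | braid (i : ℕ) (h : i + 2 < n) : RibbonRel n
      (of (.cross i (by omega)) * of (.cross (i + 1) h) * of (.cross i (by omega)) *
        (of (.cross (i + 1) h) * of (.cross i (by omega)) * of (.cross (i + 1) h))⁻¹)
  | twists (i j : ℕ) (hi : i < n) (hj : j < n) : RibbonRel n
      (of (.twist i hi) * of (.twist j hj) * (of (.twist j hj) * of (.twist i hi))⁻¹)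
  | left (i : ℕ) (h : i + 1 < n) : RibbonRel n
      (of (.cross i h) * of (.twist i (by omega)) *
        (of (.twist (i + 1) h) * of (.cross i h))⁻¹)
  | right (i : ℕ) (h : i + 1 < n) : RibbonRel n
      (of (.cross i h) * of (.twist (i + 1) h) *
        (of (.twist i (by omega)) * of (.cross i h))⁻¹)
  | apart (i j : ℕ) (h : i + 1 < n) (hj : j < n) (h1 : j ≠ i) (h2 : j ≠ i + 1) : RibbonRel n
      (of (.cross i h) * of (.twist j hj) * (of (.twist j hj) * of (.cross i h))⁻¹)

/-- The ribbon braid group on `n` ribbons, `RB_n = ℤ^n ⋊ B_n`. -/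
def RB (n : ℕ) : Type := PresentedGroup {r | RibbonRel n r}

instance (n : ℕ) : Group (RB n) := inferInstanceAs (Group (PresentedGroup {r | RibbonRel n r}))

namespace RB

variable {n m N : ℕ}

/-- The class of a generator. -/
def gen (g : RibbonGen n) : RB n := PresentedGroup.of g

/-- Induction over words in the generators. -/
theorem induction {P : RB n → Prop} (one : P 1) (hgen : ∀ g, P (gen g))
    (mul : ∀ x y, P x → P y → P (x * y)) (inv : ∀ x, P x → P x⁻¹) (x : RB n) : P x := by
  let H : Subgroup (PresentedGroup {r | RibbonRel n r}) :=
    { carrier := {x | P x}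
      mul_mem' := fun {a b} ha hb => mul a b ha hb
      one_mem' := one
      inv_mem' := fun {a} ha => inv a ha }
  exact PresentedGroup.generated_by _ H hgen x

/-- The universal property of the presentation. -/
def lift {H : Type*} [Group H] (f : RibbonGen n → H)
    (far : ∀ i j (hi : i + 1 < j) (hj : j + 1 < n),
      f (.cross i (by omega)) * f (.cross j hj) = f (.cross j hj) * f (.cross i (by omega)))
    (braid : ∀ i (h : i + 2 < n),
      f (.cross i (by omega)) * f (.cross (i + 1) h) * f (.cross i (by omega)) =
        f (.cross (i + 1) h) * f (.cross i (by omega)) * f (.cross (i + 1) h))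
    (twists : ∀ i j (hi : i < n) (hj : j < n),
      f (.twist i hi) * f (.twist j hj) = f (.twist j hj) * f (.twist i hi))
    (left : ∀ i (h : i + 1 < n), f (.cross i h) * f (.twist i (by omega)) =
      f (.twist (i + 1) h) * f (.cross i h))
    (right : ∀ i (h : i + 1 < n), f (.cross i h) * f (.twist (i + 1) h) =
      f (.twist i (by omega)) * f (.cross i h))
    (apart : ∀ i j (h : i + 1 < n) (hj : j < n), j ≠ i → j ≠ i + 1 →
      f (.cross i h) * f (.twist j hj) = f (.twist j hj) * f (.cross i h)) : RB n →* H :=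
  PresentedGroup.toGroup (f := f) (by
    intro r hr
    rcases hr with ⟨i, j, hi, hj⟩ | ⟨i, h⟩ | ⟨i, j, hi, hj⟩ | ⟨i, h⟩ | ⟨i, h⟩ | ⟨i, j, h, hj, h1, h2⟩ <;>
      rw [map_mul, map_inv, mul_inv_eq_one] <;>
      simp only [map_mul, FreeGroup.lift_apply_of]
    · exact far i j hi hj
    · exact braid i h
    · exact twists i j hi hj
    · exact left i h
    · exact right i h
    · exact apart i j h hj h1 h2)

@[simp] theorem lift_gen {H : Type*} [Group H] (f : RibbonGen n → H) (h1) (h2) (h3) (h4) (h5) (h6)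
    (g : RibbonGen n) : lift f h1 h2 h3 h4 h5 h6 (gen g) = f g :=
  PresentedGroup.toGroup.of _

theorem hom_ext {H : Type*} [Group H] {f g : RB n →* H} (h : ∀ x, f (gen x) = g (gen x)) : f = g :=
  PresentedGroup.ext h

theorem rel_far (i j : ℕ) (hi : i + 1 < j) (hj : j + 1 < n) :
    gen (.cross i (by omega)) * gen (.cross j hj) =
      gen (.cross j hj) * (gen (.cross i (by omega)) : RB n) :=
  PresentedGroup.mk_eq_mk_of_mul_inv_mem (RibbonRel.far i j hi hj)
theorem rel_braid (i : ℕ) (h : i + 2 < n) :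
    gen (.cross i (by omega)) * gen (.cross (i + 1) h) * gen (.cross i (by omega)) =
      gen (.cross (i + 1) h) * gen (.cross i (by omega)) * (gen (.cross (i + 1) h) : RB n) :=
  PresentedGroup.mk_eq_mk_of_mul_inv_mem (RibbonRel.braid i h)
theorem rel_twists (i j : ℕ) (hi : i < n) (hj : j < n) :
    gen (.twist i hi) * gen (.twist j hj) = gen (.twist j hj) * (gen (.twist i hi) : RB n) :=
  PresentedGroup.mk_eq_mk_of_mul_inv_mem (RibbonRel.twists i j hi hj)
theorem rel_left (i : ℕ) (h : i + 1 < n) : gen (.cross i h) * gen (.twist i (by omega)) =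
    gen (.twist (i + 1) h) * (gen (.cross i h) : RB n) :=
  PresentedGroup.mk_eq_mk_of_mul_inv_mem (RibbonRel.left i h)
theorem rel_right (i : ℕ) (h : i + 1 < n) : gen (.cross i h) * gen (.twist (i + 1) h) =
    gen (.twist i (by omega)) * (gen (.cross i h) : RB n) :=
  PresentedGroup.mk_eq_mk_of_mul_inv_mem (RibbonRel.right i h)
theorem rel_apart (i j : ℕ) (h : i + 1 < n) (hj : j < n) (h1 : j ≠ i) (h2 : j ≠ i + 1) :
    gen (.cross i h) * gen (.twist j hj) = gen (.twist j hj) * (gen (.cross i h) : RB n) :=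
  PresentedGroup.mk_eq_mk_of_mul_inv_mem (RibbonRel.apart i j h hj h1 h2)

/-- The crossing `σ_i`, extended by `1` to all indices. -/
def s (N i : ℕ) : RB N := if h : i + 1 < N then gen (.cross i h) else 1
/-- The twist `τ_i`, extended by `1` to all indices. -/
def t (N i : ℕ) : RB N := if h : i < N then gen (.twist i h) else 1

theorem gen_cross (i : ℕ) (h : i + 1 < N) : (gen (.cross i h) : RB N) = s N i := by simp [s, h]
theorem gen_twist (i : ℕ) (h : i < N) : (gen (.twist i h) : RB N) = t N i := by simp [t, h]

theorem s_far (i j : ℕ) (hi : i + 1 < j) (hj : j + 1 < N) : s N i * s N j = s N j * s N i := by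
  have := rel_far i j hi hj
  simpa only [gen_cross] using this
theorem s_braid (i : ℕ) (h : i + 2 < N) :
    s N i * s N (i + 1) * s N i = s N (i + 1) * s N i * s N (i + 1) := by
  simpa only [gen_cross] using rel_braid i h
theorem t_comm (i j : ℕ) : t N i * t N j = t N j * t N i := by
  by_cases hi : i < N
  · by_cases hj : j < N
    · simpa only [gen_twist] using rel_twists i j hi hj
    · simp [t, hj]
  · simp [t, hi]
theorem s_t_left (i : ℕ) (h : i + 1 < N) : s N i * t N i = t N (i + 1) * s N i := by
  simpa only [gen_twist, gen_cross] using rel_left i h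
theorem s_t_right (i : ℕ) (h : i + 1 < N) : s N i * t N (i + 1) = t N i * s N i := by
  simpa only [gen_twist, gen_cross] using rel_right i h
theorem s_t_apart (i j : ℕ) (hj : j < N) (h1 : j ≠ i) (h2 : j ≠ i + 1) :
    s N i * t N j = t N j * s N i := by
  by_cases h : i + 1 < N
  · simpa only [gen_twist, gen_cross] using rel_apart i j h hj h1 h2
  · simp [s, h]

/-- Induction over words in the generators. -/
theorem induction' {P : RB n → Prop} (one : P 1) (hs : ∀ i, i + 1 < n → P (s n i))
    (ht : ∀ i, i < n → P (t n i))
    (mul : ∀ x y, P x → P y → P (x * y)) (inv : ∀ x, P x → P x⁻¹) (x : RB n) : P x := by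
  refine induction one ?_ mul inv x
  rintro (⟨i, h⟩ | ⟨i, h⟩)
  · rw [gen_cross]; exact hs i h
  · rw [gen_twist]; exact ht i h

/-- Place a ribbon braid on `n` ribbons on the ribbons `a, …, a + n - 1` among `N` ribbons. -/
def place (a : ℕ) (h : a + n ≤ N) : RB n →* RB N :=
  lift (fun g => match g with
      | .cross i hi => gen (.cross (a + i) (by omega))
      | .twist i hi => gen (.twist (a + i) (by omega)))
    (fun i j hi hj => rel_far (a + i) (a + j) (by omega) (by omega))
    (fun i h => rel_braid (a + i) (by omega))
    (fun i j hi hj => rel_twists (a + i) (a + j) (by omega) (by omega))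
    (fun i h => rel_left (a + i) (by omega))
    (fun i h => rel_right (a + i) (by omega))
    (fun i j h hj h1 h2 => rel_apart (a + i) (a + j) (by omega) (by omega) (by omega) (by omega))

theorem place_s (a : ℕ) (h : a + n ≤ N) (i : ℕ) (hi : i + 1 < n) :
    place a h (s n i) = s N (a + i) := by
  rw [← gen_cross i hi, ← gen_cross (a + i) (by omega), place, lift_gen]
theorem place_t (a : ℕ) (h : a + n ≤ N) (i : ℕ) (hi : i < n) :
    place a h (t n i) = t N (a + i) := by
  rw [← gen_twist i hi, ← gen_twist (a + i) (by omega), place, lift_gen]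

theorem place_place {l : ℕ} (a b : ℕ) (h : a + n ≤ m) (h' : b + m ≤ l) (x : RB n) :
    place b h' (place a h x) = place (b + a) (by omega) x := by
  induction x using induction' with
  | one => simp
  | hs i hi => rw [place_s _ _ _ hi, place_s _ _ _ (by omega), place_s _ _ _ hi, add_assoc]
  | ht i hi => rw [place_t _ _ _ hi, place_t _ _ _ (by omega), place_t _ _ _ hi, add_assoc]
  | mul x y hx hy => simp [hx, hy]
  | inv x hx => simp [hx]

theorem place_self (h : 0 + n ≤ n) (x : RB n) : place 0 h x = x := by
  induction x using induction' with
  | one => simp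
  | hs i hi => rw [place_s _ _ _ hi, zero_add]
  | ht i hi => rw [place_t _ _ _ hi, zero_add]
  | mul x y hx hy => simp [hx, hy]
  | inv x hx => simp [hx]

theorem place_comm (a b : ℕ) (ha : a + n ≤ N) (hb : b + m ≤ N) (hab : a + n ≤ b)
    (x : RB n) (y : RB m) : Commute (place a ha x) (place b hb y) := by
  induction x using induction' with
  | one => simp
  | mul x x' hx hx' => rw [map_mul]; exact hx.mul_left hx'
  | inv x hx => rw [map_inv]; exact hx.inv_left
  | hs i hi =>
    rw [place_s _ _ _ hi]
    induction y using induction' with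
    | one => simp
    | mul x x' hx hx' => rw [map_mul]; exact hx.mul_right hx'
    | inv x hx => rw [map_inv]; exact hx.inv_right
    | hs j hj => rw [place_s _ _ _ hj]; exact s_far _ _ (by omega) (by omega)
    | ht j hj => rw [place_t _ _ _ hj]; exact s_t_apart _ _ (by omega) (by omega) (by omega)
  | ht i hi =>
    rw [place_t _ _ _ hi]
    induction y using induction' with
    | one => simp
    | mul x x' hx hx' => rw [map_mul]; exact hx.mul_right hx'
    | inv x hx => rw [map_inv]; exact hx.inv_right
    | hs j hj =>
      rw [place_s _ _ _ hj]; exact (s_t_apart _ _ (by omega) (by omega) (by omega)).symm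
    | ht j hj => rw [place_t _ _ _ hj]; exact t_comm _ _

/-- The ribbon in position `a` crosses the `q` ribbons to its right. Products are read as
compositions: in `x * y` the braid `y` comes first. -/
def L (N a : ℕ) : ℕ → RB N
  | 0 => 1
  | q + 1 => s N (a + q) * L N a q

/-- The block crossing: the block of `p` ribbons starting at position `a` crosses the next `q` ribbons. -/
def X (N : ℕ) : ℕ → ℕ → ℕ → RB N
  | _, 0, _ => 1
  | a, p + 1, q => L N a q * X N (a + 1) p q

/-- The full twist of the block of `p` ribbons starting at position `a`, as one wide ribbon:
`θ_{1+p} = c_{p,1} c_{1,p} (θ_1 ⊗ θ_p)`. -/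
def T (N : ℕ) : ℕ → ℕ → RB N
  | _, 0 => 1
  | a, p + 1 => X N a p 1 * X N a 1 p * t N a * T N (a + 1) p

@[simp] theorem L_zero (a : ℕ) : L N a 0 = 1 := rfl
theorem L_succ (a q : ℕ) : L N a (q + 1) = s N (a + q) * L N a q := rfl
@[simp] theorem X_zero_left (a q : ℕ) : X N a 0 q = 1 := rfl
theorem X_succ (a p q : ℕ) : X N a (p + 1) q = L N a q * X N (a + 1) p q := rfl
theorem X_one (a q : ℕ) : X N a 1 q = L N a q := by simp [X_succ]
@[simp] theorem X_zero_right (a p : ℕ) : X N a p 0 = 1 := by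
  induction p generalizing a with
  | zero => rfl
  | succ p ih => simp [X_succ, ih]
theorem X_one_one (a : ℕ) : X N a 1 1 = s N a := by simp [X_one, L_succ]
@[simp] theorem T_zero (a : ℕ) : T N a 0 = 1 := rfl
theorem T_succ (a p : ℕ) :
    T N a (p + 1) = X N a p 1 * X N a 1 p * t N a * T N (a + 1) p := rfl
theorem T_one (a : ℕ) : T N a 1 = t N a := by simp [T_succ]

theorem place_L (b : ℕ) (h : b + n ≤ N) (a q : ℕ) (hq : a + q < n) :
    place b h (L n a q) = L N (b + a) q := by
  induction q with
  | zero => simp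
  | succ q ih => rw [L_succ, map_mul, ih (by omega), place_s _ _ _ (by omega), L_succ, add_assoc]

theorem place_X (b : ℕ) (h : b + n ≤ N) (a p q : ℕ) (hq : a + p + q ≤ n) :
    place b h (X n a p q) = X N (b + a) p q := by
  induction p generalizing a with
  | zero => simp
  | succ p ih =>
    rw [X_succ, map_mul, ih _ (by omega), place_L _ _ _ _ (by omega), X_succ, add_assoc]

theorem place_T (b : ℕ) (h : b + n ≤ N) (a p : ℕ) (hq : a + p ≤ n) :
    place b h (T n a p) = T N (b + a) p := by
  induction p generalizing a with
  | zero => simp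
  | succ p ih =>
    rw [T_succ, map_mul, map_mul, map_mul, ih _ (by omega), place_X _ _ _ _ _ (by omega),
      place_X _ _ _ _ _ (by omega), place_t _ _ _ (by omega), T_succ, add_assoc]

theorem X_eq_place {a p q : ℕ} (h : a + (p + q) ≤ N) :
    X N a p q = place a h (X (p + q) 0 p q) := by
  rw [place_X _ _ _ _ _ (by omega), add_zero]
theorem T_eq_place {a p : ℕ} (h : a + p ≤ N) :
    T N a p = place a h (T p 0 p) := by
  rw [place_T _ _ _ _ (by omega), add_zero]
theorem s_eq_place {a : ℕ} (h : a + 2 ≤ N) : s N a = place a h (s 2 0) := by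
  rw [place_s _ _ _ (by omega), add_zero]
theorem t_eq_place {a : ℕ} (h : a + 1 ≤ N) : t N a = place a h (t 1 0) := by
  rw [place_t _ _ _ (by omega), add_zero]

theorem X_comm_X {a p q b r u : ℕ} (h : a + p + q ≤ b) (h' : b + r + u ≤ N) :
    Commute (X N a p q) (X N b r u) := by
  rw [X_eq_place (by omega), X_eq_place (a := b) (by omega)]
  exact place_comm _ _ _ _ (by omega) _ _
theorem X_comm_T {a p q b r : ℕ} (h : a + p + q ≤ b) (h' : b + r ≤ N) :
    Commute (X N a p q) (T N b r) := by
  rw [X_eq_place (by omega), T_eq_place (by omega)]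
  exact place_comm _ _ _ _ (by omega) _ _
theorem T_comm_X {a p b r q : ℕ} (h : a + p ≤ b) (h' : b + r + q ≤ N) :
    Commute (T N a p) (X N b r q) := by
  rw [X_eq_place (by omega), T_eq_place (by omega)]
  exact place_comm _ _ _ _ (by omega) _ _
theorem T_comm_T {a p b r : ℕ} (h : a + p ≤ b) (h' : b + r ≤ N) :
    Commute (T N a p) (T N b r) := by
  rw [T_eq_place (by omega), T_eq_place (a := b) (by omega)]
  exact place_comm _ _ _ _ (by omega) _ _
theorem s_comm_X {a b r q : ℕ} (h : a + 2 ≤ b) (h' : b + r + q ≤ N) :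
    Commute (s N a) (X N b r q) := by
  rw [X_eq_place (by omega), s_eq_place (by omega)]
  exact place_comm _ _ _ _ (by omega) _ _
theorem s_comm_T {a b r : ℕ} (h : a + 2 ≤ b) (h' : b + r ≤ N) :
    Commute (s N a) (T N b r) := by
  rw [T_eq_place (by omega), s_eq_place (by omega)]
  exact place_comm _ _ _ _ (by omega) _ _
theorem X_comm_s {a p q b : ℕ} (h : a + p + q ≤ b) (h' : b + 2 ≤ N) :
    Commute (X N a p q) (s N b) := by
  rw [X_eq_place (by omega), s_eq_place (by omega)]
  exact place_comm _ _ _ _ (by omega) _ _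
theorem t_comm_X {a b r q : ℕ} (h : a + 1 ≤ b) (h' : b + r + q ≤ N) :
    Commute (t N a) (X N b r q) := by
  rw [X_eq_place (by omega), t_eq_place (by omega)]
  exact place_comm _ _ _ _ (by omega) _ _
theorem X_comm_t {a p q b : ℕ} (h : a + p + q ≤ b) (h' : b + 1 ≤ N) :
    Commute (X N a p q) (t N b) := by
  rw [X_eq_place (by omega), t_eq_place (by omega)]
  exact place_comm _ _ _ _ (by omega) _ _
theorem t_comm_T {a b r : ℕ} (h : a + 1 ≤ b) (h' : b + r ≤ N) :
    Commute (t N a) (T N b r) := by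
  rw [T_eq_place (by omega), t_eq_place (by omega)]
  exact place_comm _ _ _ _ (by omega) _ _

/-- First hexagon. -/
theorem X_add_left (a p p' q : ℕ) : X N a (p + p') q = X N a p q * X N (a + p) p' q := by
  induction p generalizing a with
  | zero => simp
  | succ p ih =>
    rw [show p + 1 + p' = p + p' + 1 by omega, X_succ, ih, X_succ, mul_assoc,
      show a + 1 + p = a + (p + 1) by omega]

theorem L_add (a q r : ℕ) : L N a (q + r) = L N (a + q) r * L N a q := by
  induction r with
  | zero => simp
  | succ r ih => rw [← add_assoc, L_succ, ih, L_succ, mul_assoc, add_assoc]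

/-- Second hexagon. -/
theorem X_add_right (a p q r : ℕ) (h : a + p + q + r ≤ N) :
    X N a p (q + r) = X N (a + q) p r * X N a p q := by
  induction p generalizing a with
  | zero => simp
  | succ p ih =>
    rw [X_succ, X_succ, X_succ, ih _ (by omega), L_add]
    have : Commute (L N a q) (X N (a + 1 + q) p r) := by
      rw [← X_one]; exact X_comm_X (by omega) (by omega)
    rw [show a + q + 1 = a + 1 + q by omega]
    simp only [mul_assoc]
    rw [← mul_assoc (L N a q), this.eq, mul_assoc]

theorem L_s (a q i : ℕ) (hi : i + 1 < q) (h : a + q < N) :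
    L N a q * s N (a + 1 + i) = s N (a + i) * L N a q := by
  induction q with
  | zero => omega
  | succ q ih =>
    rw [L_succ]
    rcases Nat.lt_or_ge (i + 1) q with hq | hq
    · rw [mul_assoc, ih hq (by omega), ← mul_assoc, ← mul_assoc]
      rw [s_far (a + i) (a + q) (by omega) (by omega)]
    · obtain rfl : q = i + 1 := by omega
      rw [L_succ]
      have : Commute (L N a i) (s N (a + i + 1)) := by
        rw [← X_one]; exact X_comm_s (by omega) (by omega)
      rw [show a + 1 + i = a + i + 1 by omega, ← add_assoc]
      rw [mul_assoc, mul_assoc, this.eq, ← mul_assoc, ← mul_assoc, ← mul_assoc, ← mul_assoc,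
        s_braid (a + i) (by omega)]

theorem L_t (a q i : ℕ) (hi : i < q) (h : a + q < N) :
    L N a q * t N (a + 1 + i) = t N (a + i) * L N a q := by
  induction q with
  | zero => omega
  | succ q ih =>
    rw [L_succ]
    rcases Nat.lt_or_ge i q with hq | hq
    · rw [mul_assoc, ih hq (by omega), ← mul_assoc, ← mul_assoc]
      rw [s_t_apart _ _ (by omega) (by omega) (by omega)]
    · obtain rfl : q = i := by omega
      have : Commute (L N a q) (t N (a + q + 1)) := by
        rw [← X_one]; exact X_comm_t (by omega) (by omega)
      rw [show a + 1 + q = a + q + 1 by omega]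
      rw [mul_assoc, this.eq, ← mul_assoc, ← mul_assoc, s_t_right (a + q) (by omega)]

theorem L_t_first (a q : ℕ) (h : a + q < N) : L N a q * t N a = t N (a + q) * L N a q := by
  induction q with
  | zero => simp
  | succ q ih =>
    rw [L_succ, mul_assoc, ih (by omega), ← mul_assoc, ← mul_assoc, s_t_left _ (by omega),
      add_assoc]

theorem X_s_right (a p q i : ℕ) (hi : i + 1 < q) (h : a + p + q ≤ N) :
    X N a p q * s N (a + p + i) = s N (a + i) * X N a p q := by
  induction p generalizing a with
  | zero => simp
  | succ p ih =>
    rw [X_succ, mul_assoc, show a + (p + 1) + i = a + 1 + p + i by omega, ih _ (by omega),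
      ← mul_assoc, ← mul_assoc, L_s _ _ _ hi (by omega)]

theorem X_t_right (a p q i : ℕ) (hi : i < q) (h : a + p + q ≤ N) :
    X N a p q * t N (a + p + i) = t N (a + i) * X N a p q := by
  induction p generalizing a with
  | zero => simp
  | succ p ih =>
    rw [X_succ, mul_assoc, show a + (p + 1) + i = a + 1 + p + i by omega, ih _ (by omega),
      ← mul_assoc, ← mul_assoc, L_t _ _ _ hi (by omega)]

theorem X_t_left (a p q i : ℕ) (hi : i < p) (h : a + p + q ≤ N) :
    X N a p q * t N (a + i) = t N (a + q + i) * X N a p q := by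
  induction p generalizing a i with
  | zero => omega
  | succ p ih =>
    rw [X_succ]
    rcases i with _ | i
    · have : Commute (t N a) (X N (a + 1) p q) := t_comm_X (by omega) (by omega)
      rw [add_zero, add_zero, mul_assoc, ← this.eq, ← mul_assoc, ← mul_assoc,
        L_t_first _ _ (by omega)]
    · rw [mul_assoc, show a + (i + 1) = a + 1 + i by omega, ih _ _ (by omega) (by omega),
        ← mul_assoc, ← mul_assoc]
      congr 1
      have : Commute (L N a q) (t N (a + 1 + q + i)) := by
        rw [← X_one]; exact X_comm_t (by omega) (by omega)
      rw [this.eq, show a + q + (i + 1) = a + 1 + q + i by omega]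

theorem X_s_left_one (a p i : ℕ) (hi : i + 1 < p) (h : a + p < N) :
    X N a p 1 * s N (a + i) = s N (a + 1 + i) * X N a p 1 := by
  induction p generalizing a i with
  | zero => omega
  | succ p ih =>
    have hL (b : ℕ) : L N b 1 = s N b := by simp [L_succ]
    rw [X_succ, hL]
    rcases i with _ | i
    · obtain ⟨r, rfl⟩ : ∃ r, p = r + 1 := ⟨p - 1, by omega⟩
      have : Commute (s N a) (X N (a + 1 + 1) r 1) := s_comm_X (by omega) (by omega)
      rw [X_succ, hL, add_zero, add_zero, mul_assoc, mul_assoc, ← this.eq, ← mul_assoc,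
        ← mul_assoc, ← mul_assoc, ← mul_assoc, s_braid a (by omega)]
    · rw [mul_assoc, show a + (i + 1) = a + 1 + i by omega, ih _ _ (by omega) (by omega),
        ← mul_assoc, ← mul_assoc, s_far a (a + 1 + 1 + i) (by omega) (by omega),
        show a + 1 + (i + 1) = a + 1 + 1 + i by omega]

theorem X_s_left (a p q i : ℕ) (hi : i + 1 < p) (h : a + p + q ≤ N) :
    X N a p q * s N (a + i) = s N (a + q + i) * X N a p q := by
  induction q with
  | zero => simp
  | succ q ih =>
    rw [X_add_right _ _ _ _ (by omega), mul_assoc, ih (by omega), ← mul_assoc, ← mul_assoc,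
      X_s_left_one _ _ _ hi (by omega), show a + (q + 1) + i = a + q + 1 + i by omega]

theorem conj_of_gen (a b : ℕ) (ha : a + n ≤ N) (hb : b + n ≤ N) (z : RB N)
    (hs : ∀ i, i + 1 < n → z * s N (a + i) = s N (b + i) * z)
    (ht : ∀ i, i < n → z * t N (a + i) = t N (b + i) * z) (x : RB n) :
    z * place a ha x = place b hb x * z := by
  induction x using induction' with
  | one => simp
  | mul x y hx hy => rw [map_mul, map_mul, ← mul_assoc, hx, mul_assoc, hy, mul_assoc]
  | inv x hx =>
    rw [map_inv, map_inv, eq_inv_mul_iff_mul_eq, ← mul_assoc, ← hx, mul_inv_cancel_right]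
  | hs i hi => rw [place_s _ _ _ hi, place_s _ _ _ hi, hs i hi]
  | ht i hi => rw [place_t _ _ _ hi, place_t _ _ _ hi, ht i hi]

theorem X_place_right (a p q : ℕ) (h : a + p + q ≤ N) (x : RB q) :
    X N a p q * place (a + p) h x = place a (by omega) x * X N a p q :=
  conj_of_gen _ _ _ _ _ (fun i hi => X_s_right a p q i hi h) (fun i hi => X_t_right a p q i hi h) x

theorem X_place_left (a p q : ℕ) (h : a + p + q ≤ N) (x : RB p) :
    X N a p q * place a (by omega) x = place (a + q) (by omega) x * X N a p q :=
  conj_of_gen _ _ _ _ _ (fun i hi => X_s_left a p q i hi h) (fun i hi => X_t_left a p q i hi h) x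

theorem X_X_right (a p q b r u : ℕ) (h : a + p + q ≤ N) (hb : b + r + u ≤ q) :
    X N a p q * X N (a + p + b) r u = X N (a + b) r u * X N a p q := by
  have := X_place_right a p q h (X q b r u)
  rwa [place_X _ _ _ _ _ hb, place_X _ _ _ _ _ hb] at this
theorem X_X_left (a p q b r u : ℕ) (h : a + p + q ≤ N) (hb : b + r + u ≤ p) :
    X N a p q * X N (a + b) r u = X N (a + q + b) r u * X N a p q := by
  have := X_place_left a p q h (X p b r u)
  rwa [place_X _ _ _ _ _ hb, place_X _ _ _ _ _ hb] at this
theorem X_T_right (a p q b r : ℕ) (h : a + p + q ≤ N) (hb : b + r ≤ q) :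
    X N a p q * T N (a + p + b) r = T N (a + b) r * X N a p q := by
  have := X_place_right a p q h (T q b r)
  rwa [place_T _ _ _ _ hb, place_T _ _ _ _ hb] at this
theorem X_T_left (a p q b r : ℕ) (h : a + p + q ≤ N) (hb : b + r ≤ p) :
    X N a p q * T N (a + b) r = T N (a + q + b) r * X N a p q := by
  have := X_place_left a p q h (T p b r)
  rwa [place_T _ _ _ _ hb, place_T _ _ _ _ hb] at this

/-- The Yang-Baxter equation for block crossings. -/
theorem X_yang_baxter (a p q r : ℕ) (h : a + p + q + r ≤ N) :
    X N a q r * (X N (a + q) p r * X N a p q) = X N (a + r) p q * (X N a p r * X N (a + p) q r) := by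
  rw [← mul_assoc, ← X_add_left, ← X_add_left, add_comm q p]
  have := X_X_left (N := N) a (p + q) r 0 p q (by omega) (by omega)
  simpa using this

theorem T_add (a p q : ℕ) (h : a + p + q ≤ N) :
    T N a (p + q) = X N a q p * X N a p q * (T N a p * T N (a + p) q) := by
  induction p generalizing a with
  | zero => simp
  | succ p ih =>
    have e1 : T N a (p + q + 1) = X N (a + 1) q p * X N (a + 1) p q * (X N a (p + q) 1 *
        X N a 1 (p + q)) * t N a * (T N (a + 1) p * T N (a + 1 + p) q) := by
      have c1 := X_X_right (N := N) a 1 (p + q) 0 p q (by omega) (by omega)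
      have c2 := X_X_right (N := N) a 1 (p + q) 0 q p (by omega) (by omega)
      have c3 := X_X_left (N := N) a (p + q) 1 0 p q (by omega) (by omega)
      have c4 := X_X_left (N := N) a (p + q) 1 0 q p (by omega) (by omega)
      have c5 : Commute (t N a) (X N (a + 1) p q) := t_comm_X (by omega) (by omega)
      have c6 : Commute (t N a) (X N (a + 1) q p) := t_comm_X (by omega) (by omega)
      simp only [add_zero] at c1 c2 c3 c4
      rw [T_succ, ih _ (by omega)]
      calc X N a (p + q) 1 * X N a 1 (p + q) * t N a *
          (X N (a + 1) q p * X N (a + 1) p q * (T N (a + 1) p * T N (a + 1 + p) q))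
          = X N a (p + q) 1 * X N a 1 (p + q) * ((t N a * X N (a + 1) q p) * X N (a + 1) p q) *
            (T N (a + 1) p * T N (a + 1 + p) q) := by simp only [mul_assoc]
        _ = X N a (p + q) 1 * (X N a 1 (p + q) * X N (a + 1) q p) * (t N a * X N (a + 1) p q) *
            (T N (a + 1) p * T N (a + 1 + p) q) := by rw [c6.eq]; simp only [mul_assoc]
        _ = (X N a (p + q) 1 * X N a q p) * (X N a 1 (p + q) * X N (a + 1) p q) * t N a *
            (T N (a + 1) p * T N (a + 1 + p) q) := by rw [c2, c5.eq]; simp only [mul_assoc]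
        _ = X N (a + 1) q p * (X N a (p + q) 1 * X N a p q) * X N a 1 (p + q) * t N a *
            (T N (a + 1) p * T N (a + 1 + p) q) := by rw [c4, c1]; simp only [mul_assoc]
        _ = _ := by rw [c3]; simp only [mul_assoc]
    have e2 : X N (a + 1) p q * (X N a (p + q) 1 * X N a 1 (p + q)) =
        X N a q 1 * X N a (p + 1) q * (X N a p 1 * X N a 1 p) := by
      have d1 := X_X_right (N := N) a p (1 + q) 0 1 q (by omega) (by omega)
      have d2 := X_X_right (N := N) a p (q + 1) 0 q 1 (by omega) (by omega)
      simp only [add_zero] at d1 d2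
      rw [add_comm 1 q] at d1
      have d3 : X N a p (q + 1) = X N (a + 1) p q * X N a p 1 := by
        rw [add_comm q 1, X_add_right _ _ _ _ (by omega)]
      calc X N (a + 1) p q * (X N a (p + q) 1 * X N a 1 (p + q))
          = (X N (a + 1) p q * X N a p 1) * X N (a + p) q 1 * X N (a + p) 1 q * X N a 1 p := by
            rw [X_add_left, X_add_right a 1 p q (by omega)]; simp only [mul_assoc]
        _ = X N a q 1 * (X N a p (q + 1) * X N (a + p) 1 q) * X N a 1 p := by
            rw [← d3, d2]; simp only [mul_assoc]
        _ = _ := by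
            rw [d1, d3, add_comm p 1, X_add_left a 1 p q]; simp only [mul_assoc]
    have c7 : X N a q (p + 1) = X N (a + 1) q p * X N a q 1 := by
      rw [add_comm p 1, X_add_right _ _ _ _ (by omega)]
    calc T N a (p + 1 + q) = T N a (p + q + 1) := by congr 1; omega
      _ = X N (a + 1) q p * (X N (a + 1) p q * (X N a (p + q) 1 *
        X N a 1 (p + q))) * t N a * (T N (a + 1) p * T N (a + 1 + p) q) := by
          rw [e1]; simp only [mul_assoc]
      _ = _ := by
          rw [e2, c7, T_succ, show a + (p + 1) = a + 1 + p by omega]; simp only [mul_assoc]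

theorem T_t (a p i : ℕ) (hi : i < p) (h : a + p ≤ N) :
    T N a p * t N (a + i) = t N (a + i) * T N a p := by
  induction p generalizing a i with
  | zero => omega
  | succ p ih =>
    have key : T N (a + 1) p * t N (a + i) = t N (a + i) * T N (a + 1) p := by
      rcases i with _ | i
      · exact (t_comm_T (by omega) (by omega)).eq.symm
      · rw [show a + (i + 1) = a + 1 + i by omega]
        exact ih _ _ (by omega) (by omega)
    have key2 : X N a p 1 * (X N a 1 p * t N (a + i)) = t N (a + i) * (X N a p 1 * X N a 1 p) := by
      rcases i with _ | i
      · have h1 := X_t_left (N := N) a 1 p 0 (by omega) (by omega)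
        have h2 := X_t_right (N := N) a p 1 0 (by omega) (by omega)
        rw [h1, ← mul_assoc, h2, mul_assoc]
      · have h1 := X_t_right (N := N) a 1 p i (by omega) (by omega)
        have h2 := X_t_left (N := N) a p 1 i (by omega) (by omega)
        rw [show a + (i + 1) = a + 1 + i by omega, h1, ← mul_assoc, h2, mul_assoc]
    rw [T_succ, mul_assoc, key, ← mul_assoc, mul_assoc _ (t N a), t_comm a, ← mul_assoc,
      mul_assoc (X N a p 1), key2]
    simp only [mul_assoc]

theorem T_s (a p i : ℕ) (hi : i + 1 < p) (h : a + p ≤ N) :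
    T N a p * s N (a + i) = s N (a + i) * T N a p := by
  induction p generalizing a i with
  | zero => omega
  | succ p ih =>
    rcases i with _ | i
    · obtain ⟨r, hr⟩ : ∃ r, p + 1 = 2 + r := ⟨p - 1, by omega⟩
      have h2 : T N a 2 * s N a = s N a * T N a 2 := by
        have : T N a 2 = s N a * s N a * (t N a * t N (a + 1)) := by
          rw [T_succ, T_one, X_one_one, mul_assoc]
        rw [this]
        have e1 : (t N a * t N (a + 1)) * s N a = s N a * (t N a * t N (a + 1)) := by
          rw [mul_assoc, ← s_t_left _ (by omega), ← mul_assoc, ← s_t_right _ (by omega), mul_assoc,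
            t_comm]
        rw [mul_assoc, e1]; simp only [mul_assoc]
      have c : Commute (s N a) (T N (a + 2) r) := s_comm_T (by omega) (by omega)
      have h3 := X_s_left (N := N) a 2 r 0 (by omega) (by omega)
      have h4 := X_s_right (N := N) a r 2 0 (by omega) (by omega)
      simp only [add_zero] at h3 h4
      rw [hr, T_add _ _ _ (by omega), add_zero]
      calc X N a r 2 * X N a 2 r * (T N a 2 * T N (a + 2) r) * s N a
          = X N a r 2 * X N a 2 r * (T N a 2 * (T N (a + 2) r * s N a)) := by
            simp only [mul_assoc]
        _ = X N a r 2 * X N a 2 r * ((T N a 2 * s N a) * T N (a + 2) r) := by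
            rw [← c.eq]; simp only [mul_assoc]
        _ = X N a r 2 * (X N a 2 r * s N a) * (T N a 2 * T N (a + 2) r) := by
            rw [h2]; simp only [mul_assoc]
        _ = (X N a r 2 * s N (a + r)) * X N a 2 r * (T N a 2 * T N (a + 2) r) := by
            rw [h3]; simp only [mul_assoc]
        _ = _ := by rw [h4]; simp only [mul_assoc]
    · have h1 := X_s_right (N := N) a 1 p i (by omega) (by omega)
      have h2 := X_s_left (N := N) a p 1 i (by omega) (by omega)
      have h3 := ih (a + 1) i (by omega) (by omega)
      have h4 : s N (a + 1 + i) * t N a = t N a * s N (a + 1 + i) :=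
        s_t_apart _ _ (by omega) (by omega) (by omega)
      rw [T_succ, show a + (i + 1) = a + 1 + i by omega, mul_assoc, h3, ← mul_assoc,
        mul_assoc _ (t N a), ← h4, ← mul_assoc, mul_assoc (X N a p 1), h1, ← mul_assoc, h2]
      simp only [mul_assoc]

theorem T_central (x : RB n) : Commute (T n 0 n) x := by
  have := conj_of_gen (n := n) (N := n) 0 0 (by omega) (by omega) (T n 0 n)
    (fun i hi => T_s 0 n i hi (by omega)) (fun i hi => T_t 0 n i hi (by omega)) x
  rwa [place_self] at this

theorem val_swap (i j : ℕ) (hi : i < n) (hj : j < n) (x : Fin n) :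
    (Equiv.swap (⟨i, hi⟩ : Fin n) ⟨j, hj⟩ x : ℕ) =
      if (x : ℕ) = i then j else if (x : ℕ) = j then i else x := by
  rw [Equiv.swap_apply_def]
  simp only [Fin.ext_iff]
  split_ifs <;> rfl

/-- The underlying permutation of a generator. -/
def genPerm : RibbonGen n → Perm (Fin n)
  | .cross i h => Equiv.swap ⟨i, by omega⟩ ⟨i + 1, h⟩
  | .twist _ _ => 1

theorem perm_far (i j : ℕ) (hi : i + 1 < j) (hj : j + 1 < n) :
    (genPerm (.cross i (by omega)) : Perm (Fin n)) * genPerm (.cross j hj) =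
      genPerm (.cross j hj) * genPerm (.cross i (by omega)) := by
  ext x
  simp only [genPerm, Equiv.Perm.mul_apply, val_swap]
  split_ifs <;> omega

theorem perm_braid (i : ℕ) (h : i + 2 < n) :
    (genPerm (.cross i (by omega)) : Perm (Fin n)) * genPerm (.cross (i + 1) h) *
      genPerm (.cross i (by omega)) =
      genPerm (.cross (i + 1) h) * genPerm (.cross i (by omega)) * genPerm (.cross (i + 1) h) := by
  ext x
  simp only [genPerm, Equiv.Perm.mul_apply, val_swap]
  split_ifs <;> omega

/-- The underlying permutation of a ribbon braid. -/
def perm : RB n →* Perm (Fin n) :=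
  lift genPerm perm_far perm_braid (fun _ _ _ _ => rfl) (fun _ _ => rfl) (fun _ _ => rfl)
    (fun _ _ _ _ _ _ => rfl)

@[simp] theorem perm_gen (g : RibbonGen n) : perm (gen g) = genPerm g := lift_gen ..

theorem perm_s (i : ℕ) (h : i + 1 < n) (x : Fin n) : (perm (s n i) x : ℕ) =
    if (x : ℕ) = i then i + 1 else if (x : ℕ) = i + 1 then i else x := by
  rw [← gen_cross i h, perm_gen, genPerm, val_swap]

@[simp] theorem perm_t (i : ℕ) : perm (t n i) = 1 := by
  unfold t; split_ifs <;> simp [genPerm]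

theorem perm_L (a q : ℕ) (h : a + q < n) (x : Fin n) : (perm (L n a q) x : ℕ) =
    if (x : ℕ) < a then (x : ℕ) else if (x : ℕ) = a then a + q else
      if (x : ℕ) ≤ a + q then (x : ℕ) - 1 else x := by
  induction q with
  | zero => simp only [L_zero, map_one, Equiv.Perm.one_apply]; split_ifs <;> omega
  | succ q ih =>
    rw [L_succ, map_mul, Equiv.Perm.mul_apply, perm_s _ (by omega), ih (by omega)]
    split_ifs <;> omega

theorem perm_X (a p q : ℕ) (h : a + p + q ≤ n) (x : Fin n) : (perm (X n a p q) x : ℕ) =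
    if (x : ℕ) < a then (x : ℕ) else if (x : ℕ) < a + p then x + q else
      if (x : ℕ) < a + p + q then (x : ℕ) - p else x := by
  induction p generalizing a with
  | zero => simp only [X_zero_left, map_one, Equiv.Perm.one_apply]; split_ifs <;> omega
  | succ p ih =>
    rw [X_succ, map_mul, Equiv.Perm.mul_apply, perm_L _ _ (by omega), ih _ (by omega)]
    split_ifs <;> omega

theorem perm_T (a p : ℕ) (h : a + p ≤ n) : perm (T n a p) = 1 := by
  induction p generalizing a with
  | zero => simp
  | succ p ih =>
    rw [T_succ, map_mul, map_mul, ih _ (by omega), perm_t, mul_one, mul_one]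
    ext x
    rw [map_mul, Equiv.Perm.mul_apply, perm_X _ _ _ (by omega), perm_X _ _ _ (by omega),
      Equiv.Perm.one_apply]
    split_ifs <;> omega

/-- The fibres of `permAct π φ` for a block crossing `π`. -/
theorem cut_X_outside (φ : Fin n →o Fin m) (a p q k : ℕ) (h : a + p + q ≤ m)
    (hk : k ≤ a ∨ a + p + q ≤ k) : cut (permAct (perm (X m a p q)) φ) k = cut φ k := by
  rw [cut_permAct_of _ φ k k k k le_rfl le_rfl]
  · simp
  · intro y; rw [perm_X _ _ _ h]; split_ifs <;> omega

theorem cut_X_first (φ : Fin n →o Fin m) (a p q r : ℕ) (h : a + p + q ≤ m) (hr : r ≤ q) :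
    cut (permAct (perm (X m a p q)) φ) (a + r) = cut φ a + (cut φ (a + p + r) - cut φ (a + p)) := by
  rw [cut_permAct_of _ φ (a + r) a (a + p) (a + p + r) (by omega) (by omega)]
  intro y; rw [perm_X _ _ _ h]; split_ifs <;> omega

theorem cut_X_second (φ : Fin n →o Fin m) (a p q r : ℕ) (h : a + p + q ≤ m) (hr : r ≤ p) :
    cut (permAct (perm (X m a p q)) φ) (a + q + r) =
      cut φ (a + r) + (cut φ (a + p + q) - cut φ (a + p)) := by
  rw [cut_permAct_of _ φ (a + q + r) (a + r) (a + p) (a + p + q) (by omega) (by omega)]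
  intro y; rw [perm_X _ _ _ h]; split_ifs <;> omega

theorem cut_s_ne (φ : Fin n →o Fin m) (i k : ℕ) (h : i + 1 < m) (hk : k ≠ i + 1) :
    cut (permAct (perm (s m i)) φ) k = cut φ k := by
  rw [← X_one_one, cut_X_outside _ _ _ _ _ (by omega) (by omega)]
theorem cut_s_eq (φ : Fin n →o Fin m) (i : ℕ) (h : i + 1 < m) :
    cut (permAct (perm (s m i)) φ) (i + 1) = cut φ i + (cut φ (i + 2) - cut φ (i + 1)) := by
  rw [← X_one_one, cut_X_first _ _ _ _ _ (by omega) (by omega)]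

/-- The cabling of a generator along an order-preserving map `φ`: the `i`-th ribbon is replaced by
as many parallel ribbons as `φ` has elements over `i` (which deletes it if there are none). The
crossing `σ_i` becomes a block crossing, the twist `τ_i` the full twist of a block. -/
def genCable (φ : Fin n →o Fin m) : RibbonGen m → RB n
  | .cross i _ => X n (cut φ i) (cut φ (i + 1) - cut φ i) (cut φ (i + 2) - cut φ (i + 1))
  | .twist i _ => T n (cut φ i) (cut φ (i + 1) - cut φ i)

/-- The action of a generator on pairs `(φ, x)`, that is, on `D ⊗ RB (n, m)`, by post-composition. -/
def genAct (n : ℕ) (g : RibbonGen m) : Perm ((Fin n →o Fin m) × RB n) where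
  toFun y := (permAct (genPerm g) y.1, genCable y.1 g * y.2)
  invFun y := (permAct (genPerm g)⁻¹ y.1, (genCable (permAct (genPerm g)⁻¹ y.1) g)⁻¹ * y.2)
  left_inv y := by simp [← permAct_mul, permAct_one]
  right_inv y := by simp [← permAct_mul, permAct_one]

theorem genAct_apply (g : RibbonGen m) (φ : Fin n →o Fin m) (x : RB n) :
    genAct n g (φ, x) = (permAct (genPerm g) φ, genCable φ g * x) := rfl

theorem genAct_mul_eq {g g' h h' : RibbonGen m} (h1 : genPerm g * genPerm g' = genPerm h * genPerm h')
    (h2 : ∀ φ : Fin n →o Fin m, genCable (permAct (genPerm g') φ) g * genCable φ g' =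
      genCable (permAct (genPerm h') φ) h * genCable φ h') :
    genAct n g * genAct n g' = genAct n h * genAct n h' := by
  ext1 ⟨φ, x⟩
  simp only [Equiv.Perm.mul_apply, genAct_apply, ← permAct_mul, h1, ← mul_assoc, h2]

theorem genCable_cross (φ : Fin n →o Fin m) (i : ℕ) (h : i + 1 < m) : genCable φ (.cross i h) =
  X n (cut φ i) (cut φ (i + 1) - cut φ i) (cut φ (i + 2) - cut φ (i + 1)) := rfl
theorem genCable_twist (φ : Fin n →o Fin m) (i : ℕ) (h : i < m) : genCable φ (.twist i h) =
  T n (cut φ i) (cut φ (i + 1) - cut φ i) := rfl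

theorem genPerm_cross (i : ℕ) (h : i + 1 < m) :
    genPerm (.cross i h) = perm (s m i) := by rw [← gen_cross i h, perm_gen]

theorem cable_braid (φ : Fin n →o Fin m) (i : ℕ) (h : i + 2 < m) (h' : i + 1 < m) :
    genCable (permAct (perm (s m (i + 1))) (permAct (perm (s m i)) φ)) (.cross i h') *
      (genCable (permAct (perm (s m i)) φ) (.cross (i + 1) h) * genCable φ (.cross i h')) =
    genCable (permAct (perm (s m i)) (permAct (perm (s m (i + 1))) φ)) (.cross (i + 1) h) *
      (genCable (permAct (perm (s m (i + 1))) φ) (.cross i h') * genCable φ (.cross (i + 1) h)) := by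
  have m1 := cut_mono φ (show i ≤ i + 1 by omega)
  have m2 := cut_mono φ (show i + 1 ≤ i + 2 by omega)
  have m3 := cut_mono φ (show i + 2 ≤ i + 3 by omega)
  have m4 := cut_le φ (i + 3)
  have hp : i + 1 < m := h'
  simp only [genCable_cross, show i + 1 + 1 = i + 2 from rfl, show i + 1 + 2 = i + 3 from rfl]
  have a1 := cut_s_eq φ i hp
  have a2 := fun k hk => cut_s_ne φ i k hp hk
  have b1 := cut_s_eq φ (i + 1) h
  have b2 := fun k hk => cut_s_ne φ (i + 1) k h hk
  set φ1 := permAct (perm (s m i)) φ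
  set φ2 := permAct (perm (s m (i + 1))) φ
  have c1 := cut_s_eq φ1 (i + 1) h
  have c2 := fun k hk => cut_s_ne φ1 (i + 1) k h hk
  have d1 := cut_s_eq φ2 i hp
  have d2 := fun k hk => cut_s_ne φ2 i k hp hk
  rw [show i + 1 + 1 = i + 2 from rfl, show i + 1 + 2 = i + 3 from rfl] at *
  rw [c1, d1, c2 i (by omega), c2 (i + 1) (by omega), d2 (i + 2) (by omega),
    d2 (i + 3) (by omega), a1, b1, a2 i (by omega), a2 (i + 2) (by omega), a2 (i + 3) (by omega),
    b2 i (by omega), b2 (i + 1) (by omega), b2 (i + 3) (by omega)]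
  clear_value φ1 φ2
  clear a1 a2 b1 b2 c1 c2 d1 d2
  generalize cut φ i = a at *
  generalize cut φ (i + 1) = b at *
  generalize cut φ (i + 2) = c at *
  generalize cut φ (i + 3) = d at *
  obtain ⟨p, rfl⟩ := Nat.exists_eq_add_of_le m1
  obtain ⟨q, rfl⟩ := Nat.exists_eq_add_of_le m2
  obtain ⟨r, rfl⟩ := Nat.exists_eq_add_of_le m3
  have := X_yang_baxter (N := n) a p q r (by omega)
  convert this using 4 <;> omega

theorem permAct_perm_t (φ : Fin n →o Fin m) (i : ℕ) : permAct (perm (t m i)) φ = φ := by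
  rw [perm_t, permAct_one]

theorem genPerm_twist (i : ℕ) (h : i < m) : (genPerm (.twist i h) : Perm (Fin m)) = 1 := rfl

/-- The action of `RB m` on pairs `(φ, x)` by `j (φ, x) = (j_⋆ φ, φ^⋆ j * x)`; it determines
the cabling of an arbitrary ribbon braid. -/
def cable (n m : ℕ) : RB m →* Perm ((Fin n →o Fin m) × RB n) :=
  lift (genAct n)
    (fun i j hi hj => genAct_mul_eq (perm_far i j hi hj) fun φ => by
      have m1 := cut_mono φ (show i ≤ i + 1 by omega)
      have m2 := cut_mono φ (show i + 1 ≤ i + 2 by omega)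
      have m3 := cut_mono φ (show i + 2 ≤ j by omega)
      have m4 := cut_mono φ (show j ≤ j + 1 by omega)
      have m5 := cut_mono φ (show j + 1 ≤ j + 2 by omega)
      have m6 := cut_le φ (j + 2)
      have hi' : i + 1 < m := by omega
      rw [genPerm_cross, genPerm_cross]
      simp only [genCable_cross]
      rw [cut_s_ne φ j i hj (by omega), cut_s_ne φ j (i + 1) hj (by omega),
        cut_s_ne φ j (i + 2) hj (by omega), cut_s_ne φ i j hi' (by omega),
        cut_s_ne φ i (j + 1) hi' (by omega), cut_s_ne φ i (j + 2) hi' (by omega)]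
      exact (X_comm_X (by omega) (by omega)).eq)
    (fun i h => by
      have hb := perm_braid (n := m) i h
      ext1 ⟨φ, x⟩
      simp only [Equiv.Perm.mul_apply, genAct_apply, ← permAct_mul, ← mul_assoc] at hb ⊢
      rw [hb]
      congr 2
      have := cable_braid φ i h (by omega)
      simpa only [genPerm_cross, mul_assoc, ← permAct_mul] using this)
    (fun i j hi hj => genAct_mul_eq rfl fun φ => by
      rw [genPerm_twist, genPerm_twist, permAct_one]
      simp only [genCable_twist]
      rcases Nat.lt_trichotomy i j with h | h | h
      · have m1 := cut_mono φ (show i ≤ i + 1 by omega)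
        have m3 := cut_mono φ (show i + 1 ≤ j by omega)
        have m4 := cut_mono φ (show j ≤ j + 1 by omega)
        have m6 := cut_le φ (j + 1)
        exact (T_comm_T (by omega) (by omega)).eq
      · subst h; rfl
      · have m1 := cut_mono φ (show i ≤ i + 1 by omega)
        have m3 := cut_mono φ (show j + 1 ≤ i by omega)
        have m4 := cut_mono φ (show j ≤ j + 1 by omega)
        have m6 := cut_le φ (i + 1)
        exact (T_comm_T (by omega) (by omega)).eq.symm)
    (fun i h => genAct_mul_eq (by simp [genPerm_twist]) fun φ => by
      have m1 := cut_mono φ (show i ≤ i + 1 by omega)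
      have m2 := cut_mono φ (show i + 1 ≤ i + 2 by omega)
      have m6 := cut_le φ (i + 2)
      rw [genPerm_twist, permAct_one, genPerm_cross]
      simp only [genCable_twist, genCable_cross, show i + 1 + 1 = i + 2 from rfl]
      rw [cut_s_eq _ _ h, cut_s_ne φ i (i + 2) h (by omega)]
      have := X_T_left (N := n) (cut φ i) (cut φ (i + 1) - cut φ i) (cut φ (i + 2) - cut φ (i + 1))
        0 (cut φ (i + 1) - cut φ i) (by omega) (by omega)
      convert this using 3 <;> omega)
    (fun i h => genAct_mul_eq (by simp [genPerm_twist]) fun φ => by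
      have m1 := cut_mono φ (show i ≤ i + 1 by omega)
      have m2 := cut_mono φ (show i + 1 ≤ i + 2 by omega)
      have m6 := cut_le φ (i + 2)
      rw [genPerm_twist, permAct_one, genPerm_cross]
      simp only [genCable_twist, genCable_cross, show i + 1 + 1 = i + 2 from rfl]
      rw [cut_s_eq _ _ h, cut_s_ne φ i i h (by omega)]
      have := X_T_right (N := n) (cut φ i) (cut φ (i + 1) - cut φ i) (cut φ (i + 2) - cut φ (i + 1))
        0 (cut φ (i + 2) - cut φ (i + 1)) (by omega) (by omega)
      convert this using 3 <;> omega)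
    (fun i j h hj h1 h2 => genAct_mul_eq (by simp [genPerm_twist]) fun φ => by
      have m1 := cut_mono φ (show i ≤ i + 1 by omega)
      have m2 := cut_mono φ (show i + 1 ≤ i + 2 by omega)
      have m4 := cut_mono φ (show j ≤ j + 1 by omega)
      have m5 := cut_le φ (j + 1)
      have m6 := cut_le φ (i + 2)
      rw [genPerm_twist, permAct_one, genPerm_cross]
      simp only [genCable_twist, genCable_cross]
      rw [cut_s_ne φ i j h (by omega), cut_s_ne φ i (j + 1) h (by omega)]
      rcases Nat.lt_or_ge j i with h3 | h3
      · have := cut_mono φ (show j + 1 ≤ i by omega)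
        exact (T_comm_X (by omega) (by omega)).eq.symm
      · have := cut_mono φ (show i + 2 ≤ j by omega)
        exact (X_comm_T (by omega) (by omega)).eq)

theorem cable_gen (g : RibbonGen m) (φ : Fin n →o Fin m) (x : RB n) :
    cable n m (gen g) (φ, x) = (permAct (genPerm g) φ, genCable φ g * x) := by
  rw [cable, lift_gen, genAct_apply]

/-- The cabling `φ^⋆ j` of a ribbon braid `j` along an order-preserving map `φ`. -/
def pull (φ : Fin n →o Fin m) (j : RB m) : RB n := (cable n m j (φ, 1)).2

theorem cable_apply (j : RB m) (φ : Fin n →o Fin m) (x : RB n) :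
    cable n m j (φ, x) = (permAct (perm j) φ, pull φ j * x) := by
  suffices h : ∀ φ x y, (cable n m j (φ, x)).1 = permAct (perm j) φ ∧
      (cable n m j (φ, x * y)).2 = (cable n m j (φ, x)).2 * y by
    ext1
    · exact (h φ x 1).1
    · have := (h φ 1 x).2
      rwa [one_mul] at this
  induction j using induction with
  | one => intro φ x y; simp [permAct_one]
  | hgen g => intro φ x y; simp [cable_gen, mul_assoc]
  | mul j k hj hk =>
    intro φ x y
    simp only [map_mul, Equiv.Perm.mul_apply]
    have e (x : RB n) : cable n m k (φ, x) = (permAct (perm k) φ, (cable n m k (φ, x)).2) :=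
      Prod.ext (hk φ x 1).1 rfl
    refine ⟨?_, ?_⟩
    · rw [e, (hj _ _ 1).1, permAct_mul]
    · rw [e, (hk _ _ _).2, (hj _ _ _).2, ← e]
  | inv j hj =>
    intro φ x y
    have e (φ) (x : RB n) : cable n m j (φ, x) = (permAct (perm j) φ, (cable n m j (φ, x)).2) :=
      Prod.ext (hj φ x 1).1 rfl
    have key : ∀ φ x, (cable n m j⁻¹ (φ, x)).1 = permAct (perm j⁻¹) φ := fun φ x => by
      have h1 : cable n m j (cable n m j⁻¹ (φ, x)) = (φ, x) := by
        rw [← Equiv.Perm.mul_apply, ← map_mul, mul_inv_cancel, map_one]; rfl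
      have h2 := congrArg Prod.fst h1
      rw [← Prod.mk.eta (p := cable n m j⁻¹ (φ, x)), (hj _ _ 1).1] at h2
      have h3 : permAct (perm j) (cable n m j⁻¹ (φ, x)).1 = φ := h2
      conv_rhs => rw [← h3]
      rw [← permAct_mul, ← map_mul, inv_mul_cancel, map_one, permAct_one]
    refine ⟨key φ x, ?_⟩
    have h1 (y) : cable n m j (cable n m j⁻¹ (φ, y)) = (φ, y) := by
      rw [← Equiv.Perm.mul_apply, ← map_mul, mul_inv_cancel, map_one]; rfl
    have h3 : cable n m j ((cable n m j⁻¹ (φ, x)).1, (cable n m j⁻¹ (φ, x)).2 * y) =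
        (φ, x * y) := by
      ext1
      · rw [(hj _ _ 1).1, key, ← permAct_mul, ← map_mul, mul_inv_cancel, map_one, permAct_one]
      · rw [(hj _ _ y).2, h1]
    rw [← h1 (x * y)] at h3
    exact (congrArg Prod.snd ((cable n m j).injective h3)).symm

theorem pull_mul (φ : Fin n →o Fin m) (j k : RB m) :
    pull φ (j * k) = pull (permAct (perm k) φ) j * pull φ k := by
  conv_lhs => rw [pull, map_mul, Equiv.Perm.mul_apply, cable_apply, cable_apply, mul_one]

theorem pull_gen (φ : Fin n →o Fin m) (g : RibbonGen m) : pull φ (gen g) = genCable φ g := by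
  rw [pull, cable_gen, mul_one]

theorem pull_one (φ : Fin n →o Fin m) : pull φ 1 = 1 := by simp [pull]

theorem pull_inv (φ : Fin n →o Fin m) (j : RB m) :
    pull φ j⁻¹ = (pull (permAct (perm j⁻¹) φ) j)⁻¹ := by
  have := pull_mul φ j j⁻¹
  rw [mul_inv_cancel, pull_one] at this
  exact (inv_eq_of_mul_eq_one_right this.symm).symm

theorem pull_s (φ : Fin n →o Fin m) (i : ℕ) (h : i + 1 < m) : pull φ (s m i) =
    X n (cut φ i) (cut φ (i + 1) - cut φ i) (cut φ (i + 2) - cut φ (i + 1)) := by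
  rw [← gen_cross i h, pull_gen, genCable_cross]

theorem pull_t (φ : Fin n →o Fin m) (i : ℕ) (h : i < m) : pull φ (t m i) =
    T n (cut φ i) (cut φ (i + 1) - cut φ i) := by
  rw [← gen_twist i h, pull_gen, genCable_twist]

theorem pull_L (φ : Fin n →o Fin m) (a q : ℕ) (h : a + q < m) : pull φ (L m a q) =
    X n (cut φ a) (cut φ (a + 1) - cut φ a) (cut φ (a + 1 + q) - cut φ (a + 1)) := by
  induction q with
  | zero => simp [pull_one]
  | succ q ih =>
    have e1 := cut_X_first φ a 1 q q (by omega) le_rfl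
    have e2 := cut_X_outside φ a 1 q (a + q + 1) (by omega) (by omega)
    have e3 := cut_X_outside φ a 1 q (a + q + 2) (by omega) (by omega)
    rw [L_succ, pull_mul, ih (by omega), pull_s _ _ (by omega), ← X_one, e1, e2, e3]
    have m1 := cut_mono φ (show a ≤ a + 1 by omega)
    have m2 := cut_mono φ (show a + 1 ≤ a + 1 + q by omega)
    have m3 := cut_mono φ (show a + 1 + q ≤ a + q + 2 by omega)
    have m4 := cut_le φ (a + q + 2)
    rw [show a + q + 1 = a + 1 + q by omega, show a + 1 + (q + 1) = a + q + 2 by omega]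
    have := X_add_right (N := n) (cut φ a) (cut φ (a + 1) - cut φ a)
      (cut φ (a + 1 + q) - cut φ (a + 1)) (cut φ (a + q + 2) - cut φ (a + 1 + q)) (by omega)
    rw [show cut φ (a + q + 2) - cut φ (a + 1) = cut φ (a + 1 + q) - cut φ (a + 1) +
      (cut φ (a + q + 2) - cut φ (a + 1 + q)) by omega, this]
    congr 2; omega

theorem pull_X (φ : Fin n →o Fin m) (a p q : ℕ) (h : a + p + q ≤ m) : pull φ (X m a p q) =
    X n (cut φ a) (cut φ (a + p) - cut φ a) (cut φ (a + p + q) - cut φ (a + p)) := by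
  induction p generalizing a with
  | zero => simp [pull_one]
  | succ p ih =>
    have e1 := cut_X_outside φ (a + 1) p q a (by omega) (by omega)
    have e2 := cut_X_outside φ (a + 1) p q (a + 1) (by omega) (by omega)
    have e3 := cut_X_first φ (a + 1) p q q (by omega) le_rfl
    rw [X_succ, pull_mul, ih _ (by omega), pull_L _ _ _ (by omega), e1, e2, e3]
    have m1 := cut_mono φ (show a ≤ a + 1 by omega)
    have m2 := cut_mono φ (show a + 1 ≤ a + 1 + p by omega)
    have m3 := cut_mono φ (show a + 1 + p ≤ a + 1 + p + q by omega)
    have m4 := cut_le φ (a + 1 + p + q)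
    rw [show a + (p + 1) = a + 1 + p by omega]
    have := X_add_left (N := n) (cut φ a) (cut φ (a + 1) - cut φ a)
      (cut φ (a + 1 + p) - cut φ (a + 1)) (cut φ (a + 1 + p + q) - cut φ (a + 1 + p))
    rw [show cut φ (a + 1 + p) - cut φ a = cut φ (a + 1) - cut φ a +
      (cut φ (a + 1 + p) - cut φ (a + 1)) by omega, this]
    congr 2 <;> omega

theorem pull_T (φ : Fin n →o Fin m) (a p : ℕ) (h : a + p ≤ m) : pull φ (T m a p) =
    T n (cut φ a) (cut φ (a + p) - cut φ a) := by
  induction p generalizing a with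
  | zero => simp [pull_one]
  | succ p ih =>
    have m1 := cut_mono φ (show a ≤ a + 1 by omega)
    have m2 := cut_mono φ (show a + 1 ≤ a + 1 + p by omega)
    have m4 := cut_le φ (a + 1 + p)
    have e1 := cut_X_outside φ a 1 p a (by omega) (by omega)
    have e2 := cut_X_first φ a 1 p p (by omega) le_rfl
    have e3 := cut_X_outside φ a 1 p (a + p + 1) (by omega) (by omega)
    rw [T_succ, pull_mul, pull_mul, pull_mul, ih _ (by omega), perm_T _ _ (by omega), permAct_one,
      perm_t, permAct_one, pull_t _ _ (by omega), pull_X _ _ _ _ (by omega),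
      pull_X _ _ _ _ (by omega), e1, e2, e3]
    have := T_add (N := n) (cut φ a) (cut φ (a + 1) - cut φ a)
      (cut φ (a + 1 + p) - cut φ (a + 1)) (by omega)
    rw [show a + (p + 1) = a + 1 + p by omega, show a + p + 1 = a + 1 + p by omega,
      show cut φ (a + 1 + p) - cut φ a = cut φ (a + 1) - cut φ a +
      (cut φ (a + 1 + p) - cut φ (a + 1)) by omega, this]
    rw [mul_assoc]
    congr 3 <;> omega

theorem cut_top' (φ : Fin n →o Fin m) {k : ℕ} (h : k = m) : cut φ k = n := by rw [h, cut_top]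

theorem X_natural (φ : Fin n →o Fin m) (ψ : Fin n' →o Fin m') :
    pull (ordTensor φ ψ) (X (m + m') 0 m m') = X (n + n') 0 n n' := by
  rw [pull_X _ _ _ _ (by omega), zero_add, cut_top, cut_zero,
    cut_tensor_left _ _ _ le_rfl, cut_top]
  congr 1; omega

theorem T_natural (φ : Fin n →o Fin m) : pull φ (T m 0 m) = T n 0 n := by
  rw [pull_T _ _ _ (by omega), zero_add, cut_top, cut_zero, Nat.sub_zero]

end RB

theorem permAct_comp {ψ : Fin m →o Fin l} {φ : Fin n →o Fin m} {π : Perm (Fin l)}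
    {ρ : Perm (Fin m)} (h : ∀ x, permAct π ψ (ρ x) = π (ψ x)) :
    permAct π (ψ.comp φ) = (permAct π ψ).comp (permAct ρ φ) := by
  obtain ⟨τ, hτ⟩ := permAct_spec ρ φ
  exact permAct_eq τ fun x => by simp only [OrderHom.comp_coe, Function.comp, hτ, h]

namespace RB

variable {N : ℕ}
theorem val_eq_of_cut (φ : Fin n →o Fin m) (v : ℕ) (x : Fin n) (h1 : cut φ v ≤ x)
    (h2 : (x : ℕ) < cut φ (v + 1)) : (φ x : ℕ) = v := by
  have := lt_cut_iff φ v x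
  have := lt_cut_iff φ (v + 1) x
  omega

theorem apply_inv (f : Perm (Fin n)) (x : Fin n) : f (f⁻¹ x) = x := f.apply_symm_apply x
theorem inv_apply (f : Perm (Fin n)) (x : Fin n) : f⁻¹ (f x) = x := f.symm_apply_apply x

theorem perm_pull (φ : Fin n →o Fin m) (j : RB m) (x : Fin n) :
    permAct (perm j) φ (perm (pull φ j) x) = perm j (φ x) := by
  induction j using induction' generalizing φ x with
  | one => simp [pull_one, permAct_one]
  | mul j k hj hk => rw [map_mul, permAct_mul, pull_mul, map_mul, Equiv.Perm.mul_apply, hj, hk]; rfl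
  | inv j hj =>
    have h1 := hj (permAct (perm j⁻¹) φ) (perm (pull φ j⁻¹) x)
    rw [← permAct_mul, ← map_mul, mul_inv_cancel, map_one, permAct_one, pull_inv, map_inv perm (pull _ _),
      apply_inv] at h1
    rw [pull_inv, map_inv perm, map_inv perm, Equiv.Perm.eq_inv_iff_eq, ← map_inv perm j, ← h1]
  | ht i hi => rw [pull_t _ _ hi, perm_t, permAct_one, perm_T]; rfl
               have := cut_mono φ (show i ≤ i + 1 by omega)
               have := cut_le φ (i + 1)
               omega
  | hs i hi =>
    have m1 := cut_mono φ (show i ≤ i + 1 by omega)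
    have m2 := cut_mono φ (show i + 1 ≤ i + 2 by omega)
    have m3 := cut_le φ (i + 2)
    rw [pull_s _ _ hi]
    ext
    have hX := perm_X (n := n) (cut φ i) (cut φ (i + 1) - cut φ i) (cut φ (i + 2) - cut φ (i + 1))
      (by omega) x
    generalize perm (X n (cut φ i) (cut φ (i + 1) - cut φ i) (cut φ (i + 2) - cut φ (i + 1))) x = y
      at hX ⊢
    have e1 := cut_s_eq φ i hi
    have e0 := cut_s_ne φ i i hi (by omega)
    have e2 := cut_s_ne φ i (i + 2) hi (by omega)
    have ne := fun k hk => cut_s_ne φ i k hi hk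
    have l0 := lt_cut_iff φ i x
    have l1 := lt_cut_iff φ (i + 1) x
    have l2 := lt_cut_iff φ (i + 2) x
    have k1 := lt_cut_iff φ (φ x) x
    have k2 := lt_cut_iff φ (φ x + 1) x
    rw [perm_s i hi]
    generalize permAct (perm (s m i)) φ = χ at *
    rcases Nat.lt_or_ge (φ x) i with c0 | c0
    · rw [if_pos (by omega)] at hX
      rw [if_neg (by omega), if_neg (by omega)]
      apply val_eq_of_cut
      · rw [ne _ (by omega)]; omega
      · rw [ne _ (by omega)]; omega
    rcases Nat.lt_or_ge (φ x) (i + 1) with c1 | c1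
    · rw [if_neg (by omega), if_pos (by omega)] at hX
      rw [if_pos (by omega)]
      apply val_eq_of_cut
      · omega
      · rw [show i + 1 + 1 = i + 2 from rfl]; omega
    rcases Nat.lt_or_ge (φ x) (i + 2) with c2 | c2
    · rw [if_neg (by omega), if_neg (by omega), if_pos (by omega)] at hX
      rw [if_neg (by omega), if_pos (by omega)]
      apply val_eq_of_cut <;> omega
    · rw [if_neg (by omega), if_neg (by omega), if_neg (by omega)] at hX
      rw [if_neg (by omega), if_neg (by omega)]
      apply val_eq_of_cut
      · rw [ne _ (by omega)]; omega
      · rw [ne _ (by omega)]; omega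

theorem permAct_comp_pull (ψ : Fin m →o Fin l) (φ : Fin n →o Fin m) (j : RB l) :
    permAct (perm j) (ψ.comp φ) = (permAct (perm j) ψ).comp (permAct (perm (pull ψ j)) φ) :=
  permAct_comp fun x => perm_pull ψ j x

theorem pull_id (j : RB n) : pull OrderHom.id j = j := by
  have h (k : RB n) : permAct (perm k) OrderHom.id = OrderHom.id := permAct_eq (perm k) fun _ => rfl
  induction j using induction' with
  | one => exact pull_one _
  | hs i hi =>
    rw [pull_s _ _ hi, cut_id _ (by omega), cut_id _ (by omega), cut_id _ (by omega), ← X_one_one]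
    congr 1 <;> omega
  | ht i hi =>
    rw [pull_t _ _ hi, cut_id _ (by omega), cut_id _ (by omega), ← T_one]
    congr 1; omega
  | mul x y hx hy => rw [pull_mul, h, hx, hy]
  | inv x hx => rw [pull_inv, h, hx]

theorem pull_comp (ψ : Fin m →o Fin l) (φ : Fin n →o Fin m) (j : RB l) :
    pull (ψ.comp φ) j = pull φ (pull ψ j) := by
  induction j using induction' generalizing ψ φ with
  | one => simp [pull_one]
  | hs i hi =>
    have m1 := cut_mono ψ (show i ≤ i + 1 by omega)
    have m2 := cut_mono ψ (show i + 1 ≤ i + 2 by omega)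
    have m3 := cut_le ψ (i + 2)
    rw [pull_s _ _ hi, pull_s _ _ hi, pull_X _ _ _ _ (by omega), Nat.add_sub_cancel' m1,
      Nat.add_sub_cancel' m2, cut_comp, cut_comp, cut_comp]
  | ht i hi =>
    have m1 := cut_mono ψ (show i ≤ i + 1 by omega)
    have m3 := cut_le ψ (i + 1)
    rw [pull_t _ _ hi, pull_t _ _ hi, pull_T _ _ _ (by omega), Nat.add_sub_cancel' m1,
      cut_comp, cut_comp]
  | mul j k hj hk => rw [pull_mul, pull_mul, pull_mul, permAct_comp_pull, hj, hk]
  | inv j hj =>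
    rw [pull_inv, pull_inv, pull_inv, permAct_comp_pull, hj, pull_inv]

theorem perm_place_in (a : ℕ) (h : a + n ≤ N) (j : RB n) (x : Fin N) (h1 : a ≤ x)
    (h2 : (x : ℕ) < a + n) : (perm (place a h j) x : ℕ) = a + perm j ⟨x - a, by omega⟩ := by
  induction j using induction' generalizing x with
  | one => simp; omega
  | hs i hi => rw [place_s _ _ _ hi, perm_s _ (by omega), perm_s _ hi]; dsimp only; split_ifs <;> omega
  | ht i hi => rw [place_t _ _ _ hi, perm_t, perm_t]; simp; omega
  | mul j k hj hk =>
    have e := hk x h1 h2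
    have b := (perm k ⟨x - a, by omega⟩).isLt
    rw [map_mul, map_mul, map_mul, Equiv.Perm.mul_apply, hj _ (by omega) (by omega)]
    simp only [e, Equiv.Perm.mul_apply, Nat.add_sub_cancel_left]
  | inv j hj =>
    have b := ((perm j)⁻¹ ⟨x - a, by omega⟩).isLt
    have e := hj ⟨a + (perm j)⁻¹ ⟨x - a, by omega⟩, by omega⟩ (by simp) (by simp)
    simp only [Nat.add_sub_cancel_left, Fin.eta] at e
    have e' : perm (place a h j) ⟨a + (perm j)⁻¹ ⟨x - a, by omega⟩, by omega⟩ = x := by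
      ext; rw [e, apply_inv]; simp only; omega
    rw [map_inv, map_inv, map_inv]
    nth_rw 1 [← e']
    rw [inv_apply]

theorem perm_place_out (a : ℕ) (h : a + n ≤ N) (j : RB n) (x : Fin N)
    (h1 : (x : ℕ) < a ∨ a + n ≤ x) : perm (place a h j) x = x := by
  induction j using induction' with
  | one => simp
  | hs i hi => ext; rw [place_s _ _ _ hi, perm_s _ (by omega)]; split_ifs <;> omega
  | ht i hi => rw [place_t _ _ _ hi, perm_t]; rfl
  | mul j k hj hk => rw [map_mul, map_mul, Equiv.Perm.mul_apply, hk, hj]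
  | inv j hj => rw [map_inv, map_inv, Equiv.Perm.inv_eq_iff_eq, hj]

end RB

/-- The block sum of two permutations. -/
def permTensor (π : Perm (Fin n)) (ρ : Perm (Fin n')) : Perm (Fin (n + n')) :=
  finSumFinEquiv.permCongr (π.sumCongr ρ)

theorem permTensor_left (π : Perm (Fin n)) (ρ : Perm (Fin n')) (x : Fin (n + n'))
    (h : (x : ℕ) < n) : (permTensor π ρ x : ℕ) = π ⟨x, h⟩ := by
  obtain ⟨x, rfl⟩ : ∃ y : Fin n, x = Fin.castAdd n' y := ⟨⟨x, h⟩, rfl⟩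
  simp [permTensor, Equiv.permCongr_apply]

theorem permTensor_right (π : Perm (Fin n)) (ρ : Perm (Fin n')) (x : Fin (n + n'))
    (h : n ≤ (x : ℕ)) : (permTensor π ρ x : ℕ) = n + ρ ⟨x - n, by omega⟩ := by
  obtain ⟨x, rfl⟩ : ∃ y : Fin n', x = Fin.natAdd n y :=
    ⟨⟨x - n, by omega⟩, by ext; simp; omega⟩
  simp [permTensor, Equiv.permCongr_apply]

theorem permTensor_ext (π : Perm (Fin (n + n'))) (ρ : Perm (Fin n)) (ρ' : Perm (Fin n'))
    (h1 : ∀ (x : Fin (n + n')) (h : (x : ℕ) < n), (π x : ℕ) = ρ ⟨x, h⟩)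
    (h2 : ∀ (x : Fin (n + n')) (_ : n ≤ (x : ℕ)), (π x : ℕ) = n + ρ' ⟨x - n, by omega⟩) :
    π = permTensor ρ ρ' := by
  ext x
  rcases Nat.lt_or_ge x n with h | h
  · rw [permTensor_left _ _ _ h, h1 x h]
  · rw [permTensor_right _ _ _ h, h2 x h]

theorem permAct_ordTensor (π : Perm (Fin m)) (π' : Perm (Fin m')) (φ : Fin n →o Fin m)
    (ψ : Fin n' →o Fin m') : permAct (permTensor π π') (ordTensor φ ψ) =
      ordTensor (permAct π φ) (permAct π' ψ) := by
  obtain ⟨ρ, hρ⟩ := permAct_spec π φ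
  obtain ⟨ρ', hρ'⟩ := permAct_spec π' ψ
  refine permAct_eq (permTensor ρ ρ') fun x => ?_
  ext
  rcases Nat.lt_or_ge x n with h | h
  · have h1 := permTensor_left ρ ρ' x h
    have h2 := ordTensor_left φ ψ x h
    have b1 := (ρ ⟨x, h⟩).isLt
    have b2 := (φ ⟨x, h⟩).isLt
    rw [ordTensor_left _ _ _ (h1 ▸ b1), permTensor_left π π' (ordTensor φ ψ x) (h2 ▸ b2)]
    simp only [h1, h2, Fin.eta, hρ]
  · have h1 := permTensor_right ρ ρ' x h
    have h2 := ordTensor_right φ ψ x h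
    rw [ordTensor_right _ _ _ (h1 ▸ Nat.le_add_right _ _),
      permTensor_right π π' (ordTensor φ ψ x) (h2 ▸ Nat.le_add_right _ _)]
    simp only [h1, h2, Fin.eta, Nat.add_sub_cancel_left, hρ']

namespace RB

theorem perm_place_left (j : RB n) :
    perm (place (N := n + n') 0 (by omega) j) = permTensor (perm j) 1 :=
  permTensor_ext _ _ _
    (fun x h => by rw [perm_place_in _ _ _ _ (by omega) (by omega), zero_add]; rfl)
    (fun x h => by rw [perm_place_out _ _ _ _ (by omega)]; simp; omega)

theorem perm_place_right (j : RB n') :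
    perm (place (N := n + n') n (by omega) j) = permTensor 1 (perm j) :=
  permTensor_ext _ _ _
    (fun x h => by rw [perm_place_out _ _ _ _ (by omega)]; rfl)
    (fun x h => by rw [perm_place_in _ _ _ _ (by omega) (by omega)])

theorem pull_place_left (φ : Fin n →o Fin m) (ψ : Fin n' →o Fin m') (j : RB m) :
    pull (ordTensor φ ψ) (place (N := m + m') 0 (by omega) j) = place 0 (by omega) (pull φ j) := by
  have key (φ : Fin n →o Fin m) (k : RB m) :
      permAct (perm (place (N := m + m') 0 (by omega) k)) (ordTensor φ ψ) =
        ordTensor (permAct (perm k) φ) ψ := by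
    rw [perm_place_left, permAct_ordTensor, permAct_one]
  induction j using induction' generalizing φ with
  | one => simp [pull_one]
  | hs i hi =>
    have m1 := cut_mono φ (show i ≤ i + 1 by omega)
    have m2 := cut_mono φ (show i + 1 ≤ i + 2 by omega)
    have m3 := cut_le φ (i + 2)
    rw [place_s _ _ _ hi, pull_s _ _ (by omega), pull_s _ _ hi, place_X _ _ _ _ _ (by omega)]
    simp only [zero_add]
    rw [cut_tensor_left _ _ _ (by omega), cut_tensor_left _ _ _ (by omega),
      cut_tensor_left _ _ _ (by omega)]
  | ht i hi =>
    have m1 := cut_mono φ (show i ≤ i + 1 by omega)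
    have m3 := cut_le φ (i + 1)
    rw [place_t _ _ _ hi, pull_t _ _ (by omega), pull_t _ _ hi, place_T _ _ _ _ (by omega)]
    simp only [zero_add]
    rw [cut_tensor_left _ _ _ (by omega), cut_tensor_left _ _ _ (by omega)]
  | mul j k hj hk => rw [map_mul, pull_mul, pull_mul, map_mul, hk, key, hj]
  | inv j hj =>
    rw [map_inv, pull_inv, pull_inv, ← map_inv (place 0 _), key, hj, map_inv perm, map_inv (place _ _)]

theorem pull_place_right (φ : Fin n →o Fin m) (ψ : Fin n' →o Fin m') (j : RB m') :
    pull (ordTensor φ ψ) (place (N := m + m') m (by omega) j) = place n (by omega) (pull ψ j) := by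
  have key (ψ : Fin n' →o Fin m') (k : RB m') :
      permAct (perm (place (N := m + m') m (by omega) k)) (ordTensor φ ψ) =
        ordTensor φ (permAct (perm k) ψ) := by
    rw [perm_place_right, permAct_ordTensor, permAct_one]
  induction j using induction' generalizing ψ with
  | one => simp [pull_one]
  | hs i hi =>
    have m1 := cut_mono ψ (show i ≤ i + 1 by omega)
    have m2 := cut_mono ψ (show i + 1 ≤ i + 2 by omega)
    have m3 := cut_le ψ (i + 2)
    rw [place_s _ _ _ hi, pull_s _ _ (by omega), pull_s _ _ hi, place_X _ _ _ _ _ (by omega)]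
    simp only [add_assoc]
    rw [cut_tensor_right, cut_tensor_right, cut_tensor_right]
    congr 1 <;> omega
  | ht i hi =>
    have m1 := cut_mono ψ (show i ≤ i + 1 by omega)
    have m3 := cut_le ψ (i + 1)
    rw [place_t _ _ _ hi, pull_t _ _ (by omega), pull_t _ _ hi, place_T _ _ _ _ (by omega)]
    simp only [add_assoc]
    rw [cut_tensor_right, cut_tensor_right]
    congr 1; omega
  | mul j k hj hk => rw [map_mul, pull_mul, pull_mul, map_mul, hk, key, hj]
  | inv j hj =>
    rw [map_inv, pull_inv, pull_inv, ← map_inv (place m _), key, hj, map_inv perm, map_inv (place _ _)]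

end RB

/-- A family of groups `J n` with underlying permutations and cablings `pull φ j = φ^⋆ j` that satisfy
the axioms of a crossed simplicial group (equivalently, that form a distributive law
`(φ, j) ↦ (j_⋆ φ, φ^⋆ j)`, where `j_⋆ φ = permAct (perm j) φ`), together with block inclusions
`place`, block crossings `braid` and full twists `twist` compatible with them. -/
class CrossedFamily (J : ℕ → Type u) [∀ n, Group (J n)] where
  perm {n : ℕ} : J n →* Perm (Fin n)
  pull {n m : ℕ} : (Fin n →o Fin m) → J m → J n
  perm_pull {n m : ℕ} (φ : Fin n →o Fin m) (j : J m) (x : Fin n) :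
    permAct (perm j) φ (perm (pull φ j) x) = perm j (φ x)
  pull_mul {n m : ℕ} (φ : Fin n →o Fin m) (j k : J m) :
    pull φ (j * k) = pull (permAct (perm k) φ) j * pull φ k
  pull_id {n : ℕ} (j : J n) : pull OrderHom.id j = j
  pull_comp {n m l : ℕ} (ψ : Fin m →o Fin l) (φ : Fin n →o Fin m) (j : J l) :
    pull (ψ.comp φ) j = pull φ (pull ψ j)
  place {n N : ℕ} (a : ℕ) (h : a + n ≤ N) : J n →* J N
  place_self {n : ℕ} (h : 0 + n ≤ n) (j : J n) : place 0 h j = j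
  place_place {n m l : ℕ} (a b : ℕ) (h : a + n ≤ m) (h' : b + m ≤ l) (j : J n) :
    place b h' (place a h j) = place (b + a) (by omega) j
  place_comm {n m N : ℕ} (a b : ℕ) (ha : a + n ≤ N) (hb : b + m ≤ N) (hab : a + n ≤ b)
    (j : J n) (k : J m) : Commute (place a ha j) (place b hb k)
  perm_place_in {n N : ℕ} (a : ℕ) (h : a + n ≤ N) (j : J n) (x : Fin N) (h1 : a ≤ (x : ℕ))
    (h2 : (x : ℕ) < a + n) : (perm (place a h j) x : ℕ) = a + perm j ⟨x - a, by omega⟩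
  perm_place_out {n N : ℕ} (a : ℕ) (h : a + n ≤ N) (j : J n) (x : Fin N)
    (h1 : (x : ℕ) < a ∨ a + n ≤ (x : ℕ)) : perm (place a h j) x = x
  pull_place_left {n m n' m' : ℕ} (φ : Fin n →o Fin m) (ψ : Fin n' →o Fin m') (j : J m) :
    pull (ordTensor φ ψ) (place (N := m + m') 0 (by omega) j) = place 0 (by omega) (pull φ j)
  pull_place_right {n m n' m' : ℕ} (φ : Fin n →o Fin m) (ψ : Fin n' →o Fin m') (j : J m') :
    pull (ordTensor φ ψ) (place (N := m + m') m (by omega) j) = place n (by omega) (pull ψ j)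
  braid (n m : ℕ) : J (n + m)
  perm_braid (n m : ℕ) (x : Fin (n + m)) :
    (perm (braid n m) x : ℕ) = if (x : ℕ) < n then (x : ℕ) + m else x - n
  pull_braid {n m n' m' : ℕ} (φ : Fin n →o Fin m) (ψ : Fin n' →o Fin m') :
    pull (ordTensor φ ψ) (braid m m') = braid n n'
  braid_place_left (n m : ℕ) (j : J n) :
    braid n m * place 0 (by omega) j = place m (by omega) j * braid n m
  braid_place_right (n m : ℕ) (k : J m) :
    braid n m * place n (by omega) k = place 0 (by omega) k * braid n m
  braid_add_right (n m k : ℕ) : braid n (m + k) =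
    place m (by omega) (braid n k) * place 0 (by omega) (braid n m)
  braid_add_left (n m k : ℕ) : braid (n + m) k =
    place 0 (by omega) (braid n k) * place n (by omega) (braid m k)
  twist (n : ℕ) : J n
  perm_twist (n : ℕ) : perm (twist n) = 1
  twist_comm {n : ℕ} (j : J n) : Commute (twist n) j
  pull_twist {n m : ℕ} (φ : Fin n →o Fin m) : pull φ (twist m) = twist n
  twist_zero : twist 0 = 1
  twist_add (n m : ℕ) : twist (n + m) = place 0 (by omega) (braid m n) * braid n m *
    (place 0 (by omega) (twist n) * place n (by omega) (twist m))

/-- The ribbon braid crossed simplicial group. -/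
instance RB.crossedFamily : CrossedFamily RB where
  perm := RB.perm
  pull := RB.pull
  perm_pull := RB.perm_pull
  pull_mul := RB.pull_mul
  pull_id := RB.pull_id
  pull_comp := RB.pull_comp
  place := RB.place
  place_self := RB.place_self
  place_place := RB.place_place
  place_comm := RB.place_comm
  perm_place_in := RB.perm_place_in
  perm_place_out := RB.perm_place_out
  pull_place_left := RB.pull_place_left
  pull_place_right := RB.pull_place_right
  braid n m := RB.X (n + m) 0 n m
  perm_braid n m x := by
    rw [RB.perm_X _ _ _ (by omega)]; split_ifs <;> omega
  pull_braid := RB.X_natural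
  braid_place_left n m j := by
    have := RB.X_place_left (N := n + m) 0 n m (by omega) j
    simpa only [zero_add] using this
  braid_place_right n m j := by
    have := RB.X_place_right (N := n + m) 0 n m (by omega) j
    simpa only [zero_add] using this
  braid_add_right n m k := by
    rw [RB.X_add_right _ _ _ _ (by omega), RB.place_X _ _ _ _ _ (by omega),
      RB.place_X _ _ _ _ _ (by omega)]
    simp only [zero_add, add_zero]
  braid_add_left n m k := by
    rw [RB.X_add_left, RB.place_X _ _ _ _ _ (by omega), RB.place_X _ _ _ _ _ (by omega)]
    simp only [zero_add, add_zero]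
  twist n := RB.T n 0 n
  perm_twist n := RB.perm_T _ _ (by omega)
  twist_comm := RB.T_central
  pull_twist := RB.T_natural
  twist_zero := rfl
  twist_add n m := by
    rw [RB.T_add _ _ _ (by omega), RB.place_X _ _ _ _ _ (by omega), RB.place_T _ _ _ _ (by omega),
      RB.place_T _ _ _ _ (by omega)]
    simp only [zero_add, add_zero]

namespace CrossedFamily

variable {J : ℕ → Type u} [∀ n, Group (J n)] [CrossedFamily J]

theorem perm_place_left (j : J n) :
    perm (place (N := n + n') 0 (by omega) j) = permTensor (perm j) 1 :=
  permTensor_ext _ _ _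
    (fun x h => by rw [perm_place_in _ _ _ _ (by omega) (by omega), zero_add]; rfl)
    (fun x h => by rw [perm_place_out _ _ _ _ (by omega)]; simp; omega)

theorem perm_place_right (j : J n') :
    perm (place (N := n + n') n (by omega) j) = permTensor 1 (perm j) :=
  permTensor_ext _ _ _
    (fun x h => by rw [perm_place_out _ _ _ _ (by omega)]; rfl)
    (fun x h => by rw [perm_place_in _ _ _ _ (by omega) (by omega)])

theorem pull_one (φ : Fin n →o Fin m) : pull φ (1 : J m) = 1 := by
  have := pull_mul φ (1 : J m) 1
  rwa [mul_one, map_one, permAct_one, left_eq_mul] at this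

end CrossedFamily

section Wreath

variable (G : Type w) [Group G] (J : ℕ → Type u) [∀ n, Group (J n)] [CrossedFamily J]

/-- `J n` acts on `G^n` through the underlying permutations. -/
def labelAct (n : ℕ) : J n →* MulAut (Fin n → G) :=
  (mulAutArrow (G := Perm (Fin n)) (A := Fin n) (M := G)).comp CrossedFamily.perm

theorem labelAct_apply {n : ℕ} (j : J n) (x : Fin n → G) (i : Fin n) :
    labelAct G J n j x i = x ((CrossedFamily.perm j)⁻¹ i) := rfl

/-- The group `G^n ⋊ J n` of `G`-labelled elements of `J n`. -/
abbrev Wreath (n : ℕ) : Type (max w u) := (Fin n → G) ⋊[labelAct G J n] (J n)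

namespace Wreath
open CrossedFamily

variable {G J} {n m l n' m' N : ℕ}

/-- The underlying permutation of a labelled element. -/
def perm : Wreath G J n →* Perm (Fin n) := CrossedFamily.perm.comp SemidirectProduct.rightHom

theorem perm_apply (j : Wreath G J n) : perm j = CrossedFamily.perm j.right := rfl

/-- Cabling of labelled elements: every copy of a strand carries the label of that strand. -/
def pull (φ : Fin n →o Fin m) (j : Wreath G J m) : Wreath G J n :=
  ⟨fun x => j.left (permAct (perm j) φ x), CrossedFamily.pull φ j.right⟩

/-- Labels `x` placed on the block `a, …, a + n - 1`, with `1` elsewhere. -/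
def placeLabel (a : ℕ) (N : ℕ) (x : Fin n → G) : Fin N → G := fun i =>
  if h : a ≤ (i : ℕ) ∧ (i : ℕ) < a + n then x ⟨i - a, by omega⟩ else 1

theorem placeLabel_in (a : ℕ) (x : Fin n → G) (i : Fin N) (h1 : a ≤ (i : ℕ))
    (h2 : (i : ℕ) < a + n) : placeLabel a N x i = x ⟨i - a, by omega⟩ := dif_pos ⟨h1, h2⟩
theorem placeLabel_out (a : ℕ) (x : Fin n → G) (i : Fin N)
    (h : (i : ℕ) < a ∨ a + n ≤ (i : ℕ)) : placeLabel a N x i = 1 := dif_neg (by omega)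

/-- Block inclusion of labelled elements. -/
def place (a : ℕ) (h : a + n ≤ N) : Wreath G J n →* Wreath G J N where
  toFun j := ⟨placeLabel a N j.left, CrossedFamily.place a h j.right⟩
  map_one' := by
    ext i
    · simp [placeLabel]
    · simp
  map_mul' j k := by
    ext i
    · simp only [SemidirectProduct.mul_left, Pi.mul_apply, labelAct_apply]
      rw [← map_inv CrossedFamily.perm, ← map_inv]
      by_cases hi : a ≤ (i : ℕ) ∧ (i : ℕ) < a + n
      · have e := perm_place_in a h j.right⁻¹ i hi.1 hi.2
        have b := (CrossedFamily.perm j.right⁻¹ ⟨i - a, by omega⟩).isLt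
        rw [placeLabel_in _ _ _ hi.1 hi.2, placeLabel_in _ _ _ hi.1 hi.2,
          placeLabel_in _ _ _ (by omega) (by omega)]
        simp only [Pi.mul_apply, labelAct_apply]
        rw [← map_inv CrossedFamily.perm j.right]
        refine congrArg (fun y => j.left _ * k.left y) (Fin.ext ?_)
        simp only [e, Nat.add_sub_cancel_left]
      · have e := perm_place_out a h j.right⁻¹ i (by omega)
        rw [e, placeLabel_out _ _ _ (by omega), placeLabel_out _ _ _ (by omega),
          placeLabel_out _ _ _ (by omega), one_mul]
    · simp

@[simp] theorem place_left_eq (a : ℕ) (h : a + n ≤ N) (j : Wreath G J n) :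
    (place a h j).left = placeLabel a N j.left := rfl
@[simp] theorem place_right_eq (a : ℕ) (h : a + n ≤ N) (j : Wreath G J n) :
    (place a h j).right = CrossedFamily.place a h j.right := rfl
@[simp] theorem pull_left_eq (φ : Fin n →o Fin m) (j : Wreath G J m) (i : Fin n) :
    (pull φ j).left i = j.left (permAct (CrossedFamily.perm j.right) φ i) := rfl
@[simp] theorem pull_right_eq (φ : Fin n →o Fin m) (j : Wreath G J m) :
    (pull φ j).right = CrossedFamily.pull φ j.right := rfl

/-- The element `j` with all labels `1`. -/
abbrev pure (j : J n) : Wreath G J n := SemidirectProduct.inr j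

theorem mul_left_apply (j k : Wreath G J n) (i : Fin n) :
    (j * k).left i = j.left i * k.left ((CrossedFamily.perm j.right)⁻¹ i) := rfl

theorem placeLabel_one (a N : ℕ) : placeLabel a N (1 : Fin n → G) = 1 := by
  ext i; simp [placeLabel]

theorem place_pure (a : ℕ) (h : a + n ≤ N) (j : J n) :
    place a h (pure j : Wreath G J n) = pure (CrossedFamily.place a h j) := by
  ext i
  · simp [placeLabel_one]
  · simp

theorem pull_pure (φ : Fin n →o Fin m) (j : J m) :
    pull φ (pure j : Wreath G J m) = pure (CrossedFamily.pull φ j) := by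
  ext i <;> simp

/-- The crossed simplicial group `G^n ⋊ J n`, with the block crossings and twists of `J`. -/
instance crossedFamily : CrossedFamily (Wreath G J) where
  perm := perm
  pull := pull
  place := place
  braid n m := pure (CrossedFamily.braid n m)
  twist n := pure (CrossedFamily.twist n)
  perm_pull φ j x := CrossedFamily.perm_pull φ j.right x
  pull_mul φ j k := by
    ext i
    · simp only [pull_left_eq, mul_left_apply, SemidirectProduct.mul_right, map_mul, perm_apply,
        permAct_mul, pull_right_eq]
      congr 2
      have h := CrossedFamily.perm_pull (permAct (CrossedFamily.perm k.right) φ) j.right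
        ((CrossedFamily.perm (CrossedFamily.pull (permAct (CrossedFamily.perm k.right) φ)
          j.right))⁻¹ i)
      rw [RB.apply_inv] at h
      rw [h, RB.inv_apply]
    · simp [CrossedFamily.pull_mul, perm_apply]
  pull_id {n} j := by
    have h (k : J n) : permAct (CrossedFamily.perm k) (OrderHom.id : Fin n →o Fin n) = OrderHom.id :=
      permAct_eq (CrossedFamily.perm k) fun _ => rfl
    ext i
    · simp [h]
    · simp [CrossedFamily.pull_id]
  pull_comp ψ φ j := by
    ext i
    · simp only [pull_left_eq, pull_right_eq]
      rw [permAct_comp (CrossedFamily.perm_pull ψ j.right)]; rfl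
    · simp [CrossedFamily.pull_comp]
  place_self h j := by
    ext i
    · simp only [place_left_eq]
      rw [placeLabel_in _ _ _ (by omega) (by omega)]; rfl
    · simp [CrossedFamily.place_self]
  place_place {n m l} a b h h' j := by
    ext i
    · simp only [place_left_eq]
      by_cases h1 : b + a ≤ (i : ℕ) ∧ (i : ℕ) < b + a + n
      · rw [placeLabel_in (b + a) _ _ (by omega) (by omega), placeLabel_in b _ _ (by omega) (by omega),
          placeLabel_in a _ _ (by simp only; omega) (by simp only; omega)]
        simp only [Nat.sub_sub]
      · rw [placeLabel_out (b + a) _ _ (by omega)]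
        by_cases h2 : b ≤ (i : ℕ) ∧ (i : ℕ) < b + m
        · rw [placeLabel_in b _ _ (by omega) (by omega),
            placeLabel_out a _ _ (by simp only; omega)]
        · rw [placeLabel_out b _ _ (by omega)]
    · simp [CrossedFamily.place_place]
  place_comm {n m N} a b ha hb hab j k := by
    ext i
    · simp only [mul_left_apply, place_left_eq, place_right_eq]
      by_cases h1 : a ≤ (i : ℕ) ∧ (i : ℕ) < a + n
      · have e1 : (CrossedFamily.perm (CrossedFamily.place b hb k.right))⁻¹ i = i := by
          rw [← map_inv, ← map_inv]; exact perm_place_out _ _ _ _ (by omega)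
        have e2 : (CrossedFamily.perm (CrossedFamily.place a ha j.right))⁻¹ i =
            CrossedFamily.perm (CrossedFamily.place a ha j.right⁻¹) i := by
          rw [← map_inv, ← map_inv]
        have e3 := perm_place_in a ha j.right⁻¹ i h1.1 h1.2
        have b3 := (CrossedFamily.perm j.right⁻¹ ⟨i - a, by omega⟩).isLt
        rw [e1, e2, placeLabel_out b _ i (by omega), placeLabel_out b _ _ (by omega), mul_one,
          one_mul]
      · by_cases h2 : b ≤ (i : ℕ) ∧ (i : ℕ) < b + m
        · have e1 : (CrossedFamily.perm (CrossedFamily.place a ha j.right))⁻¹ i = i := by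
            rw [← map_inv, ← map_inv]; exact perm_place_out _ _ _ _ (by omega)
          have e2 : (CrossedFamily.perm (CrossedFamily.place b hb k.right))⁻¹ i =
              CrossedFamily.perm (CrossedFamily.place b hb k.right⁻¹) i := by
            rw [← map_inv, ← map_inv]
          have e3 := perm_place_in b hb k.right⁻¹ i h2.1 h2.2
          rw [e1, e2, placeLabel_out a _ i (by omega), placeLabel_out a _ _ (by omega), mul_one,
            one_mul]
        · have e1 : (CrossedFamily.perm (CrossedFamily.place a ha j.right))⁻¹ i = i := by
            rw [← map_inv, ← map_inv]; exact perm_place_out _ _ _ _ (by omega)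
          have e2 : (CrossedFamily.perm (CrossedFamily.place b hb k.right))⁻¹ i = i := by
            rw [← map_inv, ← map_inv]; exact perm_place_out _ _ _ _ (by omega)
          rw [e1, e2, placeLabel_out a _ i (by omega), placeLabel_out b _ i (by omega)]
    · simpa using (CrossedFamily.place_comm a b ha hb hab j.right k.right).eq
  perm_place_in a h j := CrossedFamily.perm_place_in a h j.right
  perm_place_out a h j := CrossedFamily.perm_place_out a h j.right
  pull_place_left {n m n' m'} φ ψ j := by
    ext i
    · simp only [pull_left_eq, place_left_eq, place_right_eq]
      rw [CrossedFamily.perm_place_left, permAct_ordTensor, permAct_one]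
      rcases Nat.lt_or_ge i n with h | h
      · have e := ordTensor_left (permAct (CrossedFamily.perm j.right) φ) ψ i h
        rw [placeLabel_in 0 _ i (by omega) (by omega), placeLabel_in 0 _ _ (by omega) (by omega)]
        simp only [e, Nat.sub_zero, Fin.eta, pull_left_eq]
      · have e := ordTensor_right (permAct (CrossedFamily.perm j.right) φ) ψ i h
        rw [placeLabel_out 0 _ i (by omega), placeLabel_out 0 _ _ (by omega)]
    · simp [CrossedFamily.pull_place_left]
  pull_place_right {n m n' m'} φ ψ j := by
    ext i
    · simp only [pull_left_eq, place_left_eq, place_right_eq]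
      rw [CrossedFamily.perm_place_right, permAct_ordTensor, permAct_one]
      rcases Nat.lt_or_ge i n with h | h
      · have e := ordTensor_left φ (permAct (CrossedFamily.perm j.right) ψ) i h
        rw [placeLabel_out n _ i (by omega), placeLabel_out m _ _ (by omega)]
      · have e := ordTensor_right φ (permAct (CrossedFamily.perm j.right) ψ) i h
        rw [placeLabel_in n _ i (by omega) (by omega), placeLabel_in m _ _ (by omega) (by omega)]
        simp only [e, Nat.add_sub_cancel_left, Fin.eta, pull_left_eq]
    · simp [CrossedFamily.pull_place_right]
  perm_braid n m x := CrossedFamily.perm_braid (J := J) n m x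
  pull_braid φ ψ := by rw [pull_pure, CrossedFamily.pull_braid]
  braid_place_left n m j := by
    ext i
    · obtain ⟨i, rfl⟩ := (CrossedFamily.perm (CrossedFamily.braid (J := J) n m)).surjective i
      have e := CrossedFamily.perm_braid (J := J) n m i
      simp only [mul_left_apply, place_left_eq, SemidirectProduct.left_inr, Pi.one_apply, mul_one,
        one_mul, SemidirectProduct.right_inr, RB.inv_apply]
      rcases Nat.lt_or_ge i n with h | h
      · rw [if_pos h] at e
        rw [placeLabel_in 0 _ _ (by omega) (by omega), placeLabel_in m _ _ (by omega) (by omega)]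
        simp only [e, Nat.add_sub_cancel, Nat.sub_zero]
      · rw [if_neg (by omega)] at e
        rw [placeLabel_out 0 _ _ (by omega), placeLabel_out m _ _ (by omega)]
    · simp [CrossedFamily.braid_place_left]
  braid_place_right n m j := by
    ext i
    · obtain ⟨i, rfl⟩ := (CrossedFamily.perm (CrossedFamily.braid (J := J) n m)).surjective i
      have e := CrossedFamily.perm_braid (J := J) n m i
      simp only [mul_left_apply, place_left_eq, SemidirectProduct.left_inr, Pi.one_apply, mul_one,
        one_mul, SemidirectProduct.right_inr, RB.inv_apply]
      rcases Nat.lt_or_ge i n with h | h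
      · rw [if_pos h] at e
        rw [placeLabel_out n _ _ (by omega), placeLabel_out 0 _ _ (by omega)]
      · rw [if_neg (by omega)] at e
        rw [placeLabel_in n _ _ (by omega) (by omega), placeLabel_in 0 _ _ (by omega) (by omega)]
        simp only [e, Nat.sub_zero]
    · simp [CrossedFamily.braid_place_right]
  braid_add_right n m k := by
    rw [place_pure, place_pure, ← map_mul, ← CrossedFamily.braid_add_right]
  braid_add_left n m k := by
    rw [place_pure, place_pure, ← map_mul, ← CrossedFamily.braid_add_left]
  perm_twist n := CrossedFamily.perm_twist (J := J) n
  twist_comm {n} j := by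
    ext i
    · simp [mul_left_apply, CrossedFamily.perm_twist]
    · simpa using (CrossedFamily.twist_comm j.right).eq
  pull_twist φ := by rw [pull_pure, CrossedFamily.pull_twist]
  twist_zero := by rw [CrossedFamily.twist_zero]; exact map_one _
  twist_add n m := by
    rw [place_pure, place_pure, place_pure, ← map_mul, ← map_mul, ← map_mul,
      ← CrossedFamily.twist_add]

end Wreath
end Wreath

open CategoryTheory MonoidalCategory

/-- A balanced braided monoidal category: a braided monoidal category with a full twist, that is, a
natural automorphism `θ` of the identity functor with `θ_I = 1` and
`θ_{X ⊗ Y} = c_{Y,X} ∘ (θ_Y ⊗ θ_X) ∘ c_{X,Y}`. -/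
class BalancedCategory (C : Type u) [Category.{v} C] [MonoidalCategory C] [BraidedCategory C] where
  twist (X : C) : X ≅ X
  twist_naturality {X Y : C} (f : X ⟶ Y) : f ≫ (twist Y).hom = (twist X).hom ≫ f
  twist_unit : (twist (𝟙_ C)).hom = 𝟙 (𝟙_ C)
  twist_tensor (X Y : C) : (twist (X ⊗ Y)).hom =
    (β_ X Y).hom ≫ ((twist Y).hom ⊗ₘ (twist X).hom) ≫ (β_ Y X).hom

/-- The opposite of a balanced category, with the opposite braiding and the opposite twist. -/
instance BalancedCategory.op (C : Type u) [Category.{v} C] [MonoidalCategory C] [BraidedCategory C]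
    [BalancedCategory C] : BalancedCategory Cᵒᵖ where
  twist X := (twist X.unop).op
  twist_naturality f := Quiver.Hom.unop_inj (twist_naturality f.unop).symm
  twist_unit := Quiver.Hom.unop_inj twist_unit
  twist_tensor X Y := Quiver.Hom.unop_inj <| by
    have := twist_tensor X.unop Y.unop
    simpa using this

/-- A monoidal category is strict if its associators and unitors are identities. -/
class StrictMonoidalCategory (C : Type u) [Category.{v} C] [MonoidalCategory C] : Prop where
  tensor_assoc (X Y Z : C) : (X ⊗ Y) ⊗ Z = X ⊗ (Y ⊗ Z)
  unit_tensor (X : C) : 𝟙_ C ⊗ X = X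
  tensor_unit (X : C) : X ⊗ 𝟙_ C = X
  associator_hom (X Y Z : C) : (α_ X Y Z).hom = eqToHom (tensor_assoc X Y Z)
  leftUnitor_hom (X : C) : (λ_ X).hom = eqToHom (unit_tensor X)
  rightUnitor_hom (X : C) : (ρ_ X).hom = eqToHom (tensor_unit X)

/-- The category `D ⊗ J`, for a crossed simplicial group `J`. Its objects are the sets `{1, …, n}`
for `n ≥ 0`, represented by their numbers of elements. -/
structure DTensor (J : ℕ → Type u) : Type where
  card : ℕ

namespace DTensor

open CrossedFamily

variable {J : ℕ → Type u} [∀ n, Group (J n)] [CrossedFamily J]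

/-- A morphism of `D ⊗ J` from `n` to `m` is a pair `(φ, j)` of an order-preserving map `φ` from `n`
to `m` and an element `j` of `J n`; it stands for `φ ∘ j`. -/
@[ext] structure Hom (X Y : DTensor J) : Type u where
  map : Fin X.card →o Fin Y.card
  elt : J X.card

/-- The tensor product of morphisms is the disjoint union in both components. -/
def tensorMap {X Y X' Y' : DTensor J} (f : Hom X Y) (g : Hom X' Y') :
    Hom (⟨X.card + X'.card⟩ : DTensor J) ⟨Y.card + Y'.card⟩ where
  map := ordTensor f.map g.map
  elt := place 0 (by simp) f.elt * place X.card le_rfl g.elt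

/-- The composition `(ψ, k) ∘ (φ, j) = (ψ ∘ k_⋆ φ, φ^⋆ k * j)`. -/
instance : Category.{u} (DTensor J) where
  Hom := Hom
  id X := ⟨OrderHom.id, 1⟩
  comp f g := ⟨g.map.comp (permAct (perm g.elt) f.map), CrossedFamily.pull f.map g.elt * f.elt⟩
  id_comp {X Y} f := by
    apply Hom.ext
    · have : permAct (perm f.elt) (OrderHom.id : Fin X.card →o _) = OrderHom.id :=
        permAct_eq (perm f.elt) fun _ => rfl
      rw [this]; rfl
    · rw [CrossedFamily.pull_id, mul_one]
  comp_id f := by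
    apply Hom.ext
    · rw [map_one, permAct_one]; rfl
    · rw [pull_one, one_mul]
  assoc f g h := by
    apply Hom.ext
    · rw [map_mul, permAct_mul]
      rw [permAct_comp (CrossedFamily.perm_pull g.map h.elt)]
      rfl
    · rw [CrossedFamily.pull_mul, CrossedFamily.pull_comp, mul_assoc]

theorem hom_ext {X Y : DTensor J} {f g : X ⟶ Y} (h1 : f.map = g.map) (h2 : f.elt = g.elt) :
    f = g := Hom.ext h1 h2

@[simp] theorem id_map (X : DTensor J) : Hom.map (𝟙 X) = OrderHom.id := rfl
@[simp] theorem id_elt (X : DTensor J) : Hom.elt (𝟙 X) = 1 := rfl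
@[simp] theorem comp_map {X Y Z : DTensor J} (f : X ⟶ Y) (g : Y ⟶ Z) :
    Hom.map (f ≫ g) = g.map.comp (permAct (perm g.elt) f.map) := rfl
@[simp] theorem comp_elt {X Y Z : DTensor J} (f : X ⟶ Y) (g : Y ⟶ Z) :
    Hom.elt (f ≫ g) = CrossedFamily.pull f.map g.elt * f.elt := rfl

/-- The morphism `(1, j)` between equal objects. -/
def isoHom {X Y : DTensor J} (h : X.card = Y.card) (j : J X.card) : X ⟶ Y := ⟨ordCast h, j⟩

theorem permAct_ordCast (h : n = m) (π : Perm (Fin m)) : permAct π (ordCast h) = ordCast h := by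
  subst h; exact permAct_eq π fun _ => rfl

theorem pull_ordCast (h : n = m) (j : J m) : CrossedFamily.pull (ordCast h) j =
    place 0 (by omega) j := by
  subst h
  rw [place_self]; exact CrossedFamily.pull_id j

theorem isoHom_comp {X Y Z : DTensor J} (h : X.card = Y.card) (h' : Y.card = Z.card)
    (j : J X.card) (k : J Y.card) :
    isoHom h j ≫ isoHom h' k = isoHom (h.trans h') (place 0 (by omega) k * j) := by
  apply hom_ext
  · rw [comp_map]
    dsimp only [isoHom]
    rw [permAct_ordCast]; rfl
  · rw [comp_elt]
    dsimp only [isoHom]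
    rw [pull_ordCast]

theorem isoHom_comp_hom {X Y Z : DTensor J} (h : X.card = Y.card) (j : J X.card) (f : Y ⟶ Z) :
    isoHom h j ≫ f = ⟨f.map.comp (ordCast h), place 0 (by omega) f.elt * j⟩ := by
  apply hom_ext
  · rw [comp_map]
    dsimp only [isoHom]
    rw [permAct_ordCast]
  · rw [comp_elt]
    dsimp only [isoHom]
    rw [pull_ordCast]

theorem isoHom_id (X : DTensor J) : 𝟙 X = isoHom rfl (1 : J X.card) := rfl

/-- The isomorphism `(1, j)` between equal objects. -/
def iso {X Y : DTensor J} (h : X.card = Y.card) (j : J X.card) : X ≅ Y where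
  hom := isoHom h j
  inv := isoHom h.symm (place 0 (by omega) j⁻¹)
  hom_inv_id := by
    rw [isoHom_comp, isoHom_id, place_place, place_self, inv_mul_cancel]
  inv_hom_id := by
    rw [isoHom_comp, isoHom_id, ← map_mul, mul_inv_cancel, map_one]

@[simp] theorem iso_hom {X Y : DTensor J} (h : X.card = Y.card) (j : J X.card) :
    (iso h j).hom = isoHom h j := rfl

theorem tensorMap_iso {X Y X' Y' : DTensor J} (h : X.card = Y.card) (h' : X'.card = Y'.card)
    (j : J X.card) (j' : J X'.card) : tensorMap (isoHom h j) (isoHom h' j') =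
      isoHom (by simp [h, h']) (place 0 (by simp) j * place X.card le_rfl j') := by
  apply hom_ext
  · ext x
    show (ordTensor (ordCast h) (ordCast h') x : ℕ) = x
    rcases Nat.lt_or_ge x X.card with hx | hx
    · rw [ordTensor_left _ _ _ hx]; rfl
    · rw [ordTensor_right _ _ _ hx]
      simp only [ordCast_val]; omega
  · rfl

theorem tensorMap_comp {X Y Z X' Y' Z' : DTensor J} (f : X ⟶ Y) (g : Y ⟶ Z) (f' : X' ⟶ Y')
    (g' : Y' ⟶ Z') : (tensorMap (f ≫ g) (f' ≫ g') : Hom _ _) =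
      (show (⟨X.card + X'.card⟩ : DTensor J) ⟶ ⟨Y.card + Y'.card⟩ from tensorMap f f') ≫
      (show (⟨Y.card + Y'.card⟩ : DTensor J) ⟶ ⟨Z.card + Z'.card⟩ from tensorMap g g') := by
  apply hom_ext
  · rw [comp_map]
    show ordTensor _ _ = OrderHom.comp (ordTensor g.map g'.map) (permAct (perm
      (place 0 _ g.elt * place Y.card _ g'.elt)) (ordTensor f.map f'.map))
    rw [map_mul, permAct_mul, perm_place_left, perm_place_right, permAct_ordTensor,
      permAct_ordTensor, permAct_one, permAct_one, comp_map, comp_map]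
    ext x
    rcases Nat.lt_or_ge x X.card with hx | hx
    · have e := ordTensor_left (permAct (perm g.elt) f.map) (permAct (perm g'.elt) f'.map) x hx
      rw [ordTensor_left _ _ _ hx]
      simp only [OrderHom.comp_coe, Function.comp]
      rw [ordTensor_left g.map g'.map _ (by omega)]
      simp only [e, Fin.eta]
    · have e := ordTensor_right (permAct (perm g.elt) f.map) (permAct (perm g'.elt) f'.map) x hx
      rw [ordTensor_right _ _ _ hx]
      simp only [OrderHom.comp_coe, Function.comp]
      rw [ordTensor_right g.map g'.map _ (by omega)]
      simp only [e, Nat.add_sub_cancel_left, Fin.eta]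
  · rw [comp_elt]
    show place 0 _ (CrossedFamily.pull f.map g.elt * f.elt) *
        place X.card _ (CrossedFamily.pull f'.map g'.elt * f'.elt) =
      CrossedFamily.pull (ordTensor f.map f'.map) (place 0 _ g.elt * place Y.card _ g'.elt) *
        (place 0 _ f.elt * place X.card _ f'.elt)
    rw [CrossedFamily.pull_mul, perm_place_right, permAct_ordTensor, permAct_one,
      CrossedFamily.pull_place_left, CrossedFamily.pull_place_right, map_mul, map_mul]
    have c := CrossedFamily.place_comm 0 X.card (N := X.card + X'.card) (by omega) le_rfl (by omega)
      f.elt (CrossedFamily.pull f'.map g'.elt)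
    simp only [mul_assoc]
    rw [← mul_assoc (place 0 _ f.elt), c.eq, mul_assoc]

/-- The tensor product of `D ⊗ J` is addition on objects; all coherence isomorphisms are identities. -/
instance : MonoidalCategoryStruct (DTensor J) where
  tensorObj X Y := ⟨X.card + Y.card⟩
  tensorUnit := ⟨0⟩
  tensorHom f g := tensorMap f g
  whiskerLeft X _ _ f := tensorMap (𝟙 X) f
  whiskerRight f Y := tensorMap f (𝟙 Y)
  associator X Y Z := iso (Nat.add_assoc X.card Y.card Z.card) 1
  leftUnitor X := iso (Nat.zero_add X.card) 1
  rightUnitor X := iso (Nat.add_zero X.card) 1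

@[simp] theorem tensor_card (X Y : DTensor J) : (X ⊗ Y).card = X.card + Y.card := rfl
@[simp] theorem unit_card : (𝟙_ (DTensor J)).card = 0 := rfl
theorem tensorHom_map {X Y X' Y' : DTensor J} (f : X ⟶ Y) (g : X' ⟶ Y') :
    Hom.map (f ⊗ₘ g) = ordTensor f.map g.map := rfl
theorem tensorHom_elt {X Y X' Y' : DTensor J} (f : X ⟶ Y) (g : X' ⟶ Y') :
    Hom.elt (f ⊗ₘ g) = place (N := X.card + X'.card) 0 (by simp) f.elt * place X.card le_rfl g.elt :=
  rfl
theorem tensorHom_iso {X Y X' Y' : DTensor J} (h : X.card = Y.card) (h' : X'.card = Y'.card)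
    (j : J X.card) (j' : J X'.card) : isoHom h j ⊗ₘ isoHom h' j' =
      (isoHom (X := X ⊗ X') (Y := Y ⊗ Y') (by simp [h, h'])
        (place 0 (by simp) j * place X.card le_rfl j' : J (X.card + X'.card))) :=
  tensorMap_iso h h' j j'
theorem associator_hom (X Y Z : DTensor J) : (α_ X Y Z).hom =
    isoHom (Nat.add_assoc X.card Y.card Z.card) 1 := rfl
theorem associator_inv (X Y Z : DTensor J) : (α_ X Y Z).inv =
    isoHom (Nat.add_assoc X.card Y.card Z.card).symm 1 := by
  show isoHom _ _ = _
  rw [inv_one, map_one]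
theorem leftUnitor_hom (X : DTensor J) : (λ_ X).hom = isoHom (Nat.zero_add X.card) 1 := rfl
theorem rightUnitor_hom (X : DTensor J) : (ρ_ X).hom = isoHom (Nat.add_zero X.card) 1 := rfl
theorem whiskerLeft_eq (X : DTensor J) {Y Z : DTensor J} (f : Y ⟶ Z) : X ◁ f = 𝟙 X ⊗ₘ f := rfl
theorem whiskerRight_eq {X Y : DTensor J} (f : X ⟶ Y) (Z : DTensor J) : f ▷ Z = f ⊗ₘ 𝟙 Z := rfl

theorem comp_isoHom_one {X Y Z : DTensor J} (f : X ⟶ Y) (h : Y.card = Z.card) :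
    f ≫ isoHom h 1 = ⟨(ordCast h).comp f.map, f.elt⟩ := by
  apply hom_ext
  · rw [comp_map]
    dsimp only [isoHom]
    rw [map_one, permAct_one]
  · rw [comp_elt]
    dsimp only [isoHom]
    rw [pull_one, one_mul]

theorem ordTensor_assoc {a b c a' b' c' : ℕ} (f : Fin a →o Fin a') (g : Fin b →o Fin b')
    (h : Fin c →o Fin c') (x : Fin (a + b + c)) : (ordTensor (ordTensor f g) h x : ℕ) =
      ordTensor f (ordTensor g h) (ordCast (Nat.add_assoc a b c) x) := by
  rcases Nat.lt_or_ge x (a + b) with hx | hx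
  · rw [ordTensor_left _ _ _ hx]
    rcases Nat.lt_or_ge x a with hx' | hx'
    · rw [ordTensor_left _ _ _ hx', ordTensor_left _ _ _ hx']; rfl
    · rw [ordTensor_right _ _ _ hx', ordTensor_right _ _ _ (by simpa using hx'),
        ordTensor_left _ _ _ (by simp only [ordCast_val]; omega)]; rfl
  · rw [ordTensor_right _ _ _ hx, ordTensor_right _ _ _ (by simp only [ordCast_val]; omega),
      ordTensor_right _ _ _ (by simp only [ordCast_val]; omega)]
    simp only [ordCast_val, Nat.sub_sub, add_assoc]

theorem ordTensor_zero_left {a a' : ℕ} (f : Fin a →o Fin a') (x : Fin (0 + a)) :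
    (ordTensor (OrderHom.id : Fin 0 →o Fin 0) f x : ℕ) = f (ordCast (Nat.zero_add a) x) := by
  rw [ordTensor_right _ _ _ (by omega), zero_add]; rfl

theorem ordTensor_zero_right {a a' : ℕ} (f : Fin a →o Fin a') (x : Fin (a + 0)) :
    (ordTensor f (OrderHom.id : Fin 0 →o Fin 0) x : ℕ) = f (ordCast (Nat.add_zero a) x) := by
  rw [ordTensor_left _ _ _ (by omega)]; rfl

theorem isoHom_eqToHom {X Y : DTensor J} (h : X = Y) (h' : X.card = Y.card) :
    isoHom h' 1 = eqToHom h := by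
  subst h; rfl

theorem ordTensor_braid (φ : Fin n →o Fin m) (ψ : Fin n' →o Fin m') (π : Perm (Fin (m + m')))
    (hπ : ∀ x, (π x : ℕ) = if (x : ℕ) < m then (x : ℕ) + m' else x - m)
    (ρ : Perm (Fin (n + n')))
    (hρ : ∀ x, (ρ x : ℕ) = if (x : ℕ) < n then (x : ℕ) + n' else x - n) :
    (ordCast (Nat.add_comm m m')).comp (permAct π (ordTensor φ ψ)) =
      (ordTensor ψ φ).comp (ordCast (Nat.add_comm n n')) := by
  have : permAct π (ordTensor φ ψ) = (ordCast (Nat.add_comm m' m)).comp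
      ((ordTensor ψ φ).comp (ordCast (Nat.add_comm n n'))) := by
    refine permAct_eq ρ fun x => ?_
    ext
    simp only [OrderHom.comp_coe, Function.comp, ordCast_val]
    have e := hρ x
    rw [hπ]
    rcases Nat.lt_or_ge x n with hx | hx
    · have b := (φ ⟨x, hx⟩).isLt
      rw [if_pos hx] at e
      rw [ordTensor_left _ _ _ hx, if_pos b, ordTensor_right _ _ _ (by simp only [ordCast_val]; omega)]
      simp only [ordCast_val, e, Nat.add_sub_cancel]
      omega
    · rw [if_neg (by omega)] at e
      rw [ordTensor_right _ _ _ hx, if_neg (by omega),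
        ordTensor_left _ _ _ (by simp only [ordCast_val]; omega)]
      simp only [ordCast_val, e, Nat.add_sub_cancel_left]
  rw [this]; rfl

theorem braid_naturality {X Y X' Y' : DTensor J} (f : X ⟶ Y) (g : X' ⟶ Y') :
    (f ⊗ₘ g) ≫ isoHom (X := Y ⊗ Y') (Y := Y' ⊗ Y) (Nat.add_comm Y.card Y'.card)
      (braid Y.card Y'.card) =
    isoHom (X := X ⊗ X') (Y := X' ⊗ X) (Nat.add_comm X.card X'.card) (braid X.card X'.card) ≫
      (g ⊗ₘ f) := by
  rw [isoHom_comp_hom]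
  apply hom_ext
  · exact ordTensor_braid f.map g.map _ (perm_braid Y.card Y'.card) _ (perm_braid (J := J) X.card X'.card)
  · show CrossedFamily.pull (ordTensor f.map g.map) (braid Y.card Y'.card) *
      (place 0 _ f.elt * place X.card _ g.elt) =
      place 0 _ (place 0 _ g.elt * place X'.card _ f.elt) * braid X.card X'.card
    rw [pull_braid, map_mul, place_place, place_place, ← mul_assoc,
      braid_place_left, mul_assoc, braid_place_right, ← mul_assoc]
    simp only [zero_add]
    congr 1
    exact ((CrossedFamily.place_comm 0 X'.card (by omega) (by omega) (by omega)
      g.elt f.elt).eq).symm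

instance : MonoidalCategory (DTensor J) := .ofTensorHom
  (id_tensorHom_id := fun X Y => by
    rw [isoHom_id, isoHom_id, isoHom_id, tensorHom_iso, map_one, map_one, one_mul])
  (id_tensorHom := fun _ _ _ _ => rfl)
  (tensorHom_id := fun _ _ => rfl)
  (tensorHom_comp_tensorHom := fun f f' g g' => (tensorMap_comp f g f' g').symm)
  (associator_naturality := fun {X₁ X₂ X₃ Y₁ Y₂ Y₃} f g h => by
    rw [associator_hom, associator_hom, comp_isoHom_one, isoHom_comp_hom]
    apply hom_ext
    · ext x
      exact ordTensor_assoc f.map g.map h.map x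
    · simp only [tensorHom_elt, mul_one, map_mul, place_place, zero_add, add_zero, mul_assoc,
        tensor_card])
  (leftUnitor_naturality := fun {X Y} f => by
    rw [leftUnitor_hom, leftUnitor_hom, comp_isoHom_one, isoHom_comp_hom]
    apply hom_ext
    · ext x
      exact ordTensor_zero_left f.map x
    · simp only [tensorHom_elt, mul_one, id_elt, map_one, one_mul, unit_card])
  (rightUnitor_naturality := fun {X Y} f => by
    rw [rightUnitor_hom, rightUnitor_hom, comp_isoHom_one, isoHom_comp_hom]
    apply hom_ext
    · ext x
      exact ordTensor_zero_right f.map x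
    · simp only [tensorHom_elt, mul_one, id_elt, map_one])
  (pentagon := fun W X Y Z => by
    simp only [associator_hom, isoHom_id, tensorHom_iso, isoHom_comp, map_one, one_mul])
  (triangle := fun X Y => by
    simp only [associator_hom, leftUnitor_hom, rightUnitor_hom, isoHom_id, tensorHom_iso,
      isoHom_comp, map_one, one_mul])

instance : StrictMonoidalCategory (DTensor J) where
  tensor_assoc X Y Z := congrArg DTensor.mk (Nat.add_assoc X.card Y.card Z.card)
  unit_tensor X := congrArg DTensor.mk (Nat.zero_add X.card)
  tensor_unit X := congrArg DTensor.mk (Nat.add_zero X.card)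
  associator_hom _ _ _ := isoHom_eqToHom _ _
  leftUnitor_hom _ := isoHom_eqToHom _ _
  rightUnitor_hom _ := isoHom_eqToHom _ _

/-- The braiding of `D ⊗ J` is given by the block crossings. -/
instance : BraidedCategory (DTensor J) where
  braiding X Y := iso (Nat.add_comm X.card Y.card) (braid X.card Y.card)
  braiding_naturality_right X {Y Z} f := braid_naturality (𝟙 X) f
  braiding_naturality_left {X Y} f Z := braid_naturality f (𝟙 Z)
  hexagon_forward X Y Z := by
    simp only [iso_hom, associator_hom, whiskerLeft_eq, whiskerRight_eq, isoHom_id, tensorHom_iso,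
      isoHom_comp, map_one, one_mul, mul_one, tensor_card, braid_add_right, map_mul, place_place,
      zero_add, add_zero]
  hexagon_reverse X Y Z := by
    simp only [iso_hom, associator_inv, whiskerLeft_eq, whiskerRight_eq, isoHom_id, tensorHom_iso,
      isoHom_comp, map_one, one_mul, mul_one, tensor_card, braid_add_left, map_mul, place_place,
      zero_add, add_zero]

/-- The full twist of `D ⊗ J` is given by the full twists of `J`. -/
instance : BalancedCategory (DTensor J) where
  twist X := iso rfl (twist X.card)
  twist_naturality {X Y} f := by
    rw [iso_hom, iso_hom, isoHom_comp_hom]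
    apply hom_ext
    · rw [comp_map]
      dsimp only [isoHom]
      rw [perm_twist, permAct_one]; rfl
    · rw [comp_elt]
      dsimp only [isoHom]
      rw [pull_twist, (twist_comm f.elt).eq]
      congr 1
      exact (place_self _ _).symm
  twist_unit := by
    rw [iso_hom, isoHom_id]
    exact congrArg _ twist_zero
  twist_tensor X Y := by
    show isoHom _ _ = isoHom _ _ ≫ (isoHom _ _ ⊗ₘ isoHom _ _) ≫ isoHom _ _
    rw [tensorHom_iso, isoHom_comp, isoHom_comp]
    refine congrArg (isoHom _) ?_
    show twist (X.card + Y.card) = _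
    rw [twist_add, mul_assoc, ← mul_assoc (braid X.card Y.card), braid_place_left, mul_assoc,
      braid_place_right]
    simp only [map_mul, place_place, zero_add, add_zero, ← mul_assoc]
    congr 1
    rw [mul_assoc, mul_assoc]
    congr 1
    exact ((CrossedFamily.place_comm 0 Y.card (by omega) (by omega) (by omega)
      (twist Y.card) (twist X.card)).eq).symm

end DTensor

/-- An algebra in `B` of a balanced PROB `Q`: a balanced braided (strong) monoidal functor from `Q`
to `B`. -/
structure BalancedAlgebra (Q : Type*) [Category* Q] [MonoidalCategory Q] [BraidedCategory Q]
    [BalancedCategory Q] (B : Type*) [Category* B] [MonoidalCategory B] [BraidedCategory B]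
    [BalancedCategory B] where
  functor : Q ⥤ B
  [braided : functor.Braided]
  map_twist (X : Q) : functor.map (BalancedCategory.twist X).hom =
    (BalancedCategory.twist (functor.obj X)).hom

namespace BalancedAlgebra

attribute [instance] BalancedAlgebra.braided

variable {Q : Type*} [Category* Q] [MonoidalCategory Q] [BraidedCategory Q]
    [BalancedCategory Q] {B : Type*} [Category* B] [MonoidalCategory B] [BraidedCategory B]
    [BalancedCategory B]

/-- A morphism of algebras is a monoidal natural transformation. -/
@[ext] structure Hom (F F' : BalancedAlgebra Q B) where
  natTrans : F.functor ⟶ F'.functor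
  [isMonoidal : NatTrans.IsMonoidal natTrans]

attribute [instance] Hom.isMonoidal

instance : Category (BalancedAlgebra Q B) where
  Hom := Hom
  id F := ⟨𝟙 F.functor⟩
  comp f g := ⟨f.natTrans ≫ g.natTrans⟩

open Functor.LaxMonoidal in
/-- An algebra is strict if it preserves unit and tensor products on the nose: its structure
isomorphisms are identities. -/
structure IsStrict (F : BalancedAlgebra Q B) : Prop where
  obj_unit : 𝟙_ B = F.functor.obj (𝟙_ Q)
  obj_tensor (X Y : Q) : F.functor.obj X ⊗ F.functor.obj Y = F.functor.obj (X ⊗ Y)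
  ε_eq : ε F.functor = eqToHom obj_unit
  μ_eq (X Y : Q) : μ F.functor X Y = eqToHom (obj_tensor X Y)

end BalancedAlgebra

/-- The category of strict algebras: balanced braided strict monoidal functors and monoidal natural
transformations. -/
abbrev StrictBalancedAlgebra (Q : Type*) [Category* Q] [MonoidalCategory Q] [BraidedCategory Q]
    [BalancedCategory Q] (B : Type*) [Category* B] [MonoidalCategory B] [BraidedCategory B]
    [BalancedCategory B] := ObjectProperty.FullSubcategory fun F : BalancedAlgebra Q B => F.IsStrict

/-- The PROB `D ⊗ RB`. -/
abbrev DRB : Type := DTensor RB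
/-- The PROB `D ⊗ RB ⊗ G`. -/
abbrev DRBG (G : Type w) [Group G] : Type := DTensor (Wreath G RB)
/-- `G`-monoids: functors from the one-object category `G` to monoids. -/
abbrev GMon (G : Type w) [Group G] (B : Type u) [Category.{v} B] [MonoidalCategory B] :=
  SingleObj G ⥤ Mon B
/-- `G`-comonoids: functors from the one-object category `G` to comonoids. -/
abbrev GComon (G : Type w) [Group G] (B : Type u) [Category.{v} B] [MonoidalCategory B] :=
  SingleObj G ⥤ Comon B

end RibbonPROB

open CategoryTheory RibbonPROB

/-! The equivalence is evaluation at the object 1. In `D ⊗ J` this object carries a monoid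
structure, given by the order-preserving maps from 2 and from 0 to 1, and a monoidal functor sends
it to a monoid in `B`. With labels in `G`, the elements `label J g` act on it by monoid
automorphisms, because cabling copies the label of a ribbon to all its parallels. The point is that
`D ⊗ RB` contains nothing beyond this monoid and the structure that every balanced category has:
each morphism is a group element followed by an order-preserving map, the order-preserving maps are
generated under composition and tensor product by unit and multiplication, and the groups `RB n` are
generated under block sums by one crossing and one twist (`RB.isGeneratedBy_empty`). In the labelled
case the labels are the only further generators (`Wreath.isGeneratedBy_range_label`).

Full faithfulness: a monoidal transformation is determined by its component `f` at 1
(`app_eq_extComp`). Conversely, the components `extComp f` built from `f` are natural for the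
braiding and the twist automatically, for unit and multiplication if `f` is a monoid morphism, and
for labels if `f` is equivariant. Naturality passes to composites, inverses and tensor products,
hence holds for all morphisms (`exists_hom_of_isGeneratedBy`).

Essential surjectivity: for a monoid `M`, send `n` to the `n`-th tensor power and `(φ, j)` to the
action of `j` followed by `mulMap φ`, which multiplies along the fibres of `φ`. The group `RB n`
acts because the braiding satisfies Yang-Baxter and is natural against the twist (`rbRep`).
Functoriality amounts to an exchange law between multiplication and group elements, with `φ^⋆ j` on
one side and `j_⋆ φ` on the other. It is checked on generators
(`BlockRep.exchange_of_isGeneratedBy`), where it is naturality of the braiding and of the twist,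
once block crossings and block twists are known to act as the braiding and the twist of tensor
powers (`rbRep_braid`, `rbRep_twist`). Labels act factorwise and combine with `RB n` to an action of
the semidirect product (`BlockRep.rep_mul_labelAut`).

If `B` is strict, the coherence isomorphisms between tensor powers are identities, so the algebra of
tensor powers is strict. The full subcategory of strict algebras is therefore already large enough
for essential surjectivity. The statements for opposites follow by applying the results to `Bᵒᵖ`:
algebras of `Qᵒᵖ` in `B` are opposite to algebras of `Q` in `Bᵒᵖ`, comonoids are opposite to monoids
in `Bᵒᵖ`, and inversion identifies `G` with its opposite. -/

namespace RibbonPROB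

open MonoidalCategory

/-! ### Tensor powers and their coherence isomorphisms -/

namespace TensorPower

variable {B : Type u} [Category.{v} B] [MonoidalCategory B] (M : B)

/-- The tensor power `(⋯((I ⊗ M) ⊗ M) ⋯) ⊗ M`. -/
@[reducible] def pow : ℕ → B
  | 0 => 𝟙_ B
  | n + 1 => pow n ⊗ M

/-- The identity between equal tensor powers. -/
def pcast {n m : ℕ} (h : n = m) : pow M n ⟶ pow M m := eqToHom (congrArg (pow M) h)

@[simp] theorem pcast_rfl {n : ℕ} (h : n = n) : pcast M h = 𝟙 (pow M n) := rfl

@[simp] theorem pcast_comp {n m l : ℕ} (h : n = m) (h' : m = l) :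
    pcast M h ≫ pcast M h' = pcast M (h.trans h') := by
  subst h h'; simp

@[simp] theorem pcast_comp_assoc {n m l : ℕ} (h : n = m) (h' : m = l) {Z : B}
    (f : pow M l ⟶ Z) : pcast M h ≫ pcast M h' ≫ f = pcast M (h.trans h') ≫ f := by
  subst h h'; simp

instance {n m : ℕ} (h : n = m) : IsIso (pcast M h) := by subst h; rw [pcast_rfl]; infer_instance

theorem pcast_succ {n m : ℕ} (h : n = m) (h' : n + 1 = m + 1) : pcast M h' = pcast M h ▷ M := by
  subst h; exact (id_whiskerRight _ _).symm

/-- The coherence isomorphism between tensor powers. -/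
def mu (n : ℕ) : ∀ m, pow M n ⊗ pow M m ≅ pow M (n + m)
  | 0 => ρ_ (pow M n)
  | m + 1 => (α_ (pow M n) (pow M m) M).symm ≪≫ whiskerRightIso (mu n m) M

theorem mu_zero (n : ℕ) : (mu M n 0).hom = (ρ_ (pow M n)).hom := rfl
theorem mu_succ (n m : ℕ) : (mu M n (m + 1)).hom =
    (α_ (pow M n) (pow M m) M).inv ≫ (mu M n m).hom ▷ M := rfl

/-- Left unitality is not built into `mu`, which recurses on the right factor. The base case is the
equality of the two unitors of the unit object, the step is compatibility of the left unitor with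
tensor products. -/
theorem mu_zero_left (m : ℕ) : (mu M 0 m).hom = (λ_ (pow M m)).hom ≫ pcast M (Nat.zero_add m).symm := by
  induction m with
  | zero =>
    rw [mu_zero]
    exact (unitors_equal.symm).trans (Category.comp_id _).symm
  | succ m ih =>
    rw [mu_succ, ih]
    have : pcast M (Nat.zero_add (m + 1)).symm = pcast M (Nat.zero_add m).symm ▷ M :=
      pcast_succ M _ _
    rw [this, comp_whiskerRight, ← Category.assoc]
    congr 1
    exact (leftUnitor_tensor_hom (pow M m) M).symm

/-- Induction on the last exponent: the base case is naturality of the right unitor, the step is the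
pentagon. This becomes the associativity axiom of the functor of tensor powers. -/
theorem mu_assoc (n m k : ℕ) :
    (mu M n m).hom ▷ pow M k ≫ (mu M (n + m) k).hom ≫ pcast M (Nat.add_assoc n m k) =
      (α_ (pow M n) (pow M m) (pow M k)).hom ≫ pow M n ◁ (mu M m k).hom ≫
        (mu M n (m + k)).hom := by
  induction k with
  | zero =>
    rw [pcast_rfl]
    rw [Category.comp_id]
    rw [mu_zero, mu_zero]
    erw [rightUnitor_naturality]
    simp
  | succ k ih =>
    have e : pcast M (Nat.add_assoc n m (k + 1)) = pcast M (Nat.add_assoc n m k) ▷ M :=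
      pcast_succ M _ _
    have e2 : (mu M n (m + (k + 1))).hom = (α_ (pow M n) (pow M (m + k)) M).inv ≫
      (mu M n (m + k)).hom ▷ M := rfl
    have ih' := congrArg (fun f => (α_ (pow M n ⊗ pow M m) (pow M k) M).inv ≫ f ▷ M) ih
    simp only [comp_whiskerRight] at ih'
    rw [e, e2, mu_succ, mu_succ]
    change (mu M n m).hom ▷ (pow M k ⊗ M) ≫ _ = (α_ (pow M n) (pow M m) (pow M k ⊗ M)).hom ≫ _
    rw [whiskerRight_tensor]
    simp only [Category.assoc, Iso.hom_inv_id_assoc]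
    rw [ih']
    simp [pow]

theorem mu_assoc_inv (n m k : ℕ) :
    pow M n ◁ (mu M m k).hom ≫ (mu M n (m + k)).hom ≫ pcast M (Nat.add_assoc n m k).symm =
      (α_ (pow M n) (pow M m) (pow M k)).inv ≫ (mu M n m).hom ▷ pow M k ≫
        (mu M (n + m) k).hom := by
  rw [← cancel_mono (pcast M (Nat.add_assoc n m k))]
  simp only [Category.assoc, mu_assoc, pcast_comp, pcast_rfl, Iso.inv_hom_id_assoc]
  rw [Category.comp_id]

variable {M}

/-- The tensor product of morphisms between tensor powers. -/
def tens {n m n' m' : ℕ} (f : pow M n ⟶ pow M m) (g : pow M n' ⟶ pow M m') :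
    pow M (n + n') ⟶ pow M (m + m') :=
  (mu M n n').inv ≫ (f ⊗ₘ g) ≫ (mu M m m').hom

theorem mu_tens {n m n' m' : ℕ} (f : pow M n ⟶ pow M m) (g : pow M n' ⟶ pow M m') :
    (mu M n n').hom ≫ tens f g = (f ⊗ₘ g) ≫ (mu M m m').hom := by
  simp [tens]

theorem mu_tens_assoc {n m n' m' : ℕ} (f : pow M n ⟶ pow M m) (g : pow M n' ⟶ pow M m') {Z : B}
    (h : pow M (m + m') ⟶ Z) :
    (mu M n n').hom ≫ tens f g ≫ h = (f ⊗ₘ g) ≫ (mu M m m').hom ≫ h := by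
  rw [← Category.assoc, mu_tens, Category.assoc]

@[simp] theorem tens_id (n m : ℕ) : tens (𝟙 (pow M n)) (𝟙 (pow M m)) = 𝟙 (pow M (n + m)) := by
  simp [tens]

theorem tens_comp {n m l n' m' l' : ℕ} (f : pow M n ⟶ pow M m) (g : pow M m ⟶ pow M l)
    (f' : pow M n' ⟶ pow M m') (g' : pow M m' ⟶ pow M l') :
    tens f f' ≫ tens g g' = tens (f ≫ g) (f' ≫ g') := by
  simp [tens, tensorHom_comp_tensorHom_assoc]

theorem tens_comp_assoc {n m l n' m' l' : ℕ} (f : pow M n ⟶ pow M m) (g : pow M m ⟶ pow M l)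
    (f' : pow M n' ⟶ pow M m') (g' : pow M m' ⟶ pow M l') {Z : B} (h : pow M (l + l') ⟶ Z) :
    tens f f' ≫ tens g g' ≫ h = tens (f ≫ g) (f' ≫ g') ≫ h := by
  rw [← Category.assoc, tens_comp]

/-- After precomposition with the invertible coherence maps, both sides become the triple tensor
product of `f`, `g`, `h` followed by the two sides of `mu_assoc`. -/
theorem tens_assoc {a b c a' b' c' : ℕ} (f : pow M a ⟶ pow M a') (g : pow M b ⟶ pow M b')
    (h : pow M c ⟶ pow M c') : tens (tens f g) h ≫ pcast M (Nat.add_assoc a' b' c') =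
      pcast M (Nat.add_assoc a b c) ≫ tens f (tens g h) := by
  rw [← cancel_epi (mu M (a + b) c).hom, ← cancel_epi ((mu M a b).hom ▷ pow M c), mu_tens_assoc]
  have e1 := mu_assoc M a b c
  have e2 := mu_assoc M a' b' c'
  rw [reassoc_of% e1, mu_tens]
  simp only [MonoidalCategory.tensorHom_def, Category.assoc]
  have e3 : (mu M a b).hom ▷ pow M c ≫ tens f g ▷ pow M c =
      (f ⊗ₘ g) ▷ pow M c ≫ (mu M a' b').hom ▷ pow M c := by
    rw [← comp_whiskerRight, mu_tens, comp_whiskerRight]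
  rw [reassoc_of% e3]
  have e4 : pow M a ◁ (mu M b c).hom ≫ f ▷ pow M (b + c) ≫ pow M a' ◁ tens g h =
      f ▷ _ ≫ pow M a' ◁ (g ⊗ₘ h) ≫ pow M a' ◁ (mu M b' c').hom := by
    rw [whisker_exchange_assoc, ← whiskerLeft_comp, mu_tens, whiskerLeft_comp]
  rw [reassoc_of% e4, ← whisker_exchange_assoc, e2]
  simp [MonoidalCategory.tensorHom_def]

@[simp] theorem tens_zero_right {n m : ℕ} (f : pow M n ⟶ pow M m) :
    tens f (𝟙 (pow M 0)) = f := by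
  rw [← cancel_epi (mu M n 0).hom, mu_tens, mu_zero, mu_zero, tensorHom_id]
  exact rightUnitor_naturality f

theorem tens_zero_left {n m : ℕ} (f : pow M n ⟶ pow M m) :
    tens (𝟙 (pow M 0)) f = pcast M (Nat.zero_add n) ≫ f ≫ pcast M (Nat.zero_add m).symm := by
  rw [← cancel_epi (mu M 0 n).hom, mu_tens, mu_zero_left, mu_zero_left, id_tensorHom]
  simp only [Category.assoc, pcast_comp_assoc, pcast_rfl, Category.id_comp]
  rw [leftUnitor_naturality_assoc]

theorem tens_pcast {n m n' m' : ℕ} (h : n = m) (h' : n' = m') :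
    tens (pcast M h) (pcast M h') = pcast M (congrArg₂ (· + ·) h h') := by
  subst h h'; simp

end TensorPower
end RibbonPROB

namespace RibbonPROB

open MonoidalCategory

namespace TensorPower

/-! ### Automorphisms of tensor powers and their block placements -/

section Aut

variable {B : Type u} [Category.{v} B] [MonoidalCategory B] {M : B} {n m k n' m' N l : ℕ}

/-- The tensor product of automorphisms of tensor powers. -/
def tensAut (f : Aut (pow M n)) (g : Aut (pow M m)) : Aut (pow M (n + m)) where
  hom := tens f.hom g.hom
  inv := tens f.inv g.inv
  hom_inv_id := by rw [tens_comp, f.hom_inv_id, g.hom_inv_id, tens_id]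
  inv_hom_id := by rw [tens_comp, f.inv_hom_id, g.inv_hom_id, tens_id]

@[simp] theorem tensAut_hom (f : Aut (pow M n)) (g : Aut (pow M m)) :
    (tensAut f g).hom = tens f.hom g.hom := rfl

/-- In a product of automorphisms the right factor acts first. This agrees with the convention for
products in `RB`, so that representations are homomorphisms and not antihomomorphisms. -/
theorem mul_hom (f g : Aut (pow M n)) : (f * g).hom = g.hom ≫ f.hom := rfl
theorem one_hom : (1 : Aut (pow M n)).hom = 𝟙 _ := rfl

theorem tensAut_mul (f f' : Aut (pow M n)) (g g' : Aut (pow M m)) :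
    tensAut (f * f') (g * g') = tensAut f g * tensAut f' g' :=
  Iso.ext (by simp only [mul_hom, tensAut_hom, tens_comp])

@[simp] theorem tensAut_one : tensAut (1 : Aut (pow M n)) (1 : Aut (pow M m)) = 1 :=
  Iso.ext (tens_id n m)

/-- Automorphisms of equal tensor powers. -/
def castAut (h : n = m) : Aut (pow M n) →* Aut (pow M m) :=
  (eqToIso (congrArg (pow M) h)).conjAut.toMonoidHom

theorem castAut_hom (h : n = m) (f : Aut (pow M n)) :
    (castAut h f).hom = pcast M h.symm ≫ f.hom ≫ pcast M h := rfl

@[simp] theorem castAut_rfl (h : n = n) (f : Aut (pow M n)) : castAut h f = f :=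
  Iso.ext (by simp [castAut_hom])

@[simp] theorem castAut_castAut (h : n = m) (h' : m = l) (f : Aut (pow M n)) :
    castAut h' (castAut h f) = castAut (h.trans h') f := by
  subst h h'; simp

theorem tensAut_castAut_left (h : n = n') (f : Aut (pow M n)) (g : Aut (pow M m)) :
    tensAut (castAut h f) g = castAut (congrArg (· + m) h) (tensAut f g) := by
  subst h; simp

theorem tensAut_castAut_right (h : m = m') (f : Aut (pow M n)) (g : Aut (pow M m)) :
    tensAut f (castAut h g) = castAut (congrArg (n + ·) h) (tensAut f g) := by
  subst h; simp

theorem tensAut_assoc (f : Aut (pow M n)) (g : Aut (pow M m)) (h : Aut (pow M k)) :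
    tensAut f (tensAut g h) = castAut (Nat.add_assoc n m k) (tensAut (tensAut f g) h) :=
  Iso.ext <| by
    rw [castAut_hom, tensAut_hom, tensAut_hom, tensAut_hom, tensAut_hom, tens_assoc,
      pcast_comp_assoc, pcast_rfl, Category.id_comp]

@[simp] theorem tensAut_zero_right (f : Aut (pow M n)) : tensAut f (1 : Aut (pow M 0)) = f :=
  Iso.ext (tens_zero_right f.hom)

theorem tensAut_zero_left (f : Aut (pow M n)) :
    tensAut (1 : Aut (pow M 0)) f = castAut (Nat.zero_add n).symm f :=
  Iso.ext (tens_zero_left f.hom)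

/-- An automorphism of a block of factors. -/
def placeAut (a : ℕ) (h : a + n ≤ N) : Aut (pow M n) →* Aut (pow M N) where
  toFun f := castAut (Nat.add_sub_cancel' h)
    (tensAut (tensAut (1 : Aut (pow M a)) f) (1 : Aut (pow M (N - (a + n)))))
  map_one' := by simp
  map_mul' f g := by
    rw [← map_mul, ← tensAut_mul, ← tensAut_mul, one_mul, one_mul]

/-- Naming the length `b` of the remaining block avoids truncated subtraction in later rewriting. -/
theorem placeAut_eq (a b : ℕ) (h : a + n ≤ N) (h' : a + n + b = N) (f : Aut (pow M n)) :
    placeAut a h f = castAut h' (tensAut (tensAut (1 : Aut (pow M a)) f) (1 : Aut (pow M b))) := by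
  obtain rfl : b = N - (a + n) := by omega
  rfl

theorem placeAut_first (b : ℕ) (h : 0 + n ≤ N) (h' : n + b = N) (f : Aut (pow M n)) :
    placeAut 0 h f = castAut h' (tensAut f (1 : Aut (pow M b))) := by
  rw [placeAut_eq 0 b h (by omega), tensAut_zero_left, tensAut_castAut_left, castAut_castAut]

theorem placeAut_last (a : ℕ) (h : a + n ≤ N) (h' : a + n = N) (f : Aut (pow M n)) :
    placeAut a h f = castAut h' (tensAut (1 : Aut (pow M a)) f) := by
  rw [placeAut_eq a 0 h h', tensAut_zero_right]

theorem placeAut_self (h : 0 + n ≤ n) (f : Aut (pow M n)) : placeAut 0 h f = f := by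
  rw [placeAut_first 0 h rfl, tensAut_zero_right, castAut_rfl]

/-- The identities on the outer blocks split as tensor products of identities; the rest is
rebracketing. -/
theorem placeAut_placeAut (a b : ℕ) (h : a + n ≤ m) (h' : b + m ≤ l) (f : Aut (pow M n)) :
    placeAut b h' (placeAut a h f) = placeAut (b + a) (by omega) f := by
  obtain ⟨c, rfl⟩ := Nat.exists_eq_add_of_le h
  obtain ⟨d, rfl⟩ := Nat.exists_eq_add_of_le h'
  rw [placeAut_eq a c h rfl, placeAut_eq b d h' rfl, placeAut_eq (b + a) (c + d) _ (by omega)]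
  have e1 : (1 : Aut (pow M (c + d))) = tensAut 1 1 := tensAut_one.symm
  have e2 : (1 : Aut (pow M (b + a))) = tensAut 1 1 := tensAut_one.symm
  simp only [e1, e2, tensAut_assoc, tensAut_castAut_left, tensAut_castAut_right, castAut_castAut]

/-- Disjoint blocks commute by bifunctoriality of the tensor product. -/
theorem placeAut_comm (a b : ℕ) (ha : a + n ≤ N) (hb : b + m ≤ N) (hab : a + n ≤ b)
    (f : Aut (pow M n)) (g : Aut (pow M m)) : Commute (placeAut a ha f) (placeAut b hb g) := by
  obtain ⟨c, rfl⟩ := Nat.exists_eq_add_of_le hab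
  -- Cutting directly before the second block turns the two automorphisms into `f' ⊗ 1` and `1 ⊗ g`,
  -- placed on the common initial segment.
  have e1 : placeAut a ha f = placeAut 0 (n := a + n + c + m) (by omega)
      (tensAut (placeAut (N := a + n + c) a (by omega) f) 1) := by
    have : tensAut (placeAut (N := a + n + c) a (by omega) f) (1 : Aut (pow M m)) =
        placeAut 0 (by omega) (placeAut (N := a + n + c) a (by omega) f) := by
      rw [placeAut_first m _ rfl, castAut_rfl]
    rw [this, placeAut_placeAut, placeAut_placeAut]
    simp only [Nat.zero_add]
  have e2 : placeAut (a + n + c) hb g = placeAut 0 (n := a + n + c + m) (by omega)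
      (tensAut (1 : Aut (pow M (a + n + c))) g) := by
    have : tensAut (1 : Aut (pow M (a + n + c))) g =
        placeAut (a + n + c) (by omega) g := by
      rw [placeAut_last _ _ rfl, castAut_rfl]
    rw [this, placeAut_placeAut]
    simp only [Nat.zero_add]
  rw [e1, e2]
  refine Commute.map ?_ _
  rw [commute_iff_eq, ← tensAut_mul, ← tensAut_mul, one_mul, one_mul, mul_one, mul_one]

end Aut

/-! ### Braidings of tensor powers -/

section Braided

variable {B : Type u} [Category.{v} B] [MonoidalCategory B] [BraidedCategory B] (M : B)
  {n m k n' m' N l : ℕ}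

/-- The braiding of tensor powers. -/
def br (n m : ℕ) : pow M (n + m) ≅ pow M (m + n) :=
  (mu M n m).symm ≪≫ β_ (pow M n) (pow M m) ≪≫ mu M m n

theorem mu_br (n m : ℕ) : (mu M n m).hom ≫ (br M n m).hom =
    (β_ (pow M n) (pow M m)).hom ≫ (mu M m n).hom := by simp [br]

theorem mu_br_assoc (n m : ℕ) {Z : B} (h : pow M (m + n) ⟶ Z) :
    (mu M n m).hom ≫ (br M n m).hom ≫ h = (β_ (pow M n) (pow M m)).hom ≫ (mu M m n).hom ≫ h := by
  rw [← Category.assoc, mu_br, Category.assoc]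

variable {M} in
theorem tens_br (f : pow M n ⟶ pow M m) (g : pow M n' ⟶ pow M m') :
    tens f g ≫ (br M m m').hom = (br M n n').hom ≫ tens g f := by
  rw [← cancel_epi (mu M n n').hom, mu_tens_assoc, mu_br, mu_br_assoc, mu_tens]
  simp [← BraidedCategory.braiding_naturality_assoc]

variable {M} in
theorem tens_br_assoc (f : pow M n ⟶ pow M m) (g : pow M n' ⟶ pow M m') {Z : B}
    (h : pow M (m' + m) ⟶ Z) :
    tens f g ≫ (br M m m').hom ≫ h = (br M n n').hom ≫ tens g f ≫ h := by
  rw [← Category.assoc, tens_br, Category.assoc]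

/-- One hexagon axiom, with its associators absorbed into `mu` by means of `mu_assoc`. -/
theorem br_add_right (n m k : ℕ) : (br M n (m + k)).hom = pcast M (Nat.add_assoc n m k).symm ≫
    tens (br M n m).hom (𝟙 (pow M k)) ≫ pcast M (Nat.add_assoc m n k) ≫
    tens (𝟙 (pow M m)) (br M n k).hom ≫ pcast M (Nat.add_assoc m k n).symm := by
  rw [← cancel_epi (mu M n (m + k)).hom, ← cancel_epi (pow M n ◁ (mu M m k).hom), mu_br,
    BraidedCategory.braiding_naturality_right_assoc, BraidedCategory.braiding_tensor_right_hom]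
  have e1 := mu_assoc M n m k
  have e2 := mu_assoc M m n k
  rw [← cancel_epi (α_ (pow M n) (pow M m) (pow M k)).hom, ← reassoc_of% e1]
  simp only [Category.assoc, Iso.hom_inv_id_assoc, pcast_comp_assoc, pcast_rfl, Category.id_comp]
  rw [mu_tens_assoc, tensorHom_id]
  have e4 := congrArg (· ▷ pow M k) (mu_br M n m)
  simp only [comp_whiskerRight] at e4
  rw [reassoc_of% e4, reassoc_of% e2, mu_tens_assoc, id_tensorHom]
  have e5 := congrArg (pow M m ◁ ·) (mu_br M n k)
  simp only [whiskerLeft_comp] at e5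
  rw [reassoc_of% e5]
  rw [mu_assoc_inv]

/-- The other hexagon axiom, treated with the inverse associators. -/
theorem br_add_left (n m k : ℕ) : (br M (n + m) k).hom = pcast M (Nat.add_assoc n m k) ≫
    tens (𝟙 (pow M n)) (br M m k).hom ≫ pcast M (Nat.add_assoc n k m).symm ≫
    tens (br M n k).hom (𝟙 (pow M m)) ≫ pcast M (Nat.add_assoc k n m) := by
  rw [← cancel_epi (mu M (n + m) k).hom, ← cancel_epi ((mu M n m).hom ▷ pow M k), mu_br,
    BraidedCategory.braiding_naturality_left_assoc, BraidedCategory.braiding_tensor_left_hom]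
  have e1 := mu_assoc_inv M n m k
  have e2 := mu_assoc_inv M n k m
  rw [← cancel_epi (α_ (pow M n) (pow M m) (pow M k)).inv, ← reassoc_of% e1]
  simp only [Category.assoc, Iso.inv_hom_id_assoc, pcast_comp_assoc, pcast_rfl, Category.id_comp]
  rw [mu_tens_assoc, id_tensorHom]
  have e4 := congrArg (pow M n ◁ ·) (mu_br M m k)
  simp only [whiskerLeft_comp] at e4
  rw [reassoc_of% e4, reassoc_of% e2, mu_tens_assoc, tensorHom_id]
  have e5 := congrArg (· ▷ pow M m) (mu_br M n k)
  simp only [comp_whiskerRight] at e5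
  rw [reassoc_of% e5, mu_assoc]

/-- The braiding of tensor powers, as an automorphism. -/
def brAut (n m : ℕ) : Aut (pow M (n + m)) := br M n m ≪≫ eqToIso (congrArg (pow M) (Nat.add_comm m n))

theorem brAut_hom (n m : ℕ) :
    (brAut M n m).hom = (br M n m).hom ≫ pcast M (Nat.add_comm m n) := rfl

/-- The hexagon in the form of the axiom `CrossedFamily.braid_add_right`, so that inductions on
block crossings run in parallel on both sides. -/
theorem brAut_add_right (n m k : ℕ) : brAut M n (m + k) =
    placeAut m (by omega) (brAut M n k) * placeAut 0 (by omega) (brAut M n m) := by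
  rw [placeAut_last _ _ (by omega), placeAut_first k _ (by omega)]
  ext
  simp only [mul_hom, castAut_hom, tensAut_hom, brAut_hom, one_hom, br_add_right, Category.assoc,
    pcast_comp, pcast_comp_assoc]
  have e1 (f : pow M (n + m) ⟶ pow M (m + n)) (h : m + n = n + m) : tens (f ≫ pcast M h) (𝟙 (pow M k)) =
      tens f (𝟙 (pow M k)) ≫ pcast M (by omega) := by
    rw [← pcast_rfl M (rfl : k = k), ← tens_pcast h rfl, tens_comp]; simp
  have e2 (f : pow M (n + k) ⟶ pow M (k + n)) (h : k + n = n + k) : tens (𝟙 (pow M m)) (f ≫ pcast M h) =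
      tens (𝟙 (pow M m)) f ≫ pcast M (by omega) := by
    rw [← pcast_rfl M (rfl : m = m), ← tens_pcast rfl h, tens_comp]; simp
  rw [e1, e2]
  simp

theorem brAut_add_left (n m k : ℕ) : brAut M (n + m) k =
    placeAut 0 (by omega) (brAut M n k) * placeAut n (by omega) (brAut M m k) := by
  rw [placeAut_first m _ (by omega), placeAut_last n _ (by omega)]
  ext
  simp only [mul_hom, castAut_hom, tensAut_hom, brAut_hom, one_hom, br_add_left, Category.assoc,
    pcast_comp, pcast_comp_assoc]
  have e1 (f : pow M (n + k) ⟶ pow M (k + n)) (h : k + n = n + k) : tens (f ≫ pcast M h) (𝟙 (pow M m)) =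
      tens f (𝟙 (pow M m)) ≫ pcast M (by omega) := by
    rw [← pcast_rfl M (rfl : m = m), ← tens_pcast h rfl, tens_comp]; simp
  have e2 (f : pow M (m + k) ⟶ pow M (k + m)) (h : k + m = m + k) : tens (𝟙 (pow M n)) (f ≫ pcast M h) =
      tens (𝟙 (pow M n)) f ≫ pcast M (by omega) := by
    rw [← pcast_rfl M (rfl : n = n), ← tens_pcast rfl h, tens_comp]; simp
  rw [e1, e2]
  simp

theorem brAut_zero_right (n : ℕ) : brAut M n 0 = 1 := by
  ext
  rw [← cancel_epi (mu M n 0).hom, brAut_hom, mu_br_assoc, mu_zero_left, mu_zero]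
  simp [one_hom]

theorem brAut_zero_left (n : ℕ) : brAut M 0 n = 1 := by
  ext
  rw [← cancel_epi (mu M 0 n).hom, brAut_hom, mu_br_assoc, mu_zero_left, mu_zero]
  simp [one_hom]

end Braided

/-! ### Twists of tensor powers -/

section Balanced

variable {B : Type u} [Category.{v} B] [MonoidalCategory B] [BraidedCategory B] [BalancedCategory B]
  (M : B) {n m k n' m' N l : ℕ}

/-- The twist of a tensor power. -/
def tw (n : ℕ) : Aut (pow M n) := BalancedCategory.twist (pow M n)

variable {M} in
theorem tw_natural (f : pow M n ⟶ pow M m) : f ≫ (tw M m).hom = (tw M n).hom ≫ f :=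
  BalancedCategory.twist_naturality f

theorem tw_zero : tw M 0 = 1 := Iso.ext BalancedCategory.twist_unit

/-- The balancing axiom in the form of `CrossedFamily.twist_add`. -/
theorem tw_add (n m : ℕ) : tw M (n + m) = placeAut 0 (by omega) (brAut M m n) * brAut M n m *
    tensAut (tw M n) (tw M m) := by
  rw [placeAut_first 0 _ (by omega), tensAut_zero_right]
  ext
  simp only [mul_hom, castAut_hom, tensAut_hom, brAut_hom, Category.assoc, pcast_comp_assoc,
    pcast_comp, pcast_rfl, Category.id_comp, Category.comp_id]
  rw [← cancel_epi (mu M n m).hom, mu_tens_assoc, mu_br_assoc, mu_br]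
  -- Naturality along `mu` replaces the twist of the tensor power by the twist of a tensor product.
  -- There the two smaller twists stand between the braidings, and naturality of the braiding moves
  -- them to the front.
  have h := BalancedCategory.twist_naturality (mu M n m).hom
  rw [BalancedCategory.twist_tensor, ← BraidedCategory.braiding_naturality_assoc] at h
  simp only [Category.assoc] at h
  exact h

end Balanced

end TensorPower
end RibbonPROB

namespace RibbonPROB

open MonoidalCategory

/-! ### Order-preserving maps as ordinal sums -/

section OrderMaps

variable {n m l n' m' l' : ℕ}

@[simp] theorem comp_ordCast_rfl (φ : Fin n →o Fin m) (h : n = n) : φ.comp (ordCast h) = φ := rfl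

theorem ordHom_ext_val {φ ψ : Fin n →o Fin m} (h : ∀ x, (φ x : ℕ) = ψ x) : φ = ψ := by
  ext x; exact h x

/-- An order-preserving map into an ordinal sum is a disjoint union. -/
theorem exists_ordTensor (φ : Fin n →o Fin (m + m')) : ∃ (a b : ℕ) (h : n = a + b)
    (φ₁ : Fin a →o Fin m) (φ₂ : Fin b →o Fin m'), φ = (ordTensor φ₁ φ₂).comp (ordCast h) := by
  have hc := cut_le φ m
  have h1 (x : Fin (cut φ m)) : (φ ⟨x, by omega⟩ : ℕ) < m :=
    (lt_cut_iff φ m ⟨x, by omega⟩).1 x.isLt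
  have h2 (x : Fin (n - cut φ m)) : m ≤ (φ ⟨cut φ m + x, by omega⟩ : ℕ) := by
    exact Nat.le_of_not_lt ((lt_cut_iff φ m ⟨cut φ m + x, by omega⟩).not.1 (by simp))
  refine ⟨cut φ m, n - cut φ m, by omega, ⟨fun x => ⟨φ ⟨x, by omega⟩, h1 x⟩, ?_⟩,
    ⟨fun x => ⟨φ ⟨cut φ m + x, by omega⟩ - m, by have := h2 x; omega⟩, ?_⟩, ordHom_ext_val fun x => ?_⟩
  · exact fun x y hxy => φ.monotone (a := ⟨x, _⟩) (b := ⟨y, _⟩) hxy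
  · intro x y hxy
    have := φ.monotone (a := ⟨cut φ m + x, by omega⟩) (b := ⟨cut φ m + y, by omega⟩)
      (Nat.add_le_add_left hxy _)
    exact Nat.sub_le_sub_right this m
  · rw [OrderHom.comp_coe, Function.comp]
    rcases Nat.lt_or_ge x (cut φ m) with h | h
    · rw [ordTensor_left _ _ _ h]; rfl
    · rw [ordTensor_right _ _ _ h]
      have e : (⟨cut φ m + (x - cut φ m), by omega⟩ : Fin n) = x :=
        Fin.ext (Nat.add_sub_cancel' h)
      have h3 := h2 ⟨x - cut φ m, by omega⟩
      change (φ x : ℕ) = m + ((φ ⟨cut φ m + (x - cut φ m), by omega⟩ : ℕ) - m)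
      change m ≤ (φ ⟨cut φ m + (x - cut φ m), by omega⟩ : ℕ) at h3
      rw [e] at h3 ⊢
      omega

theorem ordTensor_comp (ψ : Fin m →o Fin l) (φ : Fin n →o Fin m) (ψ' : Fin m' →o Fin l')
    (φ' : Fin n' →o Fin m') : (ordTensor ψ ψ').comp (ordTensor φ φ') =
      ordTensor (ψ.comp φ) (ψ'.comp φ') := by
  refine ordHom_ext_val fun x => ?_
  rw [OrderHom.comp_coe, Function.comp]
  rcases Nat.lt_or_ge x n with h | h
  · have e := ordTensor_left φ φ' x h
    rw [ordTensor_left _ _ x h, ordTensor_left _ _ _ (by omega)]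
    simp only [e]; rfl
  · have e := ordTensor_right φ φ' x h
    rw [ordTensor_right _ _ x h, ordTensor_right _ _ _ (by omega)]
    simp only [e, Nat.add_sub_cancel_left]; rfl

theorem ordTensor_id : ordTensor (OrderHom.id : Fin n →o Fin n) (OrderHom.id : Fin m →o Fin m) =
    OrderHom.id := by
  refine ordHom_ext_val fun x => ?_
  rcases Nat.lt_or_ge x n with h | h
  · rw [ordTensor_left _ _ x h]; rfl
  · rw [ordTensor_right _ _ x h]
    simp only [OrderHom.id_coe, id_eq]; omega

theorem eq_zero_of_ordHom_zero (φ : Fin n →o Fin 0) : n = 0 := by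
  rcases n with _ | n
  · rfl
  · exact (φ 0).elim0

/-- The order-preserving map to the one-element ordinal. -/
def bang (n : ℕ) : Fin n →o Fin 1 := ⟨fun _ => 0, fun _ _ _ => le_rfl⟩

theorem eq_bang (φ : Fin n →o Fin 1) : φ = bang n := by
  ext x; omega

/-- The restriction of an order-preserving map to the preimage of an initial segment. -/
def ordInit (φ : Fin n →o Fin (m + 1)) : Fin (cut φ m) →o Fin m where
  toFun x := ⟨φ ⟨x, x.isLt.trans_le (cut_le φ m)⟩, (lt_cut_iff φ m ⟨x, _⟩).1 x.isLt⟩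
  monotone' x y hxy := φ.monotone (a := ⟨x, _⟩) (b := ⟨y, _⟩) hxy

end OrderMaps

/-! ### Iterated multiplication and the action of order-preserving maps -/

namespace TensorPower

variable {B : Type u} [Category.{v} B] [MonoidalCategory B] {M : B} {n m l n' m' a b : ℕ}

variable (M) in
/-- A monoid structure on the first tensor power. -/
structure PowMon where
  mul : pow M (1 + 1) ⟶ pow M 1
  one : pow M 0 ⟶ pow M 1
  one_mul : tens one (𝟙 (pow M 1)) ≫ mul = pcast M (Nat.zero_add 1)
  mul_one : tens (𝟙 (pow M 1)) one ≫ mul = 𝟙 (pow M 1)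
  mul_assoc : tens mul (𝟙 (pow M 1)) ≫ mul =
    pcast M (Nat.add_assoc 1 1 1) ≫ tens (𝟙 (pow M 1)) mul ≫ mul

namespace PowMon

variable (S : PowMon M)

/-- The iterated multiplication. -/
def multi : ∀ n, pow M n ⟶ pow M 1
  | 0 => S.one
  | n + 1 => tens (multi n) (𝟙 (pow M 1)) ≫ S.mul

theorem multi_succ (n : ℕ) : S.multi (n + 1) = tens (S.multi n) (𝟙 (pow M 1)) ≫ S.mul := rfl

theorem multi_one : S.multi 1 = 𝟙 (pow M 1) := S.one_mul

theorem tens_id_comp {c : ℕ} (f : pow M n ⟶ pow M m) (g : pow M a ⟶ pow M b) (h : pow M b ⟶ pow M c) :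
    tens f (g ≫ h) = tens f g ≫ tens (𝟙 _) h := by
  rw [tens_comp, Category.comp_id]

/-- General associativity, by induction on the second number: associativity of the multiplication
moves the last factor out. -/
theorem multi_add (a b : ℕ) : tens (S.multi a) (S.multi b) ≫ S.mul = S.multi (a + b) := by
  induction b with
  | zero =>
    have h : tens (S.multi a) S.one = tens (S.multi a) (𝟙 _) ≫ tens (𝟙 _) S.one := by
      rw [tens_comp, Category.comp_id, Category.id_comp]
    change tens (S.multi a) S.one ≫ S.mul = _
    rw [h, Category.assoc, S.mul_one, tens_zero_right]
    exact Category.comp_id _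
  | succ b ih =>
    have h := tens_assoc (S.multi a) (S.multi b) (𝟙 (pow M 1))
    -- Here `a + (b + 1)` is definitionally `(a + b) + 1`, so the cast at the source of `tens_assoc`
    -- disappears.
    have h' : tens (S.multi a) (tens (S.multi b) (𝟙 (pow M 1))) =
        tens (tens (S.multi a) (S.multi b)) (𝟙 (pow M 1)) ≫ pcast M (Nat.add_assoc 1 1 1) := by
      rw [h]; exact (Category.id_comp _).symm
    rw [multi_succ, tens_id_comp, h']
    simp only [Category.assoc]
    rw [← S.mul_assoc, tens_comp_assoc, ih, Category.comp_id]
    rfl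

/-- The action of an order-preserving map on tensor powers of a monoid. -/
def mulMap : ∀ {m n : ℕ}, (Fin n →o Fin m) → (pow M n ⟶ pow M m)
  | 0, _, φ => pcast M (eq_zero_of_ordHom_zero φ)
  -- The fibre over the last point is the final segment with `n - cut φ m` elements; its factors are
  -- multiplied together and the rest is handled by recursion.
  | m + 1, _, φ => pcast M (Nat.add_sub_cancel' (cut_le φ m)).symm ≫
      tens (mulMap (ordInit φ)) (S.multi _)

theorem mulMap_zero (φ : Fin 0 →o Fin 0) : S.mulMap φ = 𝟙 (pow M 0) := rfl

/-- The recursion of `mulMap` in usable form, for a map already presented as an ordinal sum with its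
last fibre. The cast allows for decompositions of the source that hold only propositionally. -/
theorem mulMap_ordTensor_bang_cast (h : n = a + b) (φ : Fin a →o Fin m) :
    S.mulMap ((ordTensor φ (bang b)).comp (ordCast h)) =
      pcast M h ≫ tens (S.mulMap φ) (S.multi b) := by
  subst h
  rw [comp_ordCast_rfl, mulMap]
  have h1 : cut (ordTensor φ (bang b)) m = a := by
    rw [cut_tensor_left _ _ _ le_rfl, cut_top]
  have h2 : ∀ x : Fin (cut (ordTensor φ (bang b)) m),
      (ordInit (ordTensor φ (bang b)) x : ℕ) = φ ⟨x, x.isLt.trans_eq h1⟩ := fun x =>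
    ordTensor_left φ (bang b) ⟨x, _⟩ (x.isLt.trans_eq h1)
  generalize ordInit (ordTensor φ (bang b)) = χ at h2
  -- The cut of the ordinal sum equals `a` only propositionally, so the lengths of both blocks are
  -- generalized before the equalities are substituted.
  have key : ∀ (c d : ℕ) (hc : c = a) (_ : d = b) (h : a + b = c + d) (χ : Fin c →o Fin m),
      (∀ x : Fin c, (χ x : ℕ) = φ ⟨x, x.isLt.trans_eq hc⟩) →
      pcast M h ≫ tens (S.mulMap χ) (S.multi d) =
        pcast M rfl ≫ tens (S.mulMap φ) (S.multi b) := by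
    rintro c d rfl rfl h χ hχ
    obtain rfl : χ = φ := ordHom_ext_val hχ
    rfl
  exact key _ _ h1 (by omega) _ χ h2

theorem mulMap_ordTensor_one (φ : Fin a →o Fin m) (ψ : Fin b →o Fin 1) :
    S.mulMap (ordTensor φ ψ) = tens (S.mulMap φ) (S.multi b) := by
  rw [eq_bang ψ]
  simpa using S.mulMap_ordTensor_bang_cast rfl φ

theorem mulMap_bang (ψ : Fin n →o Fin 1) : S.mulMap ψ = S.multi n := by
  have h : ψ = (ordTensor (OrderHom.id : Fin 0 →o Fin 0) (bang n)).comp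
      (ordCast (Nat.zero_add n).symm) := by
    ext x; omega
  rw [h]
  refine (S.mulMap_ordTensor_bang_cast (Nat.zero_add n).symm OrderHom.id).trans ?_
  rw [mulMap_zero, tens_zero_left, pcast_comp_assoc, pcast_rfl, Category.id_comp]
  exact Category.comp_id _

/-- Induction on the target of `ψ`: splitting off the last fibre and rebracketing reduces to a
smaller target. -/
theorem mulMap_ordTensor (φ : Fin n →o Fin m) (ψ : Fin n' →o Fin m') :
    S.mulMap (ordTensor φ ψ) = tens (S.mulMap φ) (S.mulMap ψ) := by
  induction m' generalizing n' with
  | zero =>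
    obtain rfl := eq_zero_of_ordHom_zero ψ
    have : ordTensor φ ψ = φ := ordHom_ext_val fun x => ordTensor_left φ ψ x x.isLt
    rw [mulMap_zero, tens_zero_right]
    exact congrArg _ this
  | succ m' ih =>
    obtain ⟨a, b, rfl, ψ', χ, rfl⟩ := exists_ordTensor ψ
    rw [comp_ordCast_rfl, mulMap_ordTensor_one]
    have h : ordTensor φ (ordTensor ψ' χ) = (ordTensor (ordTensor φ ψ') (bang b)).comp
        (ordCast (Nat.add_assoc n a b).symm) := by
      rw [eq_bang χ]
      exact ordHom_ext_val fun x => (DTensor.ordTensor_assoc φ ψ' (bang b)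
        (ordCast (Nat.add_assoc n a b).symm x)).symm
    rw [h]
    refine (S.mulMap_ordTensor_bang_cast _ _).trans ?_
    have e := tens_assoc (S.mulMap φ) (S.mulMap ψ') (S.multi b)
    rw [← cancel_epi (pcast M (Nat.add_assoc n a b)), ← e, ih, pcast_comp_assoc]
    rw [pcast_rfl, Category.id_comp]
    exact (Category.comp_id _).symm

/-- Multiplying first within the fibres and then the results is multiplying everything, by
`multi_add`. -/
theorem mulMap_comp_multi (φ : Fin n →o Fin m) : S.mulMap φ ≫ S.multi m = S.multi n := by
  induction m generalizing n with
  | zero =>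
    obtain rfl := eq_zero_of_ordHom_zero φ
    rw [mulMap_zero, Category.id_comp]
  | succ m ih =>
    obtain ⟨a, b, rfl, φ', χ, rfl⟩ := exists_ordTensor φ
    rw [comp_ordCast_rfl, mulMap_ordTensor_one, multi_succ, tens_comp_assoc, ih, Category.comp_id,
      multi_add]

/-- Splitting `ψ` over the last point of its target, and then `φ` accordingly, leaves a smaller
composite and a composite into one point; the latter is `mulMap_comp_multi`. -/
theorem mulMap_comp (ψ : Fin m →o Fin l) (φ : Fin n →o Fin m) :
    S.mulMap (ψ.comp φ) = S.mulMap φ ≫ S.mulMap ψ := by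
  induction l generalizing n m with
  | zero =>
    obtain rfl := eq_zero_of_ordHom_zero ψ
    obtain rfl := eq_zero_of_ordHom_zero φ
    simp only [mulMap_zero, Category.comp_id]
  | succ l ih =>
    obtain ⟨a, b, rfl, ψ', χ, rfl⟩ := exists_ordTensor ψ
    obtain ⟨c, d, rfl, φ₁, φ₂, rfl⟩ := exists_ordTensor φ
    rw [comp_ordCast_rfl, comp_ordCast_rfl, ordTensor_comp, mulMap_ordTensor, mulMap_ordTensor,
      mulMap_ordTensor, tens_comp, ih, mulMap_bang, mulMap_bang, mulMap_comp_multi]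

theorem mulMap_id (n : ℕ) : S.mulMap (OrderHom.id : Fin n →o Fin n) = 𝟙 (pow M n) := by
  induction n with
  | zero => rfl
  | succ n ih =>
    rw [← ordTensor_id, mulMap_ordTensor, ih, mulMap_bang, multi_one, tens_id]

theorem mulMap_ordCast (h : n = m) : S.mulMap (ordCast h) = pcast M h := by
  subst h; exact S.mulMap_id n

end PowMon

end TensorPower
end RibbonPROB

namespace RibbonPROB

open MonoidalCategory

/-! ### Generation of the groups under block sums -/

namespace CrossedFamily

variable {J : ℕ → Type*} [∀ n, Group (J n)] [CrossedFamily J] {n m l n' m' : ℕ}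

/-- The groups `J n` are generated by block sums of `twist 1`, `braid 1 1` and elements of `A`. -/
def IsGeneratedBy (A : Set (J 1)) : Prop :=
  ∀ S : ∀ n, Subgroup (J n), A ⊆ S 1 → twist 1 ∈ S 1 → braid 1 1 ∈ S (1 + 1) →
    (∀ (n m : ℕ) (j : J n), j ∈ S n → place (N := n + m) 0 (by omega) j ∈ S (n + m)) →
    (∀ (n m : ℕ) (j : J m), j ∈ S m → place (N := n + m) n le_rfl j ∈ S (n + m)) →
    ∀ n (j : J n), j ∈ S n

theorem pull_inv (φ : Fin n →o Fin m) (j : J m) :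
    pull φ j⁻¹ = (pull (permAct (perm j⁻¹) φ) j)⁻¹ := by
  have := pull_mul φ j j⁻¹
  rw [mul_inv_cancel, pull_one] at this
  exact (inv_eq_of_mul_eq_one_right this.symm).symm

theorem permAct_place_left (φ : Fin n →o Fin m) (ψ : Fin n' →o Fin m') (j : J m) :
    permAct (perm (place (N := m + m') 0 (by omega) j)) (ordTensor φ ψ) =
      ordTensor (permAct (perm j) φ) ψ := by
  rw [perm_place_left, permAct_ordTensor, permAct_one]

theorem permAct_place_right (φ : Fin n →o Fin m) (ψ : Fin n' →o Fin m') (j : J m') :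
    permAct (perm (place (N := m + m') m le_rfl j)) (ordTensor φ ψ) =
      ordTensor φ (permAct (perm j) ψ) := by
  rw [perm_place_right, permAct_ordTensor, permAct_one]

end CrossedFamily

-- Each generator of the presentation is the crossing of two ribbons or the twist of one, with
-- identity ribbons added first on the left and then on the right.
open CrossedFamily in
theorem RB.isGeneratedBy_empty : IsGeneratedBy (∅ : Set (RB 1)) := by
  intro S _ htw hbr hl hr n j
  have hbr' : RB.s 2 0 ∈ S (1 + 1) := by rw [← RB.X_one_one]; exact hbr
  have htw' : RB.t 1 0 ∈ S 1 := by rw [← RB.T_one]; exact htw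
  induction j using RB.induction' with
  | one => exact one_mem _
  | mul x y hx hy => exact mul_mem hx hy
  | inv x hx => exact inv_mem hx
  | hs i hi =>
    obtain ⟨b, rfl⟩ := Nat.exists_eq_add_of_le (show i + (1 + 1) ≤ n from hi)
    have := hl _ b _ (hr i _ _ hbr')
    rw [CrossedFamily.place_place] at this
    rw [RB.s_eq_place hi]
    simp only [zero_add] at this
    exact this
  | ht i hi =>
    obtain ⟨b, rfl⟩ := Nat.exists_eq_add_of_le (show i + 1 ≤ n from hi)
    have := hl _ b _ (hr i _ _ htw')
    rw [CrossedFamily.place_place] at this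
    rw [RB.t_eq_place hi]
    simp only [zero_add] at this
    exact this

/-! ### The action of the ribbon braid groups and the exchange law -/

namespace TensorPower

variable {B : Type u} [Category.{v} B] [MonoidalCategory B] [BraidedCategory B]
  {M : B} {n m l n' m' N : ℕ}

/-- Naturality of the braiding in its first variable; compare `CrossedFamily.braid_place_left`. -/
theorem brAut_place_left (f : Aut (pow M n)) : brAut M n m * placeAut 0 (by omega) f =
    placeAut m (by omega) f * brAut M n m := by
  rw [placeAut_first m _ rfl, placeAut_last m _ (Nat.add_comm m n)]
  ext
  simp only [mul_hom, castAut_hom, tensAut_hom, brAut_hom, one_hom, pcast_rfl, Category.id_comp,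
    Category.comp_id, tens_br_assoc, Category.assoc, pcast_comp_assoc]

theorem brAut_place_right (f : Aut (pow M m)) : brAut M n m * placeAut n (by omega) f =
    placeAut 0 (by omega) f * brAut M n m := by
  rw [placeAut_last n _ rfl, placeAut_first n _ (Nat.add_comm m n)]
  ext
  simp only [mul_hom, castAut_hom, tensAut_hom, brAut_hom, one_hom, pcast_rfl, Category.id_comp,
    Category.comp_id, tens_br_assoc, Category.assoc, pcast_comp_assoc]

-- Yang-Baxter is naturality of the braiding of one factor past two, applied to the crossing of
-- those two, with that braiding expanded by the hexagon.
variable (M) in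
theorem placeAut_yang_baxter :
    placeAut (N := 1 + (1 + 1)) 0 (by omega) (brAut M 1 1) * placeAut 1 (by omega) (brAut M 1 1) *
      placeAut 0 (by omega) (brAut M 1 1) =
    placeAut 1 (by omega) (brAut M 1 1) * placeAut 0 (by omega) (brAut M 1 1) *
      placeAut 1 (by omega) (brAut M 1 1) := by
  have h := brAut_place_right (n := 1) (brAut M 1 1)
  rw [brAut_add_right] at h
  rw [h, mul_assoc]

variable [BalancedCategory B]

variable (M) in
/-- The automorphism of a tensor power given by a generator of the ribbon braid group. -/
def genAut (n : ℕ) : RibbonGen n → Aut (pow M n)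
  | .cross i h => placeAut i (show i + (1 + 1) ≤ n from h) (brAut M 1 1)
  | .twist i h => placeAut i h (tw M 1)

variable (M) in
/-- The action of the ribbon braid group on a tensor power. -/
def rbRep (n : ℕ) : RB n →* Aut (pow M n) :=
  RB.lift (genAut M n)
    (fun i j hi hj => (placeAut_comm i j _ _ (by omega) _ _).eq)
    (fun i h => by
      have h1 (h' : i + (1 + 1) ≤ n) : placeAut i h' (brAut M 1 1) =
          placeAut i (show i + (1 + (1 + 1)) ≤ n by omega) (placeAut 0 (by omega) (brAut M 1 1)) := by
        rw [placeAut_placeAut]; rfl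
      have h2 (h' : i + 1 + (1 + 1) ≤ n) : placeAut (i + 1) h' (brAut M 1 1) =
          placeAut i (show i + (1 + (1 + 1)) ≤ n by omega) (placeAut 1 (by omega) (brAut M 1 1)) := by
        rw [placeAut_placeAut]
      simp only [genAut]
      rw [h1, h2, ← map_mul, ← map_mul, placeAut_yang_baxter, map_mul, map_mul])
    (fun i j hi hj => by
      simp only [genAut]
      rcases Nat.lt_trichotomy i j with h | rfl | h
      · exact (placeAut_comm i j _ _ (by omega) _ _).eq
      · rfl
      · exact (placeAut_comm j i _ _ (by omega) _ _).eq.symm)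
    (fun i h => by
      -- A crossing against the twists of its own two ribbons: naturality of the braiding for `tw M
      -- 1`, here in the first and below in the second variable, moved to position `i`.
      have e := congrArg (placeAut i (show i + (1 + 1) ≤ n from h))
        (brAut_place_left (M := M) (m := 1) (tw M 1))
      rw [map_mul, map_mul, placeAut_placeAut, placeAut_placeAut] at e
      exact e)
    (fun i h => by
      have e := congrArg (placeAut i (show i + (1 + 1) ≤ n from h))
        (brAut_place_right (M := M) (n := 1) (tw M 1))
      rw [map_mul, map_mul, placeAut_placeAut, placeAut_placeAut] at e
      exact e)
    (fun i j h hj h1 h2 => by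
      simp only [genAut]
      rcases Nat.lt_or_ge j i with h' | h'
      · exact (placeAut_comm j i _ _ (by omega) _ _).eq.symm
      · exact (placeAut_comm i j _ _ (by omega) _ _).eq)

theorem rbRep_gen (g : RibbonGen n) : rbRep M n (RB.gen g) = genAut M n g := RB.lift_gen ..

theorem rbRep_place (a : ℕ) (h : a + n ≤ N) (j : RB n) :
    rbRep M N (RB.place a h j) = placeAut a h (rbRep M n j) := by
  suffices H : (rbRep M N).comp (RB.place a h) = (placeAut a h).comp (rbRep M n) from
    DFunLike.congr_fun H j
  refine RB.hom_ext fun g => ?_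
  rcases g with ⟨i, hi⟩ | ⟨i, hi⟩
  · rw [MonoidHom.comp_apply, MonoidHom.comp_apply, rbRep_gen, RB.place, RB.lift_gen, rbRep_gen]
    exact (placeAut_placeAut ..).symm
  · rw [MonoidHom.comp_apply, MonoidHom.comp_apply, rbRep_gen, RB.place, RB.lift_gen, rbRep_gen]
    exact (placeAut_placeAut ..).symm

theorem rbRep_braid_one_one : rbRep M (1 + 1) (CrossedFamily.braid 1 1) = brAut M 1 1 := by
  have : CrossedFamily.braid (J := RB) 1 1 = RB.gen (.cross 0 (by omega)) := by
    rw [RB.gen_cross]; exact RB.X_one_one 0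
  rw [this, rbRep_gen]
  exact placeAut_self _ _

theorem rbRep_twist_one : rbRep M 1 (CrossedFamily.twist 1) = tw M 1 := by
  have : CrossedFamily.twist (J := RB) 1 = RB.gen (.twist 0 (by omega)) := by
    rw [RB.gen_twist]; exact RB.T_one 0
  rw [this, rbRep_gen]
  exact placeAut_self _ _

/-- The block crossing and the braiding satisfy the same hexagon recursion in the right block. -/
theorem rbRep_braid_one (m : ℕ) : rbRep M (1 + m) (CrossedFamily.braid 1 m) = brAut M 1 m := by
  induction m with
  | zero =>
    have : CrossedFamily.braid (J := RB) 1 0 = 1 := RB.X_zero_right 0 1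
    rw [this, map_one, brAut_zero_right]
  | succ m ih =>
    rw [CrossedFamily.braid_add_right, map_mul, brAut_add_right, ← ih, ← rbRep_braid_one_one,
      ← rbRep_place, ← rbRep_place]
    rfl

/-- Recursion in the left block by the other hexagon, starting from a single ribbon crossing a
block. This makes the functor of tensor powers braided. -/
theorem rbRep_braid (n m : ℕ) : rbRep M (n + m) (CrossedFamily.braid n m) = brAut M n m := by
  induction n with
  | zero =>
    have : CrossedFamily.braid (J := RB) 0 m = 1 := RB.X_zero_left 0 m
    rw [this, map_one, brAut_zero_left]
  | succ n ih =>
    rw [CrossedFamily.braid_add_left, map_mul, brAut_add_left, ← ih, ← rbRep_braid_one,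
      ← rbRep_place, ← rbRep_place]
    rfl

theorem rbRep_place_left (j : RB n) :
    rbRep M (n + m) (CrossedFamily.place 0 (by omega) j) = tensAut (rbRep M n j) 1 := by
  refine (rbRep_place 0 _ j).trans ?_
  rw [placeAut_first m _ rfl, castAut_rfl]

theorem rbRep_place_right (j : RB m) :
    rbRep M (n + m) (CrossedFamily.place n le_rfl j) = tensAut 1 (rbRep M m j) := by
  refine (rbRep_place n _ j).trans ?_
  rw [placeAut_last n _ rfl, castAut_rfl]

/-- Both sides satisfy the same recursion, `twist_add` and `tw_add`, and agree on one ribbon by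
construction. -/
theorem rbRep_twist (n : ℕ) : rbRep M n (CrossedFamily.twist n) = tw M n := by
  induction n with
  | zero => rw [CrossedFamily.twist_zero, map_one, tw_zero]
  | succ n ih =>
    have h : tensAut (tw M n) (tw M 1) = tensAut (tw M n) 1 * tensAut 1 (tw M 1) := by
      rw [← tensAut_mul, mul_one, one_mul]
    rw [CrossedFamily.twist_add, map_mul, map_mul, map_mul, rbRep_place_left, rbRep_place_right, ih,
      rbRep_twist_one, tw_add, h, rbRep_braid, ← rbRep_braid 1 n, ← rbRep_place]
    rfl

variable (J : ℕ → Type*) [∀ n, Group (J n)] [CrossedFamily J]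

variable (M) in
/-- Actions of the groups `J n` on the tensor powers of `M` that are compatible with block sums,
braidings and twists. -/
structure BlockRep where
  rep (n : ℕ) : J n →* Aut (pow M n)
  place_left (n m : ℕ) (j : J n) :
    rep (n + m) (CrossedFamily.place 0 (by omega) j) = tensAut (rep n j) 1
  place_right (n m : ℕ) (j : J m) :
    rep (n + m) (CrossedFamily.place n le_rfl j) = tensAut 1 (rep m j)
  braid (n m : ℕ) : rep (n + m) (CrossedFamily.braid n m) = brAut M n m
  twist (n : ℕ) : rep n (CrossedFamily.twist n) = tw M n

variable (M) in
/-- The action of the ribbon braid groups on tensor powers. -/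
def rbBlockRep : BlockRep M RB where
  rep := rbRep M
  place_left _ _ := rbRep_place_left
  place_right _ _ := rbRep_place_right
  braid := rbRep_braid
  twist := rbRep_twist

variable {J}

/-- Compatibility of an element of `J m` with the multiplication. -/
def BlockRep.Exchange (R : BlockRep M J) (S : PowMon M) {m : ℕ} (j : J m) : Prop :=
  ∀ (n : ℕ) (φ : Fin n →o Fin m), S.mulMap φ ≫ (R.rep m j).hom =
    (R.rep n (CrossedFamily.pull φ j)).hom ≫ S.mulMap (permAct (CrossedFamily.perm j) φ)

-- The elements satisfying the exchange law form subgroups closed under block sums, since a map into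
-- `m + m'` is an ordinal sum. For the twist the law is naturality of the twist, and for the
-- crossing it is naturality of the braiding. No commutativity of the monoid is needed: cabling
-- carries whole fibres past each other without changing the order within a fibre.
open CrossedFamily in
theorem BlockRep.exchange_of_isGeneratedBy (R : BlockRep M J) (S : PowMon M) {A : Set (J 1)}
    (hA : IsGeneratedBy A) (h : ∀ a ∈ A, R.Exchange S a) (j : J m) : R.Exchange S j := by
  let T (m : ℕ) : Subgroup (J m) :=
    { carrier := {j | R.Exchange S j}
      one_mem' := fun n φ => by
        simp only [map_one, CrossedFamily.pull_one, permAct_one, one_hom, Category.comp_id,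
          Category.id_comp]
      mul_mem' := fun {j k} hj hk n φ => by
        rw [map_mul, mul_hom, reassoc_of% (hk n φ), hj, pull_mul, map_mul, mul_hom, Category.assoc,
          map_mul, permAct_mul]
      inv_mem' := fun {j} hj n φ => by
        -- The law for `j` is used at the map `j⁻¹_⋆ φ`, which `j` sends back to `φ`, and is then
        -- multiplied by the inverses on both sides.
        have e := hj n (permAct (perm j⁻¹) φ)
        rw [← permAct_mul, ← map_mul, mul_inv_cancel, map_one, permAct_one] at e
        have e1 : (R.rep m j).hom ≫ (R.rep m j⁻¹).hom = 𝟙 _ := by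
          rw [← mul_hom, ← map_mul, inv_mul_cancel, map_one, one_hom]
        have e2 : (R.rep n (pull φ j⁻¹)).hom ≫ (R.rep n (pull (permAct (perm j⁻¹) φ) j)).hom =
            𝟙 _ := by
          rw [← mul_hom, ← map_mul, CrossedFamily.pull_inv, mul_inv_cancel, map_one, one_hom]
        have e3 := congrArg (fun f => (R.rep n (pull φ j⁻¹)).hom ≫ f ≫ (R.rep m j⁻¹).hom) e
        simp only [Category.assoc, e1, reassoc_of% e2, Category.comp_id] at e3
        exact e3.symm }
  refine hA T h ?_ ?_ ?_ ?_ m j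
  · intro n φ
    rw [pull_twist, R.twist, R.twist, perm_twist, permAct_one, tw_natural]
  · intro n φ
    obtain ⟨a, b, rfl, φ₁, φ₂, rfl⟩ := exists_ordTensor φ
    rw [comp_ordCast_rfl, pull_braid, R.braid, R.braid, brAut_hom, brAut_hom]
    -- Exchanging the two fibres amounts to swapping the summands, so that naturality of `br`
    -- applies to the tensor product of the two multiplications.
    have e := congrArg S.mulMap (DTensor.ordTensor_braid φ₁ φ₂ _ (perm_braid (J := J) 1 1) _
      (perm_braid (J := J) a b))
    rw [PowMon.mulMap_comp, PowMon.mulMap_comp, PowMon.mulMap_ordCast, PowMon.mulMap_ordCast,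
      pcast_rfl, Category.comp_id] at e
    rw [e, PowMon.mulMap_ordTensor, PowMon.mulMap_ordTensor, tens_br_assoc, pcast_rfl,
      Category.comp_id, Category.assoc, pcast_comp_assoc, pcast_rfl, Category.id_comp]
  · intro m m' j hj n φ
    obtain ⟨a, b, rfl, φ₁, φ₂, rfl⟩ := exists_ordTensor φ
    rw [comp_ordCast_rfl, pull_place_left, R.place_left, R.place_left, permAct_place_left,
      PowMon.mulMap_ordTensor, PowMon.mulMap_ordTensor, tensAut_hom, tensAut_hom, tens_comp,
      tens_comp, hj, one_hom, one_hom, Category.comp_id, Category.id_comp]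
  · intro m m' j hj n φ
    obtain ⟨a, b, rfl, φ₁, φ₂, rfl⟩ := exists_ordTensor φ
    rw [comp_ordCast_rfl, pull_place_right, R.place_right, R.place_right, permAct_place_right,
      PowMon.mulMap_ordTensor, PowMon.mulMap_ordTensor, tensAut_hom, tensAut_hom, tens_comp,
      tens_comp, hj, one_hom, one_hom, Category.comp_id, Category.id_comp]

end TensorPower
end RibbonPROB

namespace RibbonPROB

open MonoidalCategory

/-! ### Generation of the labelled groups -/

section Labels

open CrossedFamily

variable {G : Type w} [Group G] {J : ℕ → Type*} [∀ n, Group (J n)] [CrossedFamily J] {n m : ℕ}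

theorem Wreath.ext_iff' {j k : Wreath G J n} : j = k ↔ (∀ i, j.left i = k.left i) ∧ j.right = k.right :=
  ⟨fun h => h ▸ ⟨fun _ => rfl, rfl⟩, fun h => SemidirectProduct.ext (funext h.1) h.2⟩

variable (J) in
/-- The element of `G ⋊ J 1` given by a label. -/
def label : G →* Wreath G J 1 :=
  (SemidirectProduct.inl (φ := labelAct G J 1)).comp (Pi.constMonoidHom (Fin 1) G)

theorem label_left (g : G) (i : Fin 1) : (label J g).left i = g := rfl

theorem inl_succ (x : Fin (n + 1) → G) : (SemidirectProduct.inl x : Wreath G J (n + 1)) =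
    CrossedFamily.place (J := Wreath G J) 0 (by omega)
      (SemidirectProduct.inl (fun i => x i.castSucc) : Wreath G J n) *
    CrossedFamily.place n le_rfl (label J (x (Fin.last n))) := by
  rw [Wreath.ext_iff']
  constructor
  · intro i
    change _ = (Wreath.place 0 (by omega)
      (SemidirectProduct.inl (fun i => x i.castSucc) : Wreath G J n) *
      Wreath.place n le_rfl (label J (x (Fin.last n))) : Wreath G J (n + 1)).left i
    rw [Wreath.mul_left_apply, Wreath.place_left_eq, Wreath.place_left_eq, Wreath.place_right_eq,
      SemidirectProduct.right_inl, map_one, map_one, inv_one, Equiv.Perm.one_apply,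
      SemidirectProduct.left_inl, SemidirectProduct.left_inl]
    rcases Nat.lt_or_ge i n with h | h
    · rw [Wreath.placeLabel_in _ _ _ (by omega) (by omega), Wreath.placeLabel_out _ _ _ (by omega),
        mul_one]
      rfl
    · rw [Wreath.placeLabel_out _ _ _ (by omega), Wreath.placeLabel_in _ _ _ (by omega) (by omega),
        one_mul, label_left]
      exact congrArg x (Fin.ext (by simp only [Fin.val_last]; omega))
  · change (1 : J (n + 1)) = CrossedFamily.place 0 _ 1 * CrossedFamily.place n _ 1
    rw [map_one, map_one, mul_one]

/-- In a semidirect product every element is a label vector times an unlabelled element. The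
unlabelled part is reached by pulling the subgroups back to `J`, the label vector one strand at a
time by `inl_succ`. -/
theorem Wreath.isGeneratedBy_range_label (hJ : IsGeneratedBy (∅ : Set (J 1))) :
    IsGeneratedBy (Set.range (label (G := G) J)) := by
  intro S hA htw hbr hl hr n j
  have hpure : ∀ n (j : J n), (SemidirectProduct.inr j : Wreath G J n) ∈ S n := by
    refine hJ (fun n => (S n).comap SemidirectProduct.inr) (Set.empty_subset _) htw hbr
      (fun n m j hj => ?_) (fun n m j hj => ?_)
    · have e := Wreath.place_pure (G := G) (N := n + m) 0 (by omega) j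
      exact (congrArg (· ∈ S (n + m)) e).mp (hl n m _ hj)
    · have e := Wreath.place_pure (G := G) (N := n + m) n (by omega) j
      exact (congrArg (· ∈ S (n + m)) e).mp (hr n m _ hj)
  have hlabel : ∀ n (x : Fin n → G), (SemidirectProduct.inl x : Wreath G J n) ∈ S n := by
    intro n
    induction n with
    | zero =>
      intro x
      rw [Subsingleton.elim x 1, map_one]
      exact one_mem _
    | succ n ih =>
      intro x
      rw [inl_succ]
      exact mul_mem (hl n 1 _ (ih _)) (hr n 1 _ (hA ⟨_, rfl⟩))
  rw [← SemidirectProduct.inl_left_mul_inr_right j]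
  exact mul_mem (hlabel n _) (hpure n _)

end Labels

/-! ### Actions of labelled elements on tensor powers -/

namespace TensorPower

variable {B : Type u} [Category.{v} B] [MonoidalCategory B] {M : B} {G : Type w} [Group G]
  (a : G →* Aut (pow M 1)) {n m : ℕ}

/-- The action of `n` labels on a tensor power. -/
def labelAut : ∀ {n : ℕ}, (Fin n → G) → Aut (pow M n)
  | 0, _ => 1
  | n + 1, x => tensAut (labelAut (n := n) fun i => x i.castSucc) (a (x (Fin.last n)))

theorem labelAut_zero (x : Fin 0 → G) : labelAut a x = 1 := rfl

theorem labelAut_succ (x : Fin (n + 1) → G) : labelAut a x =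
    tensAut (labelAut a fun i => x i.castSucc) (a (x (Fin.last n))) := rfl

theorem labelAut_one : labelAut a (1 : Fin n → G) = 1 := by
  induction n with
  | zero => rfl
  | succ n ih =>
    exact (congrArg₂ tensAut ih (map_one a)).trans tensAut_one

theorem labelAut_mul (x y : Fin n → G) : labelAut a (x * y) = labelAut a x * labelAut a y := by
  induction n with
  | zero => rw [labelAut_zero, labelAut_zero, labelAut_zero, one_mul]
  | succ n ih =>
    rw [labelAut_succ, labelAut_succ a x, labelAut_succ a y, ← tensAut_mul, ← ih, ← map_mul]
    rfl

theorem labelAut_add (z : Fin (n + m) → G) : labelAut a z =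
    tensAut (labelAut a fun i : Fin n => z (Fin.castAdd m i))
      (labelAut a fun i : Fin m => z (Fin.natAdd n i)) := by
  induction m with
  | zero => exact (tensAut_zero_right _).symm
  | succ m ih =>
    have e := ih fun i => z i.castSucc
    refine (labelAut_succ (n := n + m) a z).trans ?_
    rw [e, labelAut_succ, tensAut_assoc]
    exact (castAut_rfl rfl _).symm

/-- The action of `n` labels on a tensor power, as a homomorphism. -/
def labelRep (n : ℕ) : (Fin n → G) →* Aut (pow M n) where
  toFun := labelAut a
  map_one' := labelAut_one a
  map_mul' := labelAut_mul a

theorem labelAut_one_label (x : Fin 1 → G) : labelAut a x = a (x 0) := by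
  change tensAut (1 : Aut (pow M 0)) (a (x 0)) = _
  rw [tensAut_zero_left]
  exact castAut_rfl rfl _

theorem labelAut_placeLabel_left (x : Fin n → G) :
    labelAut a (Wreath.placeLabel 0 (n + m) x) = tensAut (labelAut a x) 1 := by
  rw [labelAut_add]
  congr 1
  · refine congrArg _ (funext fun i => ?_)
    rw [Wreath.placeLabel_in _ _ _ (by omega) (by simp)]
    rfl
  · rw [← labelAut_one a]
    refine congrArg _ (funext fun i => ?_)
    rw [Wreath.placeLabel_out _ _ _ (by simp)]
    rfl

theorem labelAut_placeLabel_right (x : Fin m → G) :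
    labelAut a (Wreath.placeLabel n (n + m) x) = tensAut 1 (labelAut a x) := by
  rw [labelAut_add]
  congr 1
  · rw [← labelAut_one a]
    refine congrArg _ (funext fun i => ?_)
    rw [Wreath.placeLabel_out _ _ _ (by simp)]
    rfl
  · refine congrArg _ (funext fun i => ?_)
    rw [Wreath.placeLabel_in _ _ _ (by simp) (by simp)]
    exact congrArg x (Fin.ext (by simp))

/-- A monoid endomorphism commutes with iterated multiplication when applied to all factors at once.
Equal labels on all factors are what cabling a labelled ribbon produces. -/
theorem multi_comp_labelAut (S : PowMon M) (g : G) (h1 : S.one ≫ (a g).hom = S.one)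
    (h2 : S.mul ≫ (a g).hom = tens (a g).hom (a g).hom ≫ S.mul) (n : ℕ) :
    S.multi n ≫ (a g).hom = (labelAut a fun _ : Fin n => g).hom ≫ S.multi n := by
  induction n with
  | zero => exact h1.trans (Category.id_comp _).symm
  | succ n ih =>
    change _ = tens (labelAut a fun _ : Fin n => g).hom (a g).hom ≫ _
    rw [PowMon.multi_succ, Category.assoc, h2, tens_comp_assoc, tens_comp_assoc, ih,
      Category.id_comp, Category.comp_id]

theorem brAut_mul_tensAut [BraidedCategory B] (f g : Aut (pow M n)) :
    brAut M n n * tensAut f g = tensAut g f * brAut M n n := by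
  ext
  simp only [mul_hom, brAut_hom, tensAut_hom, pcast_rfl, Category.comp_id, tens_br]

variable [BraidedCategory B] [BalancedCategory B] {J : ℕ → Type*} [∀ n, Group (J n)]
  [CrossedFamily J]

open CrossedFamily

/-- This is the relation that lets the action of `J n` and the factorwise action of `G^n` combine to
one of the semidirect product. It holds on a subgroup closed under block sums, so the twist and the
crossing suffice, and there it is naturality. -/
theorem BlockRep.rep_mul_labelAut (R : BlockRep M J) (hJ : IsGeneratedBy (∅ : Set (J 1)))
    (j : J n) (x : Fin n → G) :
    R.rep n j * labelAut a x = labelAut a (labelAct G J n j x) * R.rep n j := by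
  let T (n : ℕ) : Subgroup (J n) :=
    { carrier := {j | ∀ x : Fin n → G,
        R.rep n j * labelAut a x = labelAut a (labelAct G J n j x) * R.rep n j}
      one_mem' := fun x => by
        rw [map_one, map_one, one_mul, mul_one]; rfl
      mul_mem' := fun {j k} hj hk x => by
        rw [map_mul, mul_assoc, hk, ← mul_assoc, hj, mul_assoc, map_mul]; rfl
      inv_mem' := fun {j} hj x => by
        have e := hj (labelAct G J n j⁻¹ x)
        rw [← MulAut.mul_apply, ← map_mul, mul_inv_cancel, map_one, MulAut.one_apply] at e
        rw [map_inv, inv_mul_eq_iff_eq_mul, ← mul_assoc, e, mul_inv_cancel_right] }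
  suffices H : ∀ n j, j ∈ T n from H n j x
  refine hJ T (Set.empty_subset _) ?_ ?_ ?_ ?_
  · intro x
    -- The twist has trivial underlying permutation and leaves the label in place.
    have : labelAct G J 1 (CrossedFamily.twist 1) x = x := by
      funext i
      rw [labelAct_apply, perm_twist]; rfl
    rw [this, R.twist]
    exact Iso.ext (tw_natural _)
  · intro x
    -- The crossing exchanges the two labels, as the braiding exchanges the two automorphisms in
    -- `brAut_mul_tensAut`.
    have h1 : labelAut a (fun i : Fin 1 => labelAct G J (1 + 1) (CrossedFamily.braid 1 1) x
        (Fin.castAdd 1 i)) = labelAut a fun i : Fin 1 => x (Fin.natAdd 1 i) := by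
      refine congrArg _ (funext fun i => ?_)
      rw [labelAct_apply]
      refine congrArg x ?_
      rw [Equiv.Perm.inv_eq_iff_eq]
      ext
      rw [perm_braid]
      simp
    have h2 : labelAut a (fun i : Fin 1 => labelAct G J (1 + 1) (CrossedFamily.braid 1 1) x
        (Fin.natAdd 1 i)) = labelAut a fun i : Fin 1 => x (Fin.castAdd 1 i) := by
      refine congrArg _ (funext fun i => ?_)
      rw [labelAct_apply]
      refine congrArg x ?_
      rw [Equiv.Perm.inv_eq_iff_eq]
      ext
      rw [perm_braid]
      simp
    rw [labelAut_add, labelAut_add a (labelAct G J (1 + 1) (CrossedFamily.braid 1 1) x), h1, h2,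
      R.braid]
    exact brAut_mul_tensAut _ _
  · intro n m j hj x
    have h1 : (fun i : Fin n => labelAct G J (n + m) (CrossedFamily.place 0 (by omega) j) x
        (Fin.castAdd m i)) = labelAct G J n j fun i => x (Fin.castAdd m i) := by
      funext i
      rw [labelAct_apply, labelAct_apply]
      refine congrArg x ?_
      rw [← map_inv, ← map_inv, ← map_inv, perm_place_left]
      ext
      rw [permTensor_left _ _ _ (by simp)]
      rfl
    have h2 : (fun i : Fin m => labelAct G J (n + m) (CrossedFamily.place 0 (by omega) j) x
        (Fin.natAdd n i)) = fun i => x (Fin.natAdd n i) := by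
      funext i
      rw [labelAct_apply]
      refine congrArg x ?_
      rw [← map_inv, ← map_inv, perm_place_left]
      ext
      rw [permTensor_right _ _ _ (by simp)]
      simp
    rw [labelAut_add, labelAut_add a (labelAct G J (n + m) _ x), h1, h2, R.place_left,
      ← tensAut_mul, ← tensAut_mul, hj, one_mul, mul_one]
  · intro n m j hj x
    have h1 : (fun i : Fin n => labelAct G J (n + m) (CrossedFamily.place n le_rfl j) x
        (Fin.castAdd m i)) = fun i => x (Fin.castAdd m i) := by
      funext i
      rw [labelAct_apply]
      refine congrArg x ?_
      rw [← map_inv, ← map_inv, perm_place_right]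
      ext
      rw [permTensor_left _ _ _ (by simp)]
      simp
    have h2 : (fun i : Fin m => labelAct G J (n + m) (CrossedFamily.place n le_rfl j) x
        (Fin.natAdd n i)) = labelAct G J m j fun i => x (Fin.natAdd n i) := by
      funext i
      rw [labelAct_apply, labelAct_apply]
      refine congrArg x ?_
      rw [← map_inv, ← map_inv, ← map_inv, perm_place_right]
      ext
      rw [permTensor_right _ _ _ (by simp)]
      simp
    rw [labelAut_add, labelAut_add a (labelAct G J (n + m) _ x), h1, h2, R.place_right,
      ← tensAut_mul, ← tensAut_mul, hj, one_mul, mul_one]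

/-- The action of labelled elements on tensor powers. -/
def BlockRep.wreathRep (R : BlockRep M J) (hJ : IsGeneratedBy (∅ : Set (J 1))) (n : ℕ) :
    Wreath G J n →* Aut (pow M n) :=
  SemidirectProduct.lift (labelRep a n) (R.rep n) fun j => by
    ext1 x
    change labelAut a (labelAct G J n j x) = R.rep n j * labelAut a x * (R.rep n j)⁻¹
    rw [R.rep_mul_labelAut a hJ, mul_inv_cancel_right]

theorem BlockRep.wreathRep_apply (R : BlockRep M J) (hJ : IsGeneratedBy (∅ : Set (J 1)))
    (j : Wreath G J n) : R.wreathRep a hJ n j = labelAut a j.left * R.rep n j.right := rfl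

/-- The action of labelled elements on tensor powers. -/
def BlockRep.wreath (R : BlockRep M J) (hJ : IsGeneratedBy (∅ : Set (J 1))) :
    BlockRep M (Wreath G J) where
  rep := R.wreathRep a hJ
  place_left n m j := by
    rw [wreathRep_apply, wreathRep_apply]
    change labelAut a (Wreath.placeLabel 0 (n + m) j.left) *
      R.rep (n + m) (CrossedFamily.place 0 _ j.right) = _
    rw [labelAut_placeLabel_left, R.place_left, ← tensAut_mul, one_mul]
  place_right n m j := by
    rw [wreathRep_apply, wreathRep_apply]
    change labelAut a (Wreath.placeLabel n (n + m) j.left) *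
      R.rep (n + m) (CrossedFamily.place n _ j.right) = _
    rw [labelAut_placeLabel_right, R.place_right, ← tensAut_mul, one_mul]
  braid n m := by
    rw [wreathRep_apply]
    change labelAut a (1 : Fin (n + m) → G) * R.rep (n + m) (CrossedFamily.braid n m) = _
    rw [labelAut_one, one_mul, R.braid]
  twist n := by
    rw [wreathRep_apply]
    change labelAut a (1 : Fin n → G) * R.rep n (CrossedFamily.twist n) = _
    rw [labelAut_one, one_mul, R.twist]

theorem BlockRep.wreath_rep_label (R : BlockRep M J) (hJ : IsGeneratedBy (∅ : Set (J 1))) (g : G) :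
    (R.wreath a hJ).rep 1 (label J g) = a g := by
  change labelAut a (fun _ : Fin 1 => g) * R.rep 1 1 = _
  rw [map_one, mul_one, labelAut_one_label]

/-- The only map to the one-element ordinal is `bang`, and cabling along it gives every strand the
label `g`, so the law reduces to `multi_comp_labelAut`. This is where `G` must act by monoid
automorphisms. -/
theorem BlockRep.exchange_label (R : BlockRep M J) (hJ : IsGeneratedBy (∅ : Set (J 1)))
    (S : PowMon M) (g : G) (h1 : S.one ≫ (a g).hom = S.one)
    (h2 : S.mul ≫ (a g).hom = tens (a g).hom (a g).hom ≫ S.mul) :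
    (R.wreath a hJ).Exchange S (label J g) := by
  intro n φ
  rw [PowMon.mulMap_bang, PowMon.mulMap_bang]
  have e2 : (R.wreath a hJ).rep n (CrossedFamily.pull φ (label J g)) =
      labelAut a fun _ : Fin n => g := by
    change labelAut a (fun _ : Fin n => g) * R.rep n (CrossedFamily.pull φ 1) = _
    rw [CrossedFamily.pull_one, map_one, mul_one]
  rw [R.wreath_rep_label, e2, multi_comp_labelAut a S g h1 h2]

end TensorPower
end RibbonPROB

namespace RibbonPROB

open MonoidalCategory

namespace TensorPower

/-! ### The algebra of tensor powers -/

section Functor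

/-- All constituents of `mu` are identities in a strict category. The equality of objects is part of
the conclusion because it is constructed along the same induction. -/
theorem mu_eq_eqToHom {B : Type u} [Category.{v} B] [MonoidalCategory B] {M : B}
    [StrictMonoidalCategory B] (n m : ℕ) :
    ∃ h : pow M n ⊗ pow M m = pow M (n + m), (mu M n m).hom = eqToHom h := by
  induction m with
  | zero => exact ⟨_, StrictMonoidalCategory.rightUnitor_hom _⟩
  | succ m ih =>
    obtain ⟨h, e⟩ := ih
    have e1 : (α_ (pow M n) (pow M m) M).inv =
        eqToHom (StrictMonoidalCategory.tensor_assoc (pow M n) (pow M m) M).symm := by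
      rw [← cancel_epi (α_ (pow M n) (pow M m) M).hom, Iso.hom_inv_id,
        StrictMonoidalCategory.associator_hom, eqToHom_trans, eqToHom_refl]
    refine ⟨(StrictMonoidalCategory.tensor_assoc (pow M n) (pow M m) M).symm.trans
      (congrArg (· ⊗ M) h), ?_⟩
    rw [mu_succ, e, e1, eqToHom_whiskerRight, eqToHom_trans]

variable {B : Type u} [Category.{v} B] [MonoidalCategory B] [BraidedCategory B]
  [BalancedCategory B] {M : B} {J : ℕ → Type*} [∀ n, Group (J n)] [CrossedFamily J]
  (R : BlockRep M J) (S : PowMon M) (hRS : ∀ {m : ℕ} (j : J m), R.Exchange S j)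

/-- The functor on `D ⊗ J` that sends `n` to the `n`-th tensor power of a monoid. -/
def powFunctor : DTensor J ⥤ B where
  obj X := pow M X.card
  map {X Y} f := (R.rep X.card f.elt).hom ≫ S.mulMap f.map
  map_id X := by
    rw [DTensor.id_elt, map_one, one_hom, DTensor.id_map, Category.id_comp, PowMon.mulMap_id]
  map_comp {X Y Z} f g := by
    rw [DTensor.comp_elt, DTensor.comp_map, map_mul, mul_hom, PowMon.mulMap_comp]
    simp only [Category.assoc]
    -- The exchange law moves the group element of `g` past the multiplication of `f`; this is
    -- exactly the composition rule of `D ⊗ J`.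
    rw [reassoc_of% (hRS g.elt X.card f.map)]

theorem powFunctor_map {X Y : DTensor J} (f : X ⟶ Y) :
    (powFunctor R S hRS).map f = (R.rep X.card f.elt).hom ≫ S.mulMap f.map := rfl

theorem powFunctor_map_isoHom {X Y : DTensor J} (h : X.card = Y.card) (j : J X.card) :
    (powFunctor R S hRS).map (DTensor.isoHom h j) = (R.rep X.card j).hom ≫ pcast M h := by
  rw [powFunctor_map]
  dsimp only [DTensor.isoHom]
  rw [PowMon.mulMap_ordCast]

theorem powFunctor_map_isoHom_one {X Y : DTensor J} (h : X.card = Y.card) :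
    (powFunctor R S hRS).map (DTensor.isoHom h 1) = pcast M h := by
  rw [powFunctor_map_isoHom, map_one]
  exact Category.id_comp _

theorem powFunctor_map_tensor {X Y X' Y' : DTensor J} (f : X ⟶ Y) (g : X' ⟶ Y') :
    (powFunctor R S hRS).map (f ⊗ₘ g) =
      tens ((powFunctor R S hRS).map f) ((powFunctor R S hRS).map g) := by
  rw [powFunctor_map, DTensor.tensorHom_elt, DTensor.tensorHom_map]
  change (R.rep (X.card + X'.card) _).hom ≫ _ = _
  rw [map_mul, R.place_left, R.place_right, ← tensAut_mul, one_mul, mul_one, tensAut_hom,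
    PowMon.mulMap_ordTensor]
  exact tens_comp ..

/-- The tensor structure of the functor of tensor powers. -/
def powCoreMonoidal : (powFunctor R S hRS).CoreMonoidal where
  εIso := Iso.refl _
  μIso X Y := mu M X.card Y.card
  μIso_hom_natural_left {X Y} f X' := by
    rw [DTensor.whiskerRight_eq, powFunctor_map_tensor, CategoryTheory.Functor.map_id]
    exact ((mu_tens ..).trans (congrArg (· ≫ _) (tensorHom_id ..))).symm
  μIso_hom_natural_right {X Y} X' f := by
    rw [DTensor.whiskerLeft_eq, powFunctor_map_tensor, CategoryTheory.Functor.map_id]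
    exact ((mu_tens ..).trans (congrArg (· ≫ _) (id_tensorHom ..))).symm
  associativity X Y Z := by
    rw [DTensor.associator_hom, powFunctor_map_isoHom_one]
    exact mu_assoc M X.card Y.card Z.card
  left_unitality X := by
    rw [DTensor.leftUnitor_hom, powFunctor_map_isoHom_one]
    have h : (λ_ (pow M X.card)).hom = 𝟙 (pow M 0) ▷ pow M X.card ≫ (mu M 0 X.card).hom ≫
        pcast M (Nat.zero_add X.card) := by
      rw [mu_zero_left, id_whiskerRight, Category.id_comp, Category.assoc, pcast_comp, pcast_rfl,
        Category.comp_id]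
    exact h
  right_unitality X := by
    rw [DTensor.rightUnitor_hom, powFunctor_map_isoHom_one]
    have h : (ρ_ (pow M X.card)).hom = pow M X.card ◁ 𝟙 (pow M 0) ≫ (mu M X.card 0).hom ≫
        pcast M (Nat.add_zero X.card) := by
      rw [mu_zero, whiskerLeft_id, Category.id_comp]
      exact (Category.comp_id _).symm
    exact h

/-- The algebra of `D ⊗ J` given by a monoid with compatible actions on its tensor powers. -/
def powAlgebra : BalancedAlgebra (DTensor J) B where
  functor := powFunctor R S hRS
  braided :=
    { toMonoidal := (powCoreMonoidal R S hRS).toMonoidal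
      braided := fun X Y => by
        change (mu M X.card Y.card).hom ≫ (powFunctor R S hRS).map (DTensor.isoHom _ _) = _
        rw [powFunctor_map_isoHom]
        have h : (mu M X.card Y.card).hom ≫ (R.rep (X.card + Y.card)
            (CrossedFamily.braid X.card Y.card)).hom ≫ pcast M (Nat.add_comm X.card Y.card) =
            (β_ (pow M X.card) (pow M Y.card)).hom ≫ (mu M Y.card X.card).hom := by
          rw [R.braid, brAut_hom, Category.assoc, mu_br_assoc, pcast_comp, pcast_rfl,
            Category.comp_id]
        exact h }
  map_twist X := by
    change (powFunctor R S hRS).map (DTensor.isoHom _ _) = _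
    rw [powFunctor_map_isoHom, R.twist]
    exact Category.comp_id _

theorem powAlgebra_isStrict [StrictMonoidalCategory B] : (powAlgebra R S hRS).IsStrict where
  obj_unit := rfl
  obj_tensor X Y := (mu_eq_eqToHom X.card Y.card).choose
  ε_eq := rfl
  μ_eq X Y := (mu_eq_eqToHom X.card Y.card).choose_spec

end Functor

/-! ### From monoid objects to monoid structures on the first tensor power -/

section Monoid

variable {B : Type u} [Category.{v} B] [MonoidalCategory B] {M : B}

open MonObj

/-- A monoid structure on the first tensor power. -/
def PowMon.ofMonObj [MonObj (pow M 1)] : PowMon M where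
  mul := (mu M 1 1).inv ≫ MonObj.mul (X := pow M 1)
  one := MonObj.one (X := pow M 1)
  one_mul := by
    rw [← cancel_epi (mu M 0 1).hom, mu_tens_assoc, Iso.hom_inv_id_assoc, tensorHom_id,
      MonObj.one_mul, mu_zero_left, Category.assoc, pcast_comp, pcast_rfl]
    exact (Category.comp_id _).symm
  mul_one := by
    rw [← cancel_epi (mu M 1 0).hom, mu_tens_assoc, Iso.hom_inv_id_assoc, id_tensorHom,
      MonObj.mul_one, mu_zero]
    exact (Category.comp_id _).symm
  mul_assoc := by
    have e := mu_assoc M 1 1 1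
    rw [← cancel_epi (mu M (1 + 1) 1).hom, ← cancel_epi ((mu M 1 1).hom ▷ pow M 1), mu_tens_assoc,
      Iso.hom_inv_id_assoc, tensorHom_id, ← comp_whiskerRight_assoc, Iso.hom_inv_id_assoc,
      MonObj.mul_assoc, reassoc_of% e, mu_tens_assoc, Iso.hom_inv_id_assoc, id_tensorHom,
      ← whiskerLeft_comp_assoc, Iso.hom_inv_id_assoc]

end Monoid

end TensorPower
end RibbonPROB

namespace RibbonPROB

open MonoidalCategory

/-! ### Generating morphisms and the generating monoid of `D ⊗ J` -/

namespace DTensor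

variable {J : ℕ → Type u} [∀ n, Group (J n)] [CrossedFamily J] {n m : ℕ}

/-- The morphism given by an order-preserving map. -/
def ordHom {X Y : DTensor J} (φ : Fin X.card →o Fin Y.card) : X ⟶ Y := ⟨φ, 1⟩

/-- The endomorphism given by a group element. -/
def eltHom (j : J n) : (⟨n⟩ : DTensor J) ⟶ ⟨n⟩ := isoHom rfl j

theorem eltHom_one : eltHom (1 : J n) = 𝟙 _ := rfl

theorem eltHom_mul (j k : J n) : eltHom (j * k) = eltHom k ≫ eltHom j := by
  rw [eltHom, eltHom, eltHom, isoHom_comp, CrossedFamily.place_self]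

/-- The factorization built into the category: it separates naturality for group elements from
naturality for order-preserving maps. -/
theorem eltHom_comp_ordHom {X Y : DTensor J} (f : X ⟶ Y) : eltHom f.elt ≫ ordHom f.map = f := by
  refine (isoHom_comp_hom _ _ _).trans (hom_ext rfl ?_)
  change CrossedFamily.place 0 _ 1 * f.elt = f.elt
  rw [map_one, one_mul]

theorem ordHom_comp {X Y Z : DTensor J} (φ : Fin X.card →o Fin Y.card)
    (ψ : Fin Y.card →o Fin Z.card) : (ordHom (ψ.comp φ) : X ⟶ Z) = (ordHom φ : X ⟶ Y) ≫ ordHom ψ := by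
  refine hom_ext ?_ ?_
  · rw [comp_map]
    change _ = ψ.comp (permAct (CrossedFamily.perm 1) φ)
    rw [map_one, permAct_one]; rfl
  · rw [comp_elt]
    change 1 = CrossedFamily.pull φ 1 * 1
    rw [CrossedFamily.pull_one, mul_one]

theorem ordHom_tensor {X Y X' Y' : DTensor J} (φ : Fin X.card →o Fin Y.card)
    (ψ : Fin X'.card →o Fin Y'.card) :
    (ordHom (X := X ⊗ X') (Y := Y ⊗ Y') (ordTensor φ ψ)) = ordHom φ ⊗ₘ ordHom ψ := by
  refine hom_ext rfl ?_
  rw [tensorHom_elt]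
  change 1 = CrossedFamily.place 0 _ 1 * CrossedFamily.place _ _ 1
  rw [map_one, map_one, one_mul]

theorem eltHom_place_left (j : J n) :
    eltHom (CrossedFamily.place (N := n + m) 0 (by omega) j) =
      eltHom j ⊗ₘ 𝟙 (⟨m⟩ : DTensor J) := by
  rw [isoHom_id, eltHom, eltHom, tensorHom_iso, map_one, mul_one]

theorem eltHom_place_right (j : J m) :
    eltHom (CrossedFamily.place (N := n + m) n le_rfl j) =
      𝟙 (⟨n⟩ : DTensor J) ⊗ₘ eltHom j := by
  rw [isoHom_id, eltHom, eltHom, tensorHom_iso, map_one, one_mul]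

/-- The one-element ordinal is terminal, so only the group components have to be compared. -/
theorem hom_one_ext {X : DTensor J} {f g : X ⟶ (⟨1⟩ : DTensor J)} (h : f.elt = g.elt) : f = g :=
  hom_ext ((eq_bang _).trans (eq_bang _).symm) h

variable (J) in
/-- The generating monoid of `D ⊗ J`. -/
@[reducible] def pt : DTensor J := ⟨1⟩

/-- All morphisms involved have trivial group component and cabling preserves 1, so each axiom
becomes the equality `1 = 1` in `J`. -/
instance : MonObj (pt J) where
  one := ordHom (X := 𝟙_ (DTensor J)) (bang 0)
  mul := ordHom (X := pt J ⊗ pt J) (bang (1 + 1))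
  one_mul := hom_one_ext (by
    rw [whiskerRight_eq, comp_elt, tensorHom_elt]
    change CrossedFamily.pull _ 1 * (CrossedFamily.place 0 _ 1 * CrossedFamily.place _ _ 1) = 1
    rw [CrossedFamily.pull_one, map_one, map_one, one_mul, one_mul])
  mul_one := hom_one_ext (by
    rw [whiskerLeft_eq, comp_elt, tensorHom_elt]
    change CrossedFamily.pull _ 1 * (CrossedFamily.place 0 _ 1 * CrossedFamily.place _ _ 1) = 1
    rw [CrossedFamily.pull_one, map_one, map_one, one_mul, one_mul])
  mul_assoc := hom_one_ext (by
    rw [whiskerLeft_eq, whiskerRight_eq, comp_elt, comp_elt, comp_elt, tensorHom_elt, tensorHom_elt]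
    change CrossedFamily.pull _ 1 * (CrossedFamily.place 0 _ 1 * CrossedFamily.place _ _ 1) =
      CrossedFamily.pull _ (CrossedFamily.pull _ 1 *
        (CrossedFamily.place 0 _ 1 * CrossedFamily.place _ _ 1)) * 1
    simp only [CrossedFamily.pull_one, map_one, one_mul])

theorem pt_mul : (MonObj.mul : pt J ⊗ pt J ⟶ pt J) = ordHom (X := pt J ⊗ pt J) (bang (1 + 1)) := rfl

end DTensor

/-! ### Extending a morphism on the generator to a monoidal transformation -/

section Extension

open Functor.LaxMonoidal Functor.OplaxMonoidal DTensor

variable {B : Type u} [Category.{v} B] [MonoidalCategory B] {J : ℕ → Type w} [∀ n, Group (J n)]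
  [CrossedFamily J]

section Components

variable {F F' : DTensor J ⥤ B} [F.Monoidal] [F'.Monoidal] (f : F.obj (pt J) ⟶ F'.obj (pt J))

/-- The components of the monoidal transformation extending a morphism on the generator. -/
def extComp : ∀ n : ℕ, F.obj ⟨n⟩ ⟶ F'.obj ⟨n⟩
  | 0 => η F ≫ ε F'
  | n + 1 => δ F ⟨n⟩ (pt J) ≫ (extComp n ⊗ₘ f) ≫ μ F' ⟨n⟩ (pt J)

theorem ε_extComp : ε F ≫ extComp f 0 = ε F' := by
  rw [extComp]; exact Functor.Monoidal.ε_η_assoc F _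

theorem μ_extComp_one (n : ℕ) : μ F ⟨n⟩ (pt J) ≫ extComp f (n + 1) =
    (extComp f n ⊗ₘ f) ≫ μ F' ⟨n⟩ (pt J) := by
  rw [extComp]; exact Functor.Monoidal.μ_δ_assoc F _ _ _

/-- By construction `extComp f 1` is the tensor product of the unit component with `f`, read through
the structure maps; left unitality of both functors and naturality of the left unitor reduce it to
`f`. -/
theorem extComp_one : extComp f 1 = f := by
  -- The left unitor of the generator is an identity morphism, since `0 + 1` reduces to `1`; so it
  -- drops out of the unitality axiom.
  have h (H : DTensor J ⥤ B) [H.Monoidal] : (λ_ (H.obj (pt J))).hom =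
      ε H ▷ H.obj (pt J) ≫ μ H (𝟙_ (DTensor J)) (pt J) := by
    have e := Functor.LaxMonoidal.left_unitality H (pt J)
    rw [e]
    have : H.map (λ_ (pt J)).hom = 𝟙 (H.obj (pt J)) := H.map_id (pt J)
    rw [this]
    exact congrArg (_ ≫ ·) (Category.comp_id _)
  have e := μ_extComp_one f 0
  have e1 : ε F ▷ F.obj (pt J) ≫ μ F (𝟙_ (DTensor J)) (pt J) ≫ extComp f 1 =
      ε F ▷ F.obj (pt J) ≫ (extComp f 0 ⊗ₘ f) ≫ μ F' (𝟙_ (DTensor J)) (pt J) :=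
    congrArg (ε F ▷ F.obj (pt J) ≫ ·) e
  have e2 : ε F ▷ F.obj (pt J) ≫ (extComp f 0 ⊗ₘ f) = 𝟙_ B ◁ f ≫ ε F' ▷ F'.obj (pt J) := by
    rw [← tensorHom_id, tensorHom_comp_tensorHom, ε_extComp, Category.id_comp, tensorHom_def']
  rw [reassoc_of% e2, ← h F', ← Category.assoc, ← h F] at e1
  exact (cancel_epi _).1 (e1.trans (leftUnitor_naturality f))

/-- The components are defined by adding one generator at a time. Compatibility with arbitrary
tensor products follows by induction on `m` from associativity of the structure maps, the associator
in `D ⊗ J` being a definitional identity here. -/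
theorem μ_extComp (n m : ℕ) : μ F ⟨n⟩ ⟨m⟩ ≫ extComp f (n + m) =
    (extComp f n ⊗ₘ extComp f m) ≫ μ F' ⟨n⟩ ⟨m⟩ := by
  induction m with
  | zero =>
    have h (H : DTensor J ⥤ B) [H.Monoidal] : (ρ_ (H.obj ⟨n⟩)).hom =
        H.obj ⟨n⟩ ◁ ε H ≫ μ H ⟨n⟩ (𝟙_ (DTensor J)) := by
      have e := Functor.LaxMonoidal.right_unitality H ⟨n⟩
      rw [e]
      have : H.map (ρ_ (⟨n⟩ : DTensor J)).hom = 𝟙 (H.obj ⟨n⟩) := H.map_id _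
      rw [this]
      exact congrArg (_ ≫ ·) (Category.comp_id _)
    have e1 : F.obj ⟨n⟩ ◁ ε F ≫ μ F ⟨n⟩ (𝟙_ (DTensor J)) ≫ extComp f n =
        F.obj ⟨n⟩ ◁ ε F ≫ (extComp f n ⊗ₘ extComp f 0) ≫ μ F' ⟨n⟩ (𝟙_ (DTensor J)) := by
      have e2 : F.obj ⟨n⟩ ◁ ε F ≫ (extComp f n ⊗ₘ extComp f 0) =
          extComp f n ▷ 𝟙_ B ≫ F'.obj ⟨n⟩ ◁ ε F' := by
        rw [← id_tensorHom, tensorHom_comp_tensorHom, ε_extComp, Category.id_comp,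
          MonoidalCategory.tensorHom_def]
      rw [reassoc_of% e2, ← h F', ← Category.assoc, ← h F]
      exact (rightUnitor_naturality _).symm
    exact (cancel_epi _).1 e1
  | succ m ih =>
    have h (H : DTensor J ⥤ B) [H.Monoidal] : μ H ⟨n⟩ ⟨m⟩ ▷ H.obj (pt J) ≫ μ H ⟨n + m⟩ (pt J) =
        (α_ (H.obj ⟨n⟩) (H.obj ⟨m⟩) (H.obj (pt J))).hom ≫ H.obj ⟨n⟩ ◁ μ H ⟨m⟩ (pt J) ≫
          μ H ⟨n⟩ ⟨m + 1⟩ := by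
      have e := Functor.LaxMonoidal.associativity H ⟨n⟩ ⟨m⟩ (pt J)
      have : H.map (α_ ⟨n⟩ ⟨m⟩ (pt J)).hom = 𝟙 (H.obj ⟨n + m + 1⟩) := H.map_id _
      rw [this] at e
      refine Eq.trans ?_ e
      exact congrArg (_ ≫ ·) (Category.comp_id _).symm
    have e1 : (α_ (F.obj ⟨n⟩) (F.obj ⟨m⟩) (F.obj (pt J))).hom ≫ F.obj ⟨n⟩ ◁ μ F ⟨m⟩ (pt J) ≫
          μ F ⟨n⟩ ⟨m + 1⟩ ≫ extComp f (n + m + 1) =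
        (α_ (F.obj ⟨n⟩) (F.obj ⟨m⟩) (F.obj (pt J))).hom ≫ F.obj ⟨n⟩ ◁ μ F ⟨m⟩ (pt J) ≫
          (extComp f n ⊗ₘ extComp f (m + 1)) ≫ μ F' ⟨n⟩ ⟨m + 1⟩ := by
      rw [← reassoc_of% (h F), μ_extComp_one f (n + m), ← tensorHom_id,
        tensorHom_comp_tensorHom_assoc, ih, Category.id_comp, ← id_tensorHom,
        tensorHom_comp_tensorHom_assoc, μ_extComp_one f m, Category.id_comp]
      have e2 : ((extComp f n ⊗ₘ extComp f m) ≫ μ F' ⟨n⟩ ⟨m⟩) ⊗ₘ f =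
          ((extComp f n ⊗ₘ extComp f m) ⊗ₘ f) ≫ μ F' ⟨n⟩ ⟨m⟩ ▷ F'.obj (pt J) := by
        rw [← tensorHom_id, tensorHom_comp_tensorHom, Category.comp_id]
      have e3 : extComp f n ⊗ₘ ((extComp f m ⊗ₘ f) ≫ μ F' ⟨m⟩ (pt J)) =
          (extComp f n ⊗ₘ (extComp f m ⊗ₘ f)) ≫ F'.obj ⟨n⟩ ◁ μ F' ⟨m⟩ (pt J) := by
        rw [← id_tensorHom, tensorHom_comp_tensorHom, Category.comp_id]
      rw [e2, e3, Category.assoc, Category.assoc, h F', associator_naturality_assoc]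
    exact (cancel_epi _).1 ((cancel_epi _).1 e1)

/-- A monoidal transformation is determined by its component on the generator. -/
theorem app_eq_extComp (τ : F ⟶ F') [NatTrans.IsMonoidal τ] (n : ℕ) :
    τ.app ⟨n⟩ = extComp (τ.app (pt J)) n := by
  induction n with
  | zero =>
    have e := NatTrans.IsMonoidal.unit (τ := τ)
    rw [← ε_extComp (τ.app (pt J))] at e
    exact (cancel_epi _).1 e
  | succ n ih =>
    have e := NatTrans.IsMonoidal.tensor (τ := τ) ⟨n⟩ (pt J)
    rw [ih, ← μ_extComp_one] at e
    exact (cancel_epi _).1 e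

end Components

section Naturality

variable [BraidedCategory B] [BalancedCategory B] {F F' : BalancedAlgebra (DTensor J) B}
  (f : F.functor.obj (pt J) ⟶ F'.functor.obj (pt J))

/-- The components extending `f` are natural with respect to `g`. -/
def ExtNat {X Y : DTensor J} (g : X ⟶ Y) : Prop :=
  F.functor.map g ≫ extComp f Y.card = extComp f X.card ≫ F'.functor.map g

variable {f}

theorem ExtNat.id (X : DTensor J) : ExtNat f (𝟙 X) := by
  unfold ExtNat
  rw [F.functor.map_id, F'.functor.map_id]
  exact (Category.id_comp _).trans (Category.comp_id _).symm

theorem ExtNat.comp {X Y Z : DTensor J} {g : X ⟶ Y} {h : Y ⟶ Z} (hg : ExtNat f g)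
    (hh : ExtNat f h) : ExtNat f (g ≫ h) := by
  unfold ExtNat at *
  rw [F.functor.map_comp, F'.functor.map_comp, Category.assoc, hh, reassoc_of% hg]

/-- An inverse of a natural morphism is natural: the square for `g` is composed with `h` on both
sides. Needed because the generation statements speak of subgroups. -/
theorem ExtNat.of_comp_eq_id {X Y : DTensor J} {g : X ⟶ Y} {h : Y ⟶ X} (hg : ExtNat f g)
    (e1 : g ≫ h = 𝟙 X) (e2 : h ≫ g = 𝟙 Y) : ExtNat f h := by
  unfold ExtNat at *
  have h1 : F.functor.map h ≫ F.functor.map g = 𝟙 _ := by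
    rw [← F.functor.map_comp, e2, F.functor.map_id]
  have h2 : F'.functor.map g ≫ F'.functor.map h = 𝟙 _ := by
    rw [← F'.functor.map_comp, e1, F'.functor.map_id]
  have e := congrArg (fun k => F.functor.map h ≫ k ≫ F'.functor.map h) hg
  simp only [Category.assoc, reassoc_of% h1] at e
  rw [h2] at e
  exact (congrArg (_ ≫ ·) (Category.comp_id _)).symm.trans e.symm

theorem ExtNat.tensor {X Y X' Y' : DTensor J} {g : X ⟶ Y} {h : X' ⟶ Y'} (hg : ExtNat f g)
    (hh : ExtNat f h) : ExtNat f (g ⊗ₘ h) := by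
  unfold ExtNat at *
  have e : μ F.functor X X' ≫ F.functor.map (g ⊗ₘ h) ≫ extComp f (Y.card + Y'.card) =
      μ F.functor X X' ≫ extComp f (X.card + X'.card) ≫ F'.functor.map (g ⊗ₘ h) := by
    rw [← Functor.LaxMonoidal.μ_natural_assoc]
    have e1 : μ F.functor Y Y' ≫ extComp f (Y.card + Y'.card) = _ := μ_extComp f Y.card Y'.card
    have e2 : μ F.functor X X' ≫ extComp f (X.card + X'.card) = _ := μ_extComp f X.card X'.card
    rw [e1, reassoc_of% e2, tensorHom_comp_tensorHom_assoc, hg, hh]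
    change _ = _ ≫ μ F'.functor X X' ≫ _
    rw [← Functor.LaxMonoidal.μ_natural, tensorHom_comp_tensorHom_assoc]
  exact (cancel_epi _).1 e

/-- No condition on `f` is needed: both functors preserve the braiding, and the braiding of `B` is
natural. `ExtNat.twist` holds for the same reason. -/
theorem ExtNat.braiding (X Y : DTensor J) : ExtNat f (β_ X Y).hom := by
  unfold ExtNat
  have e : μ F.functor X Y ≫ F.functor.map (β_ X Y).hom ≫ extComp f (Y.card + X.card) =
      μ F.functor X Y ≫ extComp f (X.card + Y.card) ≫ F'.functor.map (β_ X Y).hom := by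
    rw [Functor.LaxBraided.braided_assoc]
    have e1 : μ F.functor Y X ≫ extComp f (Y.card + X.card) = _ := μ_extComp f Y.card X.card
    have e2 : μ F.functor X Y ≫ extComp f (X.card + Y.card) = _ := μ_extComp f X.card Y.card
    rw [e1, reassoc_of% e2]
    change _ = _ ≫ μ F'.functor X Y ≫ _
    rw [Functor.LaxBraided.braided, BraidedCategory.braiding_naturality_assoc]
  exact (cancel_epi _).1 e

theorem ExtNat.twist (X : DTensor J) : ExtNat f (BalancedCategory.twist X).hom := by
  unfold ExtNat
  rw [F.map_twist, F'.map_twist]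
  exact (BalancedCategory.twist_naturality _).symm

/-- Naturality defines subgroups closed under block sums that contain the crossing and the twist, so
only the extra generators in `A` impose a condition. -/
theorem ExtNat.eltHom {A : Set (J 1)} (hA : CrossedFamily.IsGeneratedBy A)
    (h : ∀ a ∈ A, ExtNat f (DTensor.eltHom a)) {n : ℕ} (j : J n) : ExtNat f (DTensor.eltHom j) := by
  let S (n : ℕ) : Subgroup (J n) :=
    { carrier := {j | ExtNat f (DTensor.eltHom j)}
      one_mem' := ExtNat.id _
      mul_mem' := fun {j k} hj hk => by
        change ExtNat f _
        rw [eltHom_mul]; exact hk.comp hj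
      inv_mem' := fun {j} hj => ExtNat.of_comp_eq_id hj
        (by rw [← eltHom_mul, inv_mul_cancel, eltHom_one])
        (by rw [← eltHom_mul, mul_inv_cancel, eltHom_one]) }
  refine hA S h (ExtNat.twist (pt J)) (ExtNat.braiding (pt J) (pt J)) (fun n m j hj => ?_)
    (fun n m j hj => ?_) n j
  · change ExtNat f _
    rw [eltHom_place_left]; exact ExtNat.tensor hj (ExtNat.id _)
  · change ExtNat f _
    rw [eltHom_place_right]; exact ExtNat.tensor (ExtNat.id _) hj

/-- An order-preserving map is the ordinal sum of its maps from fibres to points, and each of these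
is an iterated multiplication starting from the unit. -/
theorem ExtNat.ordHom (h1 : ExtNat f (MonObj.one : 𝟙_ (DTensor J) ⟶ pt J))
    (h2 : ExtNat f (MonObj.mul : pt J ⊗ pt J ⟶ pt J)) {n m : ℕ} (φ : Fin n →o Fin m) :
    ExtNat f (DTensor.ordHom (X := ⟨n⟩) (Y := ⟨m⟩) φ) := by
  have hb : ∀ b, ExtNat f (DTensor.ordHom (X := ⟨b⟩) (Y := pt J) (bang b)) := by
    intro b
    induction b with
    | zero => exact h1
    | succ b ih =>
      have e : DTensor.ordHom (X := ⟨b + 1⟩) (Y := pt J) (bang (b + 1)) =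
          (DTensor.ordHom (X := ⟨b⟩) (Y := pt J) (bang b) ⊗ₘ 𝟙 (pt J)) ≫ MonObj.mul := by
        have e1 : 𝟙 (pt J) = DTensor.ordHom (X := pt J) OrderHom.id := rfl
        rw [pt_mul, e1, ← ordHom_tensor, ← ordHom_comp]
        exact congrArg (DTensor.ordHom (X := ⟨b + 1⟩) (Y := pt J)) (eq_bang _).symm
      rw [e]
      exact (ih.tensor (ExtNat.id _)).comp h2
  induction m generalizing n with
  | zero =>
    obtain rfl := eq_zero_of_ordHom_zero φ
    have : DTensor.ordHom (X := ⟨0⟩) (Y := ⟨0⟩) φ = 𝟙 (⟨0⟩ : DTensor J) :=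
      hom_ext (ordHom_ext_val fun x => x.elim0) rfl
    rw [this]
    exact ExtNat.id _
  | succ m ih =>
    obtain ⟨a, b, rfl, φ', χ, rfl⟩ := exists_ordTensor φ
    rw [comp_ordCast_rfl, eq_bang χ]
    have := (ih φ').tensor (hb b)
    rw [← ordHom_tensor] at this
    exact this

theorem ExtNat.of_isGeneratedBy {A : Set (J 1)} (hA : CrossedFamily.IsGeneratedBy A)
    (h : ∀ a ∈ A, ExtNat f (DTensor.eltHom a))
    (h1 : ExtNat f (MonObj.one : 𝟙_ (DTensor J) ⟶ pt J))
    (h2 : ExtNat f (MonObj.mul : pt J ⊗ pt J ⟶ pt J)) {X Y : DTensor J} (g : X ⟶ Y) :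
    ExtNat f g := by
  rw [← eltHom_comp_ordHom g]
  exact (ExtNat.eltHom hA h g.elt).comp (ExtNat.ordHom h1 h2 g.map)

/-- A monoid morphism between the generators that commutes with a generating set extends to a
morphism of algebras. -/
theorem exists_hom_of_isGeneratedBy {A : Set (J 1)} (hA : CrossedFamily.IsGeneratedBy A)
    (f : F.functor.obj (pt J) ⟶ F'.functor.obj (pt J))
    (h : ∀ a ∈ A, F.functor.map (DTensor.eltHom a) ≫ f = f ≫ F'.functor.map (DTensor.eltHom a))
    (h1 : (ε F.functor ≫ F.functor.map (MonObj.one : 𝟙_ (DTensor J) ⟶ pt J)) ≫ f =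
      ε F'.functor ≫ F'.functor.map (MonObj.one : 𝟙_ (DTensor J) ⟶ pt J))
    (h2 : (μ F.functor (pt J) (pt J) ≫ F.functor.map (MonObj.mul : pt J ⊗ pt J ⟶ pt J)) ≫ f =
      (f ⊗ₘ f) ≫ μ F'.functor (pt J) (pt J) ≫
        F'.functor.map (MonObj.mul : pt J ⊗ pt J ⟶ pt J)) :
    ∃ τ : F ⟶ F', (BalancedAlgebra.Hom.natTrans τ).app (pt J) = f := by
  have h1 : ExtNat f (MonObj.one : 𝟙_ (DTensor J) ⟶ pt J) := by
    have e : ε F.functor ≫ F.functor.map (MonObj.one : 𝟙_ (DTensor J) ⟶ pt J) ≫ extComp f 1 =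
        ε F.functor ≫ extComp f 0 ≫ F'.functor.map (MonObj.one : 𝟙_ (DTensor J) ⟶ pt J) := by
      rw [extComp_one, reassoc_of% (ε_extComp f), ← h1, Category.assoc]
    exact (cancel_epi _).1 e
  have h2 : ExtNat f (MonObj.mul : pt J ⊗ pt J ⟶ pt J) := by
    have e1 : μ F.functor (pt J) (pt J) ≫ extComp f (1 + 1) =
        (f ⊗ₘ f) ≫ μ F'.functor (pt J) (pt J) := by
      rw [μ_extComp_one, extComp_one]
    have e : μ F.functor (pt J) (pt J) ≫ F.functor.map (MonObj.mul : pt J ⊗ pt J ⟶ pt J) ≫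
          extComp f 1 =
        μ F.functor (pt J) (pt J) ≫ extComp f (1 + 1) ≫
          F'.functor.map (MonObj.mul : pt J ⊗ pt J ⟶ pt J) := by
      rw [extComp_one, reassoc_of% e1, ← h2, Category.assoc]
    exact (cancel_epi _).1 e
  have h3 : ∀ a ∈ A, ExtNat f (DTensor.eltHom a) := fun a ha => by
    have e : F.functor.map (DTensor.eltHom a) ≫ extComp f 1 =
        extComp f 1 ≫ F'.functor.map (DTensor.eltHom a) := by rw [extComp_one, h a ha]
    exact e
  let τ : F.functor ⟶ F'.functor :=
    { app := fun X => extComp f X.card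
      naturality := fun _ _ g => ExtNat.of_isGeneratedBy hA h3 h1 h2 g }
  have : NatTrans.IsMonoidal τ :=
    { unit := ε_extComp f
      tensor := fun X Y => μ_extComp f X.card Y.card }
  exact ⟨⟨τ⟩, extComp_one f⟩

theorem hom_ext_of_app_pt {τ τ' : F ⟶ F'}
    (h : (BalancedAlgebra.Hom.natTrans τ).app (pt J) = (BalancedAlgebra.Hom.natTrans τ').app (pt J)) :
    τ = τ' := by
  refine BalancedAlgebra.Hom.ext (NatTrans.ext (funext fun X => ?_))
  refine (app_eq_extComp _ X.card).trans ?_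
  rw [h]
  exact (app_eq_extComp _ X.card).symm

end Naturality

end Extension
end RibbonPROB

namespace RibbonPROB

open MonoidalCategory DTensor CrossedFamily

/-! ### Evaluation at the generator: monoids -/

section Evaluation

variable {B : Type u} [Category.{v} B] [MonoidalCategory B] [BraidedCategory B]
  [BalancedCategory B] {J : ℕ → Type*} [∀ n, Group (J n)] [CrossedFamily J]

variable (J B) in
/-- The functor that sends an algebra to its underlying monoid. -/
def monFunctor : BalancedAlgebra (DTensor J) B ⥤ Mon B where
  obj F := F.functor.mapMon.obj (.mk (pt J))
  map τ := (Functor.mapMonNatTrans (BalancedAlgebra.Hom.natTrans τ)).app (.mk (pt J))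
  map_id _ := rfl
  map_comp _ _ := rfl

/-- No generation hypothesis is needed: the component at the generator determines the others through
the monoidal structure alone. -/
instance : (monFunctor B J).Faithful where
  map_injective h := hom_ext_of_app_pt (congrArg Mon.Hom.hom h)

/-- With no generators beyond crossing and twist, being a monoid morphism is the only condition for
the extension. -/
theorem monFunctor_full (hJ : IsGeneratedBy (∅ : Set (J 1))) : (monFunctor B J).Full where
  map_surjective {F F'} f := by
    obtain ⟨τ, hτ⟩ := exists_hom_of_isGeneratedBy hJ f.hom (fun _ h => h.elim)
      (IsMonHom.one_hom f.hom) (IsMonHom.mul_hom f.hom)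
    exact ⟨τ, Mon.Hom.ext hτ⟩

end Evaluation

/-! ### Evaluation at the generator: `G`-monoids -/

section GMonoids

variable {G : Type w} [Group G] {J : ℕ → Type*} [∀ n, Group (J n)] [CrossedFamily J] {n m : ℕ}

theorem pull_label (φ : Fin n →o Fin 1) (g : G) : pull φ (label J g) =
    (SemidirectProduct.inl fun _ => g : Wreath G J n) :=
  Wreath.ext_iff'.2 ⟨fun _ => rfl, CrossedFamily.pull_one φ⟩

theorem inl_const_add (g : G) : (SemidirectProduct.inl fun _ => g : Wreath G J (1 + 1)) =
    CrossedFamily.place (N := 1 + 1) 0 (by omega) (label J g) *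
      CrossedFamily.place 1 le_rfl (label J g) := inl_succ _

/-- Cabling copies labels: pulled back along 2 → 1, the label `g` appears on both strands, which is
multiplicativity. Pulled back along 0 → 1 it disappears, which is preservation of the unit. -/
instance (g : G) : IsMonHom (C := DTensor (Wreath G J)) (M := pt (Wreath G J))
    (eltHom (label J g)) where
  one_hom := hom_one_ext (by
    rw [comp_elt]
    change CrossedFamily.pull (bang 0) (label J g) * 1 = 1
    rw [pull_label, mul_one, Subsingleton.elim (fun _ : Fin 0 => g) 1, map_one])
  mul_hom := hom_one_ext (by
    rw [comp_elt, comp_elt, tensorHom_elt]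
    change CrossedFamily.pull (bang (1 + 1)) (label J g) * 1 = CrossedFamily.pull _ 1 *
      (CrossedFamily.place 0 _ (label J g) * CrossedFamily.place 1 _ (label J g))
    rw [pull_label, mul_one, CrossedFamily.pull_one, one_mul, inl_const_add])

variable (G J) in
/-- The generating `G`-monoid of `D ⊗ J ⊗ G`. -/
def ptGMon : GMon G (DTensor (Wreath G J)) where
  obj _ := .mk (pt (Wreath G J))
  map g := .mk (eltHom (label J g))
  map_id _ := Mon.Hom.ext (congrArg eltHom (map_one (label J)))
  -- Composition in `SingleObj G` reverses products, and so does `eltHom`; hence the swapped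
  -- arguments `h g` and a covariant functor.
  map_comp g h := Mon.Hom.ext ((congrArg eltHom (map_mul (label J) h g)).trans (eltHom_mul _ _))

variable {B : Type u} [Category.{v} B] [MonoidalCategory B] [BraidedCategory B]
  [BalancedCategory B]

variable (G J B) in
/-- The functor that sends an algebra to its underlying `G`-monoid. -/
def gmonFunctor : BalancedAlgebra (DTensor (Wreath G J)) B ⥤ GMon G B where
  obj F := ptGMon G J ⋙ F.functor.mapMon
  map τ := Functor.whiskerLeft _ (Functor.mapMonNatTrans (BalancedAlgebra.Hom.natTrans τ))
  map_id _ := rfl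
  map_comp _ _ := rfl

instance : (gmonFunctor G J B).Faithful where
  map_injective h := hom_ext_of_app_pt
    (congrArg (fun α => Mon.Hom.hom (NatTrans.app α (SingleObj.star G))) h)

theorem gmonFunctor_full (hJ : IsGeneratedBy (∅ : Set (J 1))) : (gmonFunctor G J B).Full where
  map_surjective {F F'} f := by
    obtain ⟨τ, hτ⟩ := exists_hom_of_isGeneratedBy (Wreath.isGeneratedBy_range_label (G := G) hJ)
      (f.app (SingleObj.star G)).hom
      -- Naturality of `f` in the one-object category is precisely its compatibility with the
      -- generators `label J g`.
      (by
        rintro _ ⟨g, rfl⟩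
        exact congrArg Mon.Hom.hom (f.naturality (X := SingleObj.star G) (Y := SingleObj.star G) g))
      (IsMonHom.one_hom (f.app (SingleObj.star G)).hom)
      (IsMonHom.mul_hom (f.app (SingleObj.star G)).hom)
    exact ⟨τ, NatTrans.ext (funext fun _ => Mon.Hom.ext hτ)⟩

end GMonoids
end RibbonPROB

namespace RibbonPROB

open MonoidalCategory DTensor CrossedFamily RibbonPROB.TensorPower

/-! ### Transport of monoids and group actions along the left unitor -/

section PowMon

variable {B : Type u} [Category.{v} B] [MonoidalCategory B] (M : B) [MonObj M]

/-- The monoid structure on the first tensor power of a monoid. -/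
def PowMon.ofMon : PowMon M :=
  letI : MonObj (pow M 1) := .ofIso (λ_ M).symm
  PowMon.ofMonObj

theorem PowMon.ofMon_one : (PowMon.ofMon M).one = MonObj.one ≫ (λ_ M).inv := rfl

theorem PowMon.ofMon_mul : (PowMon.ofMon M).mul =
    (mu M 1 1).inv ≫ ((λ_ M).hom ⊗ₘ (λ_ M).hom) ≫ MonObj.mul ≫ (λ_ M).inv := rfl

theorem PowMon.ofMon_one_comp : (PowMon.ofMon M).one ≫ (λ_ M).hom = MonObj.one := by
  rw [PowMon.ofMon_one, Category.assoc, Iso.inv_hom_id, Category.comp_id]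

theorem PowMon.ofMon_mul_comp : ((mu M 1 1).hom ≫ (PowMon.ofMon M).mul) ≫ (λ_ M).hom =
    ((λ_ M).hom ⊗ₘ (λ_ M).hom) ≫ MonObj.mul := by
  rw [PowMon.ofMon_mul, Iso.hom_inv_id_assoc, Category.assoc, Category.assoc, Iso.inv_hom_id,
    Category.comp_id]

end PowMon

section GMonAut

variable {B : Type u} [Category.{v} B] [MonoidalCategory B] {G : Type w} [Group G] (H : GMon G B)

/-- The automorphisms of a `G`-monoid. -/
def gmonAut : G →* Aut (H.obj (SingleObj.star G)).X where
  toFun g :=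
    { hom := (H.map (X := SingleObj.star G) (Y := SingleObj.star G) g).hom
      inv := (H.map (X := SingleObj.star G) (Y := SingleObj.star G) g⁻¹).hom
      hom_inv_id := congrArg Mon.Hom.hom
        ((H.map_comp (X := SingleObj.star G) (Y := SingleObj.star G) (Z := SingleObj.star G) g
          g⁻¹).symm.trans ((congrArg H.map (inv_mul_cancel g)).trans (H.map_id (SingleObj.star G))))
      inv_hom_id := congrArg Mon.Hom.hom
        ((H.map_comp (X := SingleObj.star G) (Y := SingleObj.star G) (Z := SingleObj.star G) g⁻¹
          g).symm.trans ((congrArg H.map (mul_inv_cancel g)).trans (H.map_id (SingleObj.star G)))) }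
  map_one' := Iso.ext (congrArg Mon.Hom.hom (H.map_id (SingleObj.star G)))
  map_mul' g h := Iso.ext (congrArg Mon.Hom.hom (H.map_comp (X := SingleObj.star G)
    (Y := SingleObj.star G) (Z := SingleObj.star G) h g))

/-- The automorphisms of the first tensor power of a `G`-monoid. -/
def gmonPowAut : G →* Aut (pow (H.obj (SingleObj.star G)).X 1) :=
  ((λ_ (H.obj (SingleObj.star G)).X).symm.conjAut.toMonoidHom).comp (gmonAut H)

theorem gmonPowAut_hom (g : G) : (gmonPowAut H g).hom =
    (λ_ (H.obj (SingleObj.star G)).X).hom ≫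
      (H.map (X := SingleObj.star G) (Y := SingleObj.star G) g).hom ≫
      (λ_ (H.obj (SingleObj.star G)).X).inv := rfl

theorem gmonPowAut_hom_comp (g : G) : (gmonPowAut H g).hom ≫ (λ_ _).hom =
    (λ_ (H.obj (SingleObj.star G)).X).hom ≫
      (H.map (X := SingleObj.star G) (Y := SingleObj.star G) g).hom := by
  rw [gmonPowAut_hom, Category.assoc, Category.assoc, Iso.inv_hom_id, Category.comp_id]

end GMonAut

/-! ### Essential surjectivity -/

section EssSurj

open Functor.LaxMonoidal

variable {B : Type u} [Category.{v} B] [MonoidalCategory B] [BraidedCategory B]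
  [BalancedCategory B]

section PowAlgebra

variable {M : B} {J : ℕ → Type*} [∀ n, Group (J n)] [CrossedFamily J]
  (R : BlockRep M J) (S : PowMon M) (hRS : ∀ {m : ℕ} (j : J m), R.Exchange S j)

theorem powAlgebra_map_ordHom_bang (n : ℕ) :
    (powAlgebra R S hRS).functor.map (ordHom (X := ⟨n⟩) (Y := pt J) (bang n)) = S.multi n := by
  change (R.rep n 1).hom ≫ S.mulMap (bang n) = _
  rw [map_one, PowMon.mulMap_bang]
  exact Category.id_comp _

theorem powAlgebra_map_eltHom {n : ℕ} (j : J n) :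
    (powAlgebra R S hRS).functor.map (eltHom j) = (R.rep n j).hom := by
  refine (powFunctor_map_isoHom R S hRS _ _).trans ?_
  rw [pcast_rfl]
  exact Category.comp_id _

theorem powAlgebra_one : ε (powAlgebra R S hRS).functor ≫ (powAlgebra R S hRS).functor.map
    (MonObj.one : 𝟙_ (DTensor J) ⟶ pt J) = S.one := by
  refine (congrArg (_ ≫ ·) (powAlgebra_map_ordHom_bang R S hRS 0)).trans ?_
  exact Category.id_comp _

theorem powAlgebra_mul : μ (powAlgebra R S hRS).functor (pt J) (pt J) ≫
    (powAlgebra R S hRS).functor.map (MonObj.mul : pt J ⊗ pt J ⟶ pt J) =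
      (mu M 1 1).hom ≫ S.mul := by
  refine (congrArg (_ ≫ ·) (powAlgebra_map_ordHom_bang R S hRS (1 + 1))).trans ?_
  rw [PowMon.multi_succ, PowMon.multi_one, tens_id]
  exact congrArg (_ ≫ ·) (Category.id_comp _)

end PowAlgebra

/-- The algebra given by a monoid has this monoid as its underlying monoid. -/
def monFunctorPowIso {J : ℕ → Type*} [∀ n, Group (J n)] [CrossedFamily J] (M : B) [MonObj M]
    (R : BlockRep M J) (hR : ∀ {m : ℕ} (j : J m), R.Exchange (PowMon.ofMon M) j) :
    (powAlgebra R (PowMon.ofMon M) hR).functor.mapMon.obj (.mk (pt J)) ≅ .mk M :=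
  have : IsMonHom (M := ((powAlgebra R (PowMon.ofMon M) hR).functor.mapMon.obj (.mk (pt J))).X)
      (λ_ M).hom :=
    { one_hom := by
        refine (congrArg (· ≫ _) (powAlgebra_one R (PowMon.ofMon M) hR)).trans ?_
        exact PowMon.ofMon_one_comp M
      mul_hom := by
        refine (congrArg (· ≫ _) (powAlgebra_mul R (PowMon.ofMon M) hR)).trans ?_
        exact PowMon.ofMon_mul_comp M }
  Mon.mkIso' (M := ((powAlgebra R (PowMon.ofMon M) hR).functor.mapMon.obj (.mk (pt J))).X) (λ_ M)

/-- There are no extra generators to check, so every monoid structure on the first tensor power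
satisfies the exchange law. -/
theorem rbBlockRep_exchange (M : B) (S : PowMon M) {m : ℕ} (j : RB m) :
    (rbBlockRep M).Exchange S j :=
  BlockRep.exchange_of_isGeneratedBy _ _ RB.isGeneratedBy_empty (fun _ h => h.elim) j

/-- The algebra of `D ⊗ RB` given by a monoid. -/
def algebraOfMon (M : Mon B) : BalancedAlgebra DRB B :=
  powAlgebra (rbBlockRep M.X) (PowMon.ofMon M.X) (rbBlockRep_exchange _ _)

/-- The monoid of `algebraOfMon M` is `M`. -/
def algebraOfMonIso (M : Mon B) : (monFunctor B RB).obj (algebraOfMon M) ≅ M :=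
  monFunctorPowIso M.X (rbBlockRep M.X) (rbBlockRep_exchange _ _)

variable {G : Type w} [Group G] (H : GMon G B)

/-- The action of the labelled ribbon braid groups on the tensor powers of a `G`-monoid. -/
def gmonBlockRep : BlockRep (H.obj (SingleObj.star G)).X (Wreath G RB) :=
  (rbBlockRep _).wreath (gmonPowAut H) RB.isGeneratedBy_empty

/-- It suffices to treat labels. They act by monoid morphisms, and this persists after the
conjugation by the left unitor that defines `gmonPowAut` and `PowMon.ofMon`. -/
theorem gmonBlockRep_exchange {m : ℕ} (j : Wreath G RB m) :
    (gmonBlockRep H).Exchange (PowMon.ofMon _) j := by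
  refine BlockRep.exchange_of_isGeneratedBy _ _
    (Wreath.isGeneratedBy_range_label RB.isGeneratedBy_empty) ?_ j
  rintro _ ⟨g, rfl⟩
  refine BlockRep.exchange_label _ _ _ _ g ?_ ?_
  · rw [PowMon.ofMon_one, gmonPowAut_hom, Category.assoc, Iso.inv_hom_id_assoc,
      IsMonHom.one_hom_assoc]
  · rw [PowMon.ofMon_mul, ← cancel_epi (mu _ 1 1).hom, mu_tens_assoc, gmonPowAut_hom]
    simp only [Category.assoc, Iso.inv_hom_id_assoc, Iso.hom_inv_id_assoc, IsMonHom.mul_hom_assoc,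
      tensorHom_comp_tensorHom_assoc, Iso.inv_hom_id, Category.comp_id]

/-- The algebra of `D ⊗ RB ⊗ G` given by a `G`-monoid. -/
def algebraOfGMon : BalancedAlgebra (DRBG G) B :=
  powAlgebra (gmonBlockRep H) (PowMon.ofMon _) (gmonBlockRep_exchange H)

/-- The `G`-monoid of `algebraOfGMon H` is `H`. -/
def algebraOfGMonIso : (gmonFunctor G RB B).obj (algebraOfGMon H) ≅ H :=
  NatIso.ofComponents (fun _ => monFunctorPowIso _ (gmonBlockRep H) (gmonBlockRep_exchange H)) (by
    intro X Y g
    refine Mon.Hom.ext ?_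
    -- On the generator the label `g` acts by the conjugate of the given action, so the left unitor
    -- is equivariant.
    have e : (algebraOfGMon H).functor.map (eltHom (label RB g)) = (gmonPowAut H g).hom :=
      (powAlgebra_map_eltHom _ _ _ _).trans (congrArg Iso.hom (BlockRep.wreath_rep_label ..))
    exact (congrArg (· ≫ _) e).trans (gmonPowAut_hom_comp H g))

end EssSurj

/-! ### The equivalences for monoids and `G`-monoids -/

section Equivalences

variable (B : Type u) [Category.{v} B] [MonoidalCategory B] [BraidedCategory B]
  [BalancedCategory B] (G : Type w) [Group G]

instance : (monFunctor B RB).IsEquivalence where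
  full := monFunctor_full RB.isGeneratedBy_empty
  essSurj := ⟨fun M => ⟨_, ⟨algebraOfMonIso M⟩⟩⟩

instance : (gmonFunctor G RB B).IsEquivalence where
  full := gmonFunctor_full RB.isGeneratedBy_empty
  essSurj := ⟨fun M => ⟨_, ⟨algebraOfGMonIso M⟩⟩⟩

/-- The underlying monoid of a strict algebra. -/
abbrev strictMonFunctor : StrictBalancedAlgebra DRB B ⥤ Mon B :=
  ObjectProperty.ι _ ⋙ monFunctor B RB

/-- The underlying `G`-monoid of a strict algebra. -/
abbrev strictGMonFunctor : StrictBalancedAlgebra (DRBG G) B ⥤ GMon G B :=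
  ObjectProperty.ι _ ⋙ gmonFunctor G RB B

/-- Full faithfulness restricts to the full subcategory of strict algebras. Essential surjectivity
survives because the algebra of tensor powers used before is itself strict. -/
theorem strictMonFunctor_isEquivalence [StrictMonoidalCategory B] :
    (strictMonFunctor B).IsEquivalence where
  essSurj := ⟨fun M => ⟨⟨algebraOfMon M,
    powAlgebra_isStrict _ _ (rbBlockRep_exchange _ _)⟩, ⟨algebraOfMonIso M⟩⟩⟩

theorem strictGMonFunctor_isEquivalence [StrictMonoidalCategory B] :
    (strictGMonFunctor B G).IsEquivalence where
  essSurj := ⟨fun M => ⟨⟨algebraOfGMon M,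
    powAlgebra_isStrict _ _ (gmonBlockRep_exchange M)⟩, ⟨algebraOfGMonIso M⟩⟩⟩

end Equivalences
end RibbonPROB

namespace RibbonPROB

open MonoidalCategory Opposite Functor.LaxMonoidal Functor.OplaxMonoidal

/-! ### Passage to opposite categories -/

section Opposite

universe u' v'

variable {Q : Type u'} [Category.{v'} Q] [MonoidalCategory Q] {B : Type u} [Category.{v} B]
  [MonoidalCategory B]

/-- The opposite of a monoidal functor, with values in an opposite category. -/
def leftOpCoreMonoidal (F : Q ⥤ Bᵒᵖ) [F.Monoidal] : F.leftOp.CoreMonoidal where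
  εIso := (Functor.Monoidal.εIso F).symm.unop
  μIso X Y := (Functor.Monoidal.μIso F X.unop Y.unop).symm.unop
  μIso_hom_natural_left f X := Quiver.Hom.op_inj (δ_natural_left F f.unop X.unop)
  μIso_hom_natural_right X f := Quiver.Hom.op_inj (δ_natural_right F X.unop f.unop)
  associativity X Y Z := Quiver.Hom.op_inj ((Category.assoc _ _ _).trans
    ((Functor.OplaxMonoidal.associativity_inv F X.unop Y.unop Z.unop).symm.trans (Category.assoc _ _ _).symm))
  left_unitality X := Quiver.Hom.op_inj
    ((Functor.OplaxMonoidal.left_unitality F X.unop).trans (Category.assoc _ _ _).symm)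
  right_unitality X := Quiver.Hom.op_inj
    ((Functor.OplaxMonoidal.right_unitality F X.unop).trans (Category.assoc _ _ _).symm)

/-- The opposite of a monoidal functor on an opposite category. -/
def rightOpCoreMonoidal (F : Qᵒᵖ ⥤ B) [F.Monoidal] : F.rightOp.CoreMonoidal where
  εIso := (Functor.Monoidal.εIso F).symm.op
  μIso X Y := (Functor.Monoidal.μIso F (op X) (op Y)).symm.op
  μIso_hom_natural_left f X := Quiver.Hom.unop_inj (δ_natural_left F f.op (op X))
  μIso_hom_natural_right X f := Quiver.Hom.unop_inj (δ_natural_right F (op X) f.op)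
  associativity X Y Z := Quiver.Hom.unop_inj ((Category.assoc _ _ _).trans
    ((Functor.OplaxMonoidal.associativity_inv F (op X) (op Y) (op Z)).symm.trans (Category.assoc _ _ _).symm))
  left_unitality X := Quiver.Hom.unop_inj
    ((Functor.OplaxMonoidal.left_unitality F (op X)).trans (Category.assoc _ _ _).symm)
  right_unitality X := Quiver.Hom.unop_inj
    ((Functor.OplaxMonoidal.right_unitality F (op X)).trans (Category.assoc _ _ _).symm)

/-- Braidedness stated with the inverse structure maps. Reversing arrows exchanges the lax and oplax
maps, so this is what the opposite functor has to satisfy. -/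
theorem map_braiding_δ {C : Type u} [Category.{v} C] [MonoidalCategory C] [BraidedCategory C]
    {D : Type u'} [Category.{v'} D] [MonoidalCategory D] [BraidedCategory D] (F : C ⥤ D)
    [F.Braided] (X Y : C) : F.map (β_ X Y).hom ≫ δ F Y X = δ F X Y ≫ (β_ _ _).hom := by
  rw [Functor.map_braiding, Category.assoc, Category.assoc, Functor.Monoidal.μ_δ, Category.comp_id]

/-- Together with `tensor_δ`, the form of monoidality of a transformation that becomes the usual one
after reversing arrows. -/
theorem unit_η {C : Type u} [Category.{v} C] [MonoidalCategory C] {D : Type u'} [Category.{v'} D]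
    [MonoidalCategory D] {F F' : C ⥤ D} [F.Monoidal] [F'.Monoidal] (τ : F ⟶ F')
    [NatTrans.IsMonoidal τ] : τ.app (𝟙_ C) ≫ η F' = η F := by
  rw [← cancel_epi (ε F), NatTrans.IsMonoidal.unit_assoc, Functor.Monoidal.ε_η,
    Functor.Monoidal.ε_η]

theorem tensor_δ {C : Type u} [Category.{v} C] [MonoidalCategory C] {D : Type u'} [Category.{v'} D]
    [MonoidalCategory D] {F F' : C ⥤ D} [F.Monoidal] [F'.Monoidal] (τ : F ⟶ F')
    [NatTrans.IsMonoidal τ] (X Y : C) :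
    τ.app (X ⊗ Y) ≫ δ F' X Y = δ F X Y ≫ (τ.app X ⊗ₘ τ.app Y) := by
  rw [← cancel_epi (μ F X Y), NatTrans.IsMonoidal.tensor_assoc, Functor.Monoidal.μ_δ,
    Functor.Monoidal.μ_δ_assoc, Category.comp_id]

variable [BraidedCategory Q] [BalancedCategory Q] [BraidedCategory B] [BalancedCategory B]

/-- The algebra of `Qᵒᵖ` given by an algebra of `Q` in the opposite category. -/
def BalancedAlgebra.leftOp (F : BalancedAlgebra Q Bᵒᵖ) : BalancedAlgebra Qᵒᵖ B where
  functor := F.functor.leftOp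
  braided :=
    { toMonoidal := (leftOpCoreMonoidal F.functor).toMonoidal
      braided := fun X Y => Quiver.Hom.op_inj (map_braiding_δ F.functor Y.unop X.unop) }
  map_twist X := congrArg Quiver.Hom.unop (F.map_twist X.unop)

/-- The algebra in the opposite category given by an algebra of `Qᵒᵖ`. -/
def BalancedAlgebra.rightOp (F : BalancedAlgebra Qᵒᵖ B) : BalancedAlgebra Q Bᵒᵖ where
  functor := F.functor.rightOp
  braided :=
    { toMonoidal := (rightOpCoreMonoidal F.functor).toMonoidal
      braided := fun X Y => Quiver.Hom.unop_inj (map_braiding_δ F.functor (op Y) (op X)) }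
  map_twist X := congrArg Quiver.Hom.op (F.map_twist (op X))

variable (Q B) in
/-- The passage from algebras in the opposite category to algebras of the opposite category. -/
def leftOpFunctor : (BalancedAlgebra Q Bᵒᵖ)ᵒᵖ ⥤ BalancedAlgebra Qᵒᵖ B where
  obj F := F.unop.leftOp
  map {F F'} τ :=
    have : NatTrans.IsMonoidal (F₁ := F.unop.leftOp.functor) (F₂ := F'.unop.leftOp.functor)
        (NatTrans.leftOp (BalancedAlgebra.Hom.natTrans τ.unop)) :=
      { unit := Quiver.Hom.op_inj (unit_η (BalancedAlgebra.Hom.natTrans τ.unop))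
        tensor := fun X Y => Quiver.Hom.op_inj
          (tensor_δ (BalancedAlgebra.Hom.natTrans τ.unop) X.unop Y.unop) }
    ⟨NatTrans.leftOp (BalancedAlgebra.Hom.natTrans τ.unop)⟩
  map_id _ := rfl
  map_comp _ _ := rfl

instance : (leftOpFunctor Q B).Faithful where
  map_injective {F F'} _ _ h := Quiver.Hom.unop_inj (BalancedAlgebra.Hom.ext (NatTrans.ext
    (funext fun X => Quiver.Hom.unop_inj (congrArg
      (fun σ : F.unop.leftOp ⟶ F'.unop.leftOp => (BalancedAlgebra.Hom.natTrans σ).app (op X)) h))))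

instance : (leftOpFunctor Q B).Full where
  map_surjective {F F'} σ := by
    let τ : F'.unop.functor ⟶ F.unop.functor :=
      { app := fun X => ((BalancedAlgebra.Hom.natTrans σ).app (op X)).op
        naturality := fun X Y f =>
          Quiver.Hom.unop_inj ((BalancedAlgebra.Hom.natTrans σ).naturality f.op).symm }
    have : NatTrans.IsMonoidal τ :=
      { unit := Quiver.Hom.unop_inj (unit_η (BalancedAlgebra.Hom.natTrans σ))
        tensor := fun X Y => Quiver.Hom.unop_inj
          (tensor_δ (BalancedAlgebra.Hom.natTrans σ) (op X) (op Y)) }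
    exact ⟨Quiver.Hom.op ⟨τ⟩, rfl⟩

/-- Every algebra of the opposite category comes from the opposite of an algebra. -/
def leftOpRightOpIso (F : BalancedAlgebra Qᵒᵖ B) : F.rightOp.leftOp ≅ F where
  hom :=
    -- Passing to the opposite twice inverts the structure maps twice and gives back the original
    -- ones definitionally, so the identity transformation is monoidal.
    have : NatTrans.IsMonoidal (F₁ := F.rightOp.leftOp.functor) (F₂ := F.functor) (𝟙 F.functor) :=
      { unit := Category.comp_id _
        tensor := fun X Y => (Category.comp_id _).trans ((Category.id_comp _).symm.trans
          (congrArg (· ≫ μ F.functor X Y) (id_tensorHom_id _ _).symm)) }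
    BalancedAlgebra.Hom.mk (F := F.rightOp.leftOp) (F' := F) (𝟙 F.functor)
  inv :=
    have : NatTrans.IsMonoidal (F₁ := F.functor) (F₂ := F.rightOp.leftOp.functor) (𝟙 F.functor) :=
      { unit := Category.comp_id _
        tensor := fun X Y => (Category.comp_id _).trans ((Category.id_comp _).symm.trans
          (congrArg (· ≫ μ F.functor X Y) (id_tensorHom_id _ _).symm)) }
    BalancedAlgebra.Hom.mk (F := F) (F' := F.rightOp.leftOp) (𝟙 F.functor)
  hom_inv_id := BalancedAlgebra.Hom.ext (Category.comp_id _)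
  inv_hom_id := BalancedAlgebra.Hom.ext (Category.comp_id _)

instance : (leftOpFunctor Q B).IsEquivalence where
  essSurj := ⟨fun F => ⟨op F.rightOp, ⟨leftOpRightOpIso F⟩⟩⟩

/-- Opposite structures use inverse structure maps; this carries strictness over to them. -/
theorem inv_eq_eqToHom {C : Type u} [Category.{v} C] {X Y : C} (e : X ≅ Y) (h : X = Y)
    (he : e.hom = eqToHom h) : e.inv = eqToHom h.symm := by
  subst h
  rw [← cancel_epi e.hom, e.hom_inv_id, he, eqToHom_trans, eqToHom_refl]

instance {B : Type u} [Category.{v} B] [MonoidalCategory B] [StrictMonoidalCategory B] :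
    StrictMonoidalCategory Bᵒᵖ where
  tensor_assoc X Y Z := congrArg op (StrictMonoidalCategory.tensor_assoc X.unop Y.unop Z.unop)
  unit_tensor X := congrArg op (StrictMonoidalCategory.unit_tensor X.unop)
  tensor_unit X := congrArg op (StrictMonoidalCategory.tensor_unit X.unop)
  associator_hom X Y Z := (congrArg Quiver.Hom.op (inv_eq_eqToHom _ _
    (StrictMonoidalCategory.associator_hom X.unop Y.unop Z.unop))).trans (eqToHom_op _)
  leftUnitor_hom X := (congrArg Quiver.Hom.op (inv_eq_eqToHom _ _
    (StrictMonoidalCategory.leftUnitor_hom X.unop))).trans (eqToHom_op _)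
  rightUnitor_hom X := (congrArg Quiver.Hom.op (inv_eq_eqToHom _ _
    (StrictMonoidalCategory.rightUnitor_hom X.unop))).trans (eqToHom_op _)

theorem BalancedAlgebra.IsStrict.leftOp {F : BalancedAlgebra Q Bᵒᵖ} (h : F.IsStrict) :
    F.leftOp.IsStrict where
  obj_unit := congrArg unop h.obj_unit
  obj_tensor X Y := congrArg unop (h.obj_tensor X.unop Y.unop)
  ε_eq := (congrArg Quiver.Hom.unop (inv_eq_eqToHom (Functor.Monoidal.εIso F.functor) _
    h.ε_eq)).trans (eqToHom_unop _)
  μ_eq X Y := (congrArg Quiver.Hom.unop (inv_eq_eqToHom (Functor.Monoidal.μIso F.functor _ _) _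
    (h.μ_eq X.unop Y.unop))).trans (eqToHom_unop _)

theorem BalancedAlgebra.IsStrict.rightOp {F : BalancedAlgebra Qᵒᵖ B} (h : F.IsStrict) :
    F.rightOp.IsStrict where
  obj_unit := congrArg op h.obj_unit
  obj_tensor X Y := congrArg op (h.obj_tensor (op X) (op Y))
  ε_eq := (congrArg Quiver.Hom.op (inv_eq_eqToHom (Functor.Monoidal.εIso F.functor) _
    h.ε_eq)).trans (eqToHom_op _)
  μ_eq X Y := (congrArg Quiver.Hom.op (inv_eq_eqToHom (Functor.Monoidal.μIso F.functor _ _) _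
    (h.μ_eq (op X) (op Y)))).trans (eqToHom_op _)

variable (Q B) in
/-- The passage from strict algebras in the opposite category to strict algebras of the opposite
category. -/
def strictLeftOpFunctor : (StrictBalancedAlgebra Q Bᵒᵖ)ᵒᵖ ⥤ StrictBalancedAlgebra Qᵒᵖ B :=
  ObjectProperty.lift _ ((ObjectProperty.ι _).op ⋙ leftOpFunctor Q B) fun F => F.unop.property.leftOp

/-- Followed by the inclusion of strict algebras, this functor is a restriction of `leftOpFunctor`
to a full subcategory, which gives full faithfulness. The preimage `rightOp` of a strict algebra is
again strict. -/
instance : (strictLeftOpFunctor Q B).IsEquivalence where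
  faithful :=
    have : (strictLeftOpFunctor Q B ⋙ ObjectProperty.ι _).Faithful :=
      inferInstanceAs ((ObjectProperty.ι _).op ⋙ leftOpFunctor Q B).Faithful
    Functor.Faithful.of_comp _ (ObjectProperty.ι _)
  full :=
    have : (strictLeftOpFunctor Q B ⋙ ObjectProperty.ι _).Full :=
      inferInstanceAs ((ObjectProperty.ι _).op ⋙ leftOpFunctor Q B).Full
    Functor.Full.of_comp_faithful _ (ObjectProperty.ι _)
  essSurj := ⟨fun F => ⟨op ⟨F.obj.rightOp, F.property.rightOp⟩,
    ⟨ObjectProperty.isoMk _ (leftOpRightOpIso F.obj)⟩⟩⟩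

end Opposite

/-- `G`-comonoids are the opposite of `G`-monoids in the opposite category. -/
def gcomonEquiv (G : Type w) [Group G] (B : Type u) [Category.{v} B] [MonoidalCategory B] :
    GComon G B ≌ (GMon G Bᵒᵖ)ᵒᵖ :=
  -- Comonoids become monoids in `Bᵒᵖ`, up to passing to the opposite category. A functor with
  -- values in an opposite category is then a functor on the opposite of `G`, which inversion
  -- identifies with `G`.
  (Comon.Comon_EquivMon_OpOp B).congrRight.trans
    ((Functor.leftOpRightOpEquiv (SingleObj G) (Mon Bᵒᵖ)).symm.trans
      (Groupoid.invEquivalence (C := SingleObj G)).symm.congrLeft.op)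

end RibbonPROB

theorem mainTheorem6 (B : Type u) [Category.{v} B] [MonoidalCategory B] [BraidedCategory B]
    [BalancedCategory B] (G : Type w) [Group G] :
    (Nonempty (BalancedAlgebra DRB B ≌ Mon B) ∧
      Nonempty (BalancedAlgebra (DRBG G) B ≌ GMon G B) ∧
      Nonempty (BalancedAlgebra DRBᵒᵖ B ≌ Comon B) ∧
      Nonempty (BalancedAlgebra (DRBG G)ᵒᵖ B ≌ GComon G B)) ∧
    (StrictMonoidalCategory B →
      Nonempty (StrictBalancedAlgebra DRB B ≌ Mon B) ∧
      Nonempty (StrictBalancedAlgebra (DRBG G) B ≌ GMon G B) ∧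
      Nonempty (StrictBalancedAlgebra DRBᵒᵖ B ≌ Comon B) ∧
      Nonempty (StrictBalancedAlgebra (DRBG G)ᵒᵖ B ≌ GComon G B)) := by
  refine ⟨⟨⟨(monFunctor B RB).asEquivalence⟩, ⟨(gmonFunctor G RB B).asEquivalence⟩,
    -- The statements for comonoids are those for monoids in `Bᵒᵖ`, with both sides passed to
    -- opposite categories.
    ⟨(leftOpFunctor DRB B).asEquivalence.symm.trans
      ((monFunctor Bᵒᵖ RB).asEquivalence.op.trans (Comon.Comon_EquivMon_OpOp B).symm)⟩,
    ⟨(leftOpFunctor (DRBG G) B).asEquivalence.symm.trans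
      ((gmonFunctor G RB Bᵒᵖ).asEquivalence.op.trans (gcomonEquiv G B).symm)⟩⟩, fun _ => ?_⟩
  have := strictMonFunctor_isEquivalence B
  have := strictGMonFunctor_isEquivalence B G
  -- The opposite of a strict monoidal category is strict, so the strict results apply to `Bᵒᵖ` as
  -- well.
  have := strictMonFunctor_isEquivalence Bᵒᵖ
  have := strictGMonFunctor_isEquivalence Bᵒᵖ G
  exact ⟨⟨(strictMonFunctor B).asEquivalence⟩, ⟨(strictGMonFunctor B G).asEquivalence⟩,
    ⟨(strictLeftOpFunctor DRB B).asEquivalence.symm.trans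
      ((strictMonFunctor Bᵒᵖ).asEquivalence.op.trans (Comon.Comon_EquivMon_OpOp B).symm)⟩,
    ⟨(strictLeftOpFunctor (DRBG G) B).asEquivalence.symm.trans
      ((strictGMonFunctor Bᵒᵖ G).asEquivalence.op.trans (gcomonEquiv G B).symm)⟩⟩
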